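/- Let $(\mathcal A,\mathcal H,D)$ be a regular (odd) spectral triple with $D$ invertible: $\mathcal A$ is a unital $*$-algebra represented on the Hilbert space $\mathcal H$ by bounded operators, $D$ is self-adjoint with compact inverse, all commutators $[D,a]$ are bounded, and the algebra generated by $\mathcal A$ and $[D,\mathcal A]$ lies in $\bigcap_n \mathrm{Dom}\,\delta^n$, where $\delta(T)=|D|T-T|D|$. Put $F=D|D|^{-1}$, $P=\frac12(1+F)$, $\nabla(T)=[D^2,T]$, and let $\Psi^0(\mathcal A)$ be the algebra generated by all $\delta^k(a)$ and $\delta^k([D,a])$, $a\in\mathcal A$, $k\ge 0$. For an operator $T$ on $\mathcal H^\infty=\bigcap_n\mathrm{Dom}\,D^n$ write $\zeta_T(z)=\mathrm{Tr}(T|D|^{-z})$ for $\mathrm{Re}\,z$ large, and also for its meromorphic continuation, and put $${\int\!\!\!\!\!-}\, T:=\mathrm{Res}_{z=0}\,\mathrm{Tr}(T|D|^{-z}).$$ Assume that the dimension spectrum is simple and discrete, does not contain $0$ and is bounded above by $3$: there is a closed discrete set $\Sigma\subset\mathbb C$ with $0\notin\Sigma$ and $\mathrm{Re}\,s\le 3$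 for all $s\in\Sigma$, such that for every $T\in\Psi^0(\mathcal A)$ the functions $\zeta_T$ and $\zeta_{TF}$ are given by the trace on some right half-plane and continue analytically to $\mathbb C\setminus\Sigma$ with at most simple poles in $\Sigma$. Assume also that $[F,a]$ is trace class for all $a\in\mathcal A$. Let $\phi_{\rm odd}=(\phi_1,\phi_3)$ be the local Chern character $$\phi_1(a_0,a_1)={\int\!\!\!\!\!-}\, a_0[D,a_1]|D|^{-1}-\tfrac14{\int\!\!\!\!\!-}\, a_0\nabla([D,a_1])|D|^{-3}+\tfrac18{\int\!\!\!\!\!-}\, a_0\nabla^2([D,a_1])|D|^{-5},$$ $$\phi_3(a_0,a_1,a_2,a_3)=\tfrac1{12}{\int\!\!\!\!\!-}\, a_0[D,a_1][D,a_2][D,a_3]|D|^{-3},$$ and set $$\psi_1(a_0,a_1)=2{\int\!\!\!\!\!-}\, a_0\delta(a_1)P|D|^{-1}-{\int\!\!\!\!\!-}\, a_0\delta^2(a_1)P|D|^{-2}+\tfrac23{\int\!\!\!\!\!-}\, a_0\delta^3(a_1)P|D|^{-3},$$ $$\phi'_0(a)=\mathrm{Tr}(a|D|^{-z})\big|_{z=0},\qquad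 \phi'_2(a_0,a_1,a_2)=-\tfrac1{24}{\int\!\!\!\!\!-}\, a_0\delta(a_1)\delta^2(a_2)F|D|^{-3},\qquad \phi'_{\rm ev}=(\phi'_0,\phi'_2).$$ Then all these residues and values exist and define multilinear cochains on $\mathcal A$, $\psi_1$ is a cyclic $1$-cocycle (that is, $\psi_1(a_0,a_1)=-\psi_1(a_1,a_0)$ and $b\psi_1=0$), and $$\phi_{\rm odd}=\psi_1-(b+B)\phi'_{\rm ev},$$ that is, $\phi_1+b\phi'_0+B\phi'_2=\psi_1$ and $\phi_3+b\phi'_2=0$. Here, for an $n$-cochain $\varphi$, $$b\varphi(a_0,\dots,a_{n+1})=\sum_{j=0}^n(-1)^j\varphi(a_0,\dots,a_ja_{j+1},\dots,a_{n+1})+(-1)^{n+1}\varphi(a_{n+1}a_0,a_1,\dots,a_n),$$ and $B=NB_0$ with $B_0\varphi(a_0,\dots,a_{n-1})=\varphi(1,a_0,\dots,a_{n-1})-(-1)^n\varphi(a_0,\dots,a_{n-1},1)$ and $N\psi(a_0,\dots,a_{n-1})=\sum_{j=0}^{n-1}(-1)^{(n-1)j}\psi(a_j,\dots,a_{n-1},a_0,\dots,a_{j-1})$.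 -/

import Mathlib

open Filter Topology

noncomputable section

namespace LocalIndex

/-! ### Trace class operators and the trace -/

section Trace

variable {H : Type*} [NormedAddCommGroup H] [InnerProductSpace ℂ H] [CompleteSpace H]

/-- Trace class operators on a Hilbert space, as the operators `∑ n, ⟨y n, ·⟩ x n` with
`∑ n, ‖x n‖ ‖y n‖ < ∞`. -/
def IsTraceClass (T : H →L[ℂ] H) : Prop :=
  ∃ x y : ℕ → H, Summable (fun n => ‖x n‖ * ‖y n‖) ∧
    ∀ v : H, HasSum (fun n => inner ℂ (y n) v • x n) (T v)

/-- The trace `∑ ⟨e, T e⟩`, the sum being over an orthonormal basis (for a trace class operator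
it does not depend on the basis). -/
def opTrace (T : H →L[ℂ] H) : ℂ :=
  ∑' e : (exists_hilbertBasis ℂ H).choose, inner ℂ (e : H) (T (e : H))

/-- The bounded operator `T` preserves the domain of `D`, and the commutator `D T - T D`, defined
on the domain of `D`, extends to the bounded operator `S`. -/
def HasBoundedCommutator (D : H →ₗ.[ℂ] H) (T S : H →L[ℂ] H) : Prop :=
  ∀ x : D.domain, ∃ h : T (x : H) ∈ D.domain, D ⟨T (x : H), h⟩ - T (D x) = S (x : H)

end Trace

/-! ### Spectral triples -/

/-- An (odd) spectral triple `(A, H, D)` with invertible `D`: a unital `*`-algebra `A` represented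
by bounded operators on `H`, and a self-adjoint operator `D` with compact inverse and bounded
commutators `[D, a]`. -/
structure SpectralTriple (A : Type*) [Ring A] [StarRing A] [Algebra ℂ A] [StarModule ℂ A]
    (H : Type*) [NormedAddCommGroup H] [InnerProductSpace ℂ H] [CompleteSpace H] where
  /-- the representation of the algebra -/
  π : A →⋆ₐ[ℂ] (H →L[ℂ] H)
  /-- the Dirac operator -/
  D : H →ₗ.[ℂ] H
  isSelfAdjoint_D : IsSelfAdjoint D
  /-- the inverse of `D` -/
  Dinv : H →L[ℂ] H
  isCompact_Dinv : IsCompactOperator Dinv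
  D_Dinv : ∀ x : H, ∃ h : Dinv x ∈ D.domain, D ⟨Dinv x, h⟩ = x
  Dinv_D : ∀ x : D.domain, Dinv (D x) = (x : H)
  bounded_comm : ∀ a : A, ∃ S : H →L[ℂ] H, HasBoundedCommutator D (π a) S

namespace SpectralTriple

variable {A : Type*} [Ring A] [StarRing A] [Algebra ℂ A] [StarModule ℂ A]
  {H : Type*} [NormedAddCommGroup H] [InnerProductSpace ℂ H] [CompleteSpace H]
  (X : SpectralTriple A H)

/-- The bounded operator `|D|^{-z}`, for `Re z > 0`, through the continuous functional calculus
of the compact self-adjoint operator `D⁻¹`. -/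
def absPow (z : ℂ) : H →L[ℂ] H :=
  cfc (fun t : ℂ => (‖t‖ : ℂ) ^ z) X.Dinv

/-- The positive self-adjoint operator `|D|`, the inverse of `|D|^{-1}`. -/
def absD : H →ₗ.[ℂ] H :=
  ((X.absPow 1 : H →ₗ[ℂ] H).toPMap ⊤).inverse

/-- `T` lies in the domain of the `n`-th power of the derivation `δ = [|D|, ·]`. -/
def InDomDelta : ℕ → (H →L[ℂ] H) → Prop
  | 0, _ => True
  | n + 1, T => ∃ S : H →L[ℂ] H, HasBoundedCommutator X.absD T S ∧ InDomDelta n S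

/-- Regularity: the algebra generated by `A` and `[D, A]` lies in the smooth domain of `δ`. -/
def IsRegular : Prop :=
  ∀ T ∈ Algebra.adjoin ℂ
      (Set.range X.π ∪ {S : H →L[ℂ] H | ∃ a : A, HasBoundedCommutator X.D (X.π a) S}),
    ∀ n : ℕ, X.InDomDelta n T

/-- The domain of `D ^ n`. -/
def domPow : ℕ → Submodule ℂ H
  | 0 => ⊤
  | n + 1 => ((domPow n).comap X.D.toFun).map X.D.domain.subtype

/-- The space `H^∞` of smooth vectors, the intersection of the domains of all powers of `D`. -/
def smooth : Submodule ℂ H := ⨅ n, X.domPow n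

/-! The facts below show that `D`, `|D|^{-z}` and smooth operators act on `H^∞`. -/

theorem mem_domPow_succ {n : ℕ} {x : H} :
    x ∈ X.domPow (n + 1) ↔ ∃ h : x ∈ X.D.domain, X.D ⟨x, h⟩ ∈ X.domPow n := by
  simp [domPow]

theorem isSelfAdjoint_Dinv : IsSelfAdjoint X.Dinv := by
  have hd := X.isSelfAdjoint_D.dense_domain
  have hs := LinearPMap.adjoint_isFormalAdjoint (T := X.D) hd
  rw [LinearPMap.isSelfAdjoint_def.mp X.isSelfAdjoint_D] at hs
  rw [ContinuousLinearMap.isSelfAdjoint_iff_isSymmetric]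
  intro x y
  obtain ⟨hx, ex⟩ := X.D_Dinv x
  obtain ⟨hy, ey⟩ := X.D_Dinv y
  have := hs ⟨_, hx⟩ ⟨_, hy⟩
  rw [ex, ey] at this
  exact this.symm

theorem commute_absPow (z : ℂ) : Commute (X.absPow z) X.Dinv := by
  have h : IsStarNormal X.Dinv := X.isSelfAdjoint_Dinv.isStarNormal
  have := cfc_commute_cfc (fun t : ℂ => (‖t‖ : ℂ) ^ z) (fun t : ℂ => t) X.Dinv
  rwa [cfc_id' ℂ X.Dinv] at this

theorem mem_domPow_iff {n : ℕ} {x : H} :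
    x ∈ X.domPow n ↔ ∃ y : H, (X.Dinv ^ n) y = x := by
  induction n generalizing x with
  | zero => simp [domPow]
  | succ n ih =>
    rw [mem_domPow_succ]
    constructor
    · rintro ⟨h, hx⟩
      obtain ⟨y, hy⟩ := ih.mp hx
      refine ⟨y, ?_⟩
      rw [pow_succ', mul_apply_eq_comp, hy]
      exact X.Dinv_D ⟨x, h⟩
    · rintro ⟨y, rfl⟩
      obtain ⟨h, e⟩ := X.D_Dinv ((X.Dinv ^ n) y)
      rw [pow_succ', mul_apply_eq_comp]
      exact ⟨h, by rw [e]; exact ih.mpr ⟨y, rfl⟩⟩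

theorem mem_smooth_iff {x : H} : x ∈ X.smooth ↔ ∀ n, ∃ y : H, (X.Dinv ^ n) y = x := by
  simp [smooth, Submodule.mem_iInf, mem_domPow_iff]

theorem smooth_le_domain {x : H} (hx : x ∈ X.smooth) : x ∈ X.D.domain :=
  (X.mem_domPow_succ.mp ((Submodule.mem_iInf _).mp hx 1)).1

theorem D_mem_smooth (x : X.smooth) :
    X.D ⟨(x : H), X.smooth_le_domain x.2⟩ ∈ X.smooth :=
  (Submodule.mem_iInf _).mpr fun n =>
    (X.mem_domPow_succ.mp ((Submodule.mem_iInf _).mp x.2 (n + 1))).2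

theorem absPow_mem_smooth (z : ℂ) : ∀ x ∈ X.smooth, X.absPow z x ∈ X.smooth := by
  intro x hx
  rw [mem_smooth_iff] at hx ⊢
  intro n
  obtain ⟨y, rfl⟩ := hx n
  refine ⟨X.absPow z y, ?_⟩
  have := ((X.commute_absPow z).pow_right n).eq
  exact (congrArg (fun T : H →L[ℂ] H => T y) this).symm

theorem absPow_one_sq : X.absPow 1 ^ 2 = X.Dinv ^ 2 := by
  have hs := X.isSelfAdjoint_Dinv
  have h : IsStarNormal X.Dinv := hs.isStarNormal
  have e : X.absPow 1 = cfc (fun t : ℂ => (‖t‖ : ℂ)) X.Dinv := by simp [absPow]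
  rw [e, ← cfc_pow _ 2 X.Dinv, ← cfc_pow_id (R := ℂ) X.Dinv 2]
  refine cfc_congr fun t ht => ?_
  have := hs.mem_spectrum_eq_re ht
  rw [this]
  simp [← Complex.ofReal_pow]

theorem Dinv_injective : Function.Injective X.Dinv := by
  intro x y h
  obtain ⟨hx, ex⟩ := X.D_Dinv x
  obtain ⟨hy, ey⟩ := X.D_Dinv y
  rw [← ex, ← ey]
  congr 1
  exact Subtype.ext h

theorem absPow_one_injective : Function.Injective (X.absPow 1) := by
  intro x y h
  have h2 : (X.absPow 1 ^ 2) x = (X.absPow 1 ^ 2) y := by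
    simp [pow_two, h]
  rw [absPow_one_sq, pow_two] at h2
  exact X.Dinv_injective (X.Dinv_injective h2)

theorem HasBoundedCommutator.intertwine {T S : H →L[ℂ] H}
    (h : HasBoundedCommutator X.absD T S) :
    T * X.absPow 1 = X.absPow 1 * (T + S * X.absPow 1) := by
  have hker : LinearMap.ker ((X.absPow 1 : H →ₗ[ℂ] H).toPMap ⊤).toFun = ⊥ := by
    rw [LinearMap.ker_eq_bot]
    intro x y hxy
    exact Subtype.ext (X.absPow_one_injective hxy)
  have key : ∀ (w : X.absD.domain) (v : H), X.absPow 1 v = w → X.absD w = v := by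
    intro w v e
    exact LinearPMap.inverse_apply_eq hker (x := ⟨v, trivial⟩) (y := w) e
  have dom : ∀ v : H, X.absPow 1 v ∈ X.absD.domain := by
    intro v
    unfold absD
    rw [LinearPMap.inverse_domain]
    exact ⟨⟨v, trivial⟩, rfl⟩
  have ran : ∀ w ∈ X.absD.domain, ∃ u, X.absPow 1 u = w := by
    intro w hw
    unfold absD at hw
    rw [LinearPMap.inverse_domain] at hw
    obtain ⟨⟨u, _⟩, hu⟩ := hw
    exact ⟨u, hu⟩
  ext v
  obtain ⟨h1, h2⟩ := h ⟨X.absPow 1 v, dom v⟩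
  obtain ⟨u, hu'⟩ := ran _ h1
  rw [key ⟨_, dom v⟩ v rfl, key ⟨_, h1⟩ u hu', sub_eq_iff_eq_add] at h2
  change T (X.absPow 1 v) = X.absPow 1 (T v + S (X.absPow 1 v))
  rw [← hu', h2, add_comm]

theorem mem_smooth_of_inDomDelta {T : H →L[ℂ] H} (hT : ∀ n, X.InDomDelta n T) :
    ∀ x ∈ X.smooth, T x ∈ X.smooth := by
  have key : ∀ (n : ℕ) (T : H →L[ℂ] H), X.InDomDelta n T →
      ∃ T' : H →L[ℂ] H, T * X.absPow 1 ^ n = X.absPow 1 ^ n * T' := by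
    intro n
    induction n with
    | zero => exact fun T _ => ⟨T, by simp⟩
    | succ n ih =>
      have mono : ∀ (m : ℕ) (T : H →L[ℂ] H), X.InDomDelta (m + 1) T → X.InDomDelta m T := by
        intro m
        induction m with
        | zero => exact fun _ _ => trivial
        | succ m ihm =>
          rintro T ⟨S, h1, h2⟩
          exact ⟨S, h1, ihm S h2⟩
      intro T hT
      obtain ⟨T', e1⟩ := ih T (mono n T hT)
      obtain ⟨S, h1, h2⟩ := hT
      obtain ⟨S', e2⟩ := ih S h2
      refine ⟨T' + S' * X.absPow 1, ?_⟩
      calc T * X.absPow 1 ^ (n + 1)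
          = (T * X.absPow 1) * X.absPow 1 ^ n := by rw [pow_succ', mul_assoc]
        _ = X.absPow 1 * (T * X.absPow 1 ^ n + S * X.absPow 1 ^ n * X.absPow 1) := by
            rw [HasBoundedCommutator.intertwine X h1, mul_assoc, add_mul, mul_assoc S,
              mul_assoc S, ← pow_succ, ← pow_succ']
        _ = _ := by rw [e1, e2, mul_assoc (X.absPow 1 ^ n) S', ← mul_add, ← mul_assoc,
              ← pow_succ']
  intro x hx
  have lift : ∀ (n : ℕ) (w : H), (∃ y, (X.Dinv ^ (2 * n)) y = w) →
      ∃ y, (X.Dinv ^ n) y = w := by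
    rintro n w ⟨y, rfl⟩
    exact ⟨(X.Dinv ^ n) y, by rw [two_mul, pow_add]; rfl⟩
  rw [mem_smooth_iff] at hx ⊢
  intro n
  apply lift
  obtain ⟨y, rfl⟩ := hx (2 * n)
  obtain ⟨T', e⟩ := key (2 * n) T (hT _)
  refine ⟨T' y, ?_⟩
  rw [pow_mul, absPow_one_sq, ← pow_mul] at e
  exact (congrArg (fun T : H →L[ℂ] H => T y) e).symm

end SpectralTriple

/-- A regular spectral triple. -/
structure RegularSpectralTriple (A : Type*) [Ring A] [StarRing A] [Algebra ℂ A] [StarModule ℂ A]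
    (H : Type*) [NormedAddCommGroup H] [InnerProductSpace ℂ H] [CompleteSpace H]
    extends SpectralTriple A H where
  isRegular : toSpectralTriple.IsRegular

namespace RegularSpectralTriple

variable {A : Type*} [Ring A] [StarRing A] [Algebra ℂ A] [StarModule ℂ A]
  {H : Type*} [NormedAddCommGroup H] [InnerProductSpace ℂ H] [CompleteSpace H]
  (X : RegularSpectralTriple A H)

/-! ### Operators on `H^∞` -/

/-- The algebra of all linear operators `H^∞ → H^∞`. -/
abbrev Op : Type _ := Module.End ℂ X.smooth

/-- The Dirac operator on `H^∞`. -/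
def dirac : X.Op where
  toFun x := ⟨X.D ⟨(x : H), X.smooth_le_domain x.2⟩, X.D_mem_smooth x⟩
  map_add' x y := Subtype.ext
    (X.D.map_add ⟨(x : H), X.smooth_le_domain x.2⟩ ⟨(y : H), X.smooth_le_domain y.2⟩)
  map_smul' c x := Subtype.ext (X.D.map_smul c ⟨(x : H), X.smooth_le_domain x.2⟩)

/-- The operator `|D|^{-z}` on `H^∞`, for `Re z > 0`. -/
def absNegPow (z : ℂ) : X.Op :=
  (X.absPow z : H →ₗ[ℂ] H).restrict (X.absPow_mem_smooth z)

/-- `|D|^{-1}` on `H^∞`. -/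
def absInv : X.Op := X.absNegPow 1

/-- The sign `F = D |D|^{-1}` of `D`. -/
def F : X.Op := X.dirac * X.absInv

/-- The projection `P = (1 + F) / 2`. -/
def P : X.Op := (1 / 2 : ℂ) • (1 + X.F)

/-- `|D| = F D` on `H^∞`. -/
def abs : X.Op := X.F * X.dirac

/-- The action of the algebra on `H^∞`. -/
def rep (a : A) : X.Op :=
  (X.π a : H →ₗ[ℂ] H).restrict (X.mem_smooth_of_inDomDelta
    (X.isRegular _ (Algebra.subset_adjoin (Or.inl ⟨a, rfl⟩))))

/-- The derivation `δ(T) = |D| T - T |D|`. -/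
def delta (T : X.Op) : X.Op := X.abs * T - T * X.abs

/-- The derivation `∇(T) = [D², T]`. -/
def nabla (T : X.Op) : X.Op := X.dirac ^ 2 * T - T * X.dirac ^ 2

/-- The commutator `[D, a]`. -/
def dComm (a : A) : X.Op := X.dirac * X.rep a - X.rep a * X.dirac

/-- The algebra `Ψ⁰(A)` generated by all `δ^k(a)` and `δ^k([D, a])`. -/
def psiZero : Subalgebra ℂ X.Op :=
  Algebra.adjoin ℂ
    ({T | ∃ (k : ℕ) (a : A), T = X.delta^[k] (X.rep a)} ∪
      {T | ∃ (k : ℕ) (a : A), T = X.delta^[k] (X.dComm a)})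

/-- `T` extends to a trace class operator on the Hilbert space. -/
def IsTraceClassOp (T : X.Op) : Prop :=
  ∃ S : H →L[ℂ] H, (∀ x : X.smooth, S (x : H) = (T x : H)) ∧ IsTraceClass S

/-- `T` extends to a trace class operator with trace `t`. -/
def HasTrace (T : X.Op) (t : ℂ) : Prop :=
  ∃ S : H →L[ℂ] H, (∀ x : X.smooth, S (x : H) = (T x : H)) ∧ IsTraceClass S ∧ opTrace S = t

/-! ### Zeta functions, dimension spectrum and residues -/

/-- `f` is a meromorphic continuation to the plane of the zeta function
`ζ_T(z) = Tr (T |D|^{-z})`, which is given by the trace on some right half-plane. -/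
def IsZeta (T : X.Op) (f : ℂ → ℂ) : Prop :=
  MeromorphicOn f Set.univ ∧
    ∃ R : ℝ, ∀ z : ℂ, R < z.re → X.HasTrace (T * X.absNegPow z) (f z)

/-- The triple has simple discrete dimension spectrum contained in `Σ`: for every `T` in `Ψ⁰(A)`
the zeta functions of `T` and of `T F` continue analytically to the complement of the closed
discrete set `Σ`, with at most simple poles in `Σ`. -/
structure HasSimpleDimensionSpectrum (Sd : Set ℂ) : Prop where
  isClosed : IsClosed Sd
  isDiscrete : IsDiscrete Sd
  continuation : ∀ T ∈ X.psiZero, ∀ T' : X.Op, T' = T ∨ T' = T * X.F →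
    ∃ f : ℂ → ℂ, X.IsZeta T' f ∧ AnalyticOnNhd ℂ f Sdᶜ ∧
      ∀ s ∈ Sd, ((-1 : ℤ) : WithTop ℤ) ≤ meromorphicOrderAt f s

/-- The zeta function of `T` continues meromorphically, with at most a simple pole at `0` and
with residue `r` there. -/
def HasResidue (T : X.Op) (r : ℂ) : Prop :=
  ∃ f : ℂ → ℂ, X.IsZeta T f ∧ Tendsto (fun z => z * f z) (𝓝[≠] 0) (𝓝 r)

open scoped Classical in
/-- The noncommutative integral: the residue at `z = 0` of `Tr (T |D|^{-z})`. -/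
def ncint (T : X.Op) : ℂ := if h : ∃ r, X.HasResidue T r then h.choose else 0

/-- The zeta function of `T` continues meromorphically, is regular at `0`, and has value `v`
there. -/
def HasZetaValue (T : X.Op) (v : ℂ) : Prop :=
  ∃ f : ℂ → ℂ, X.IsZeta T f ∧ Tendsto f (𝓝[≠] 0) (𝓝 v)

open scoped Classical in
/-- The value of `Tr (T |D|^{-z})` at `z = 0`. -/
def zetaAtZero (T : X.Op) : ℂ := if h : ∃ v, X.HasZetaValue T v then h.choose else 0

end RegularSpectralTriple

/-! ### Cochains and the `(b, B)` bicomplex -/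

section Cochains

variable (A : Type*) [Ring A] [Algebra ℂ A]

/-- Functions of `n + 1` variables in `A`. -/
abbrev Cochain (n : ℕ) : Type _ := (Fin (n + 1) → A) → ℂ

variable {A}

/-- `φ` is an `n`-cochain: an `(n + 1)`-linear functional. -/
def IsCochain {n : ℕ} (φ : Cochain A n) : Prop :=
  ∃ f : MultilinearMap ℂ (fun _ : Fin (n + 1) => A) ℂ, ∀ a, f a = φ a

/-- The Hochschild coboundary
`∑ j ≤ n, (-1)^j φ(…, a_j a_{j+1}, …) + (-1)^{n+1} φ(a_{n+1} a_0, a_1, …, a_n)`. -/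
def hochschild {n : ℕ} (φ : Cochain A n) : Cochain A (n + 1) := fun a =>
  ∑ j : Fin (n + 1), (-1 : ℂ) ^ (j : ℕ) * φ (Fin.contractNth j.castSucc (· * ·) a) +
    (-1 : ℂ) ^ (n + 1) *
      φ (Fin.cons (a (Fin.last (n + 1)) * a 0) fun i : Fin n => a i.succ.castSucc)

/-- `B₀ φ (a_0, …, a_{n-1}) = φ(1, a_0, …, a_{n-1}) - (-1)^n φ(a_0, …, a_{n-1}, 1)`, with
`n = m + 1`. -/
def connesB₀ {m : ℕ} (φ : Cochain A (m + 1)) : Cochain A m := fun a =>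
  φ (Fin.cons 1 a) - (-1 : ℂ) ^ (m + 1) * φ (Fin.snoc a 1)

/-- Cyclic antisymmetrization
`∑ j, (-1)^{m j} ψ(a_j, …, a_m, a_0, …, a_{j-1})`; the indices are added modulo `m + 1`. -/
def cyclicSum {m : ℕ} (ψ : Cochain A m) : Cochain A m := fun a =>
  ∑ j : Fin (m + 1), (-1 : ℂ) ^ (m * (j : ℕ)) * ψ fun i => a (i + j)

/-- Connes' operator `B = N B₀`. -/
def connesB {m : ℕ} (φ : Cochain A (m + 1)) : Cochain A m := cyclicSum (connesB₀ φ)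

/-- The total coboundary `b + B` on families of cochains. -/
def totalBoundary (φ : ∀ n, Cochain A n) : ∀ n, Cochain A n
  | 0 => connesB (φ 1)
  | n + 1 => hochschild (φ n) + connesB (φ (n + 2))

/-- A cyclic `n`-cocycle: an `(n + 1)`-linear functional with
`φ(a_0, …, a_n) = (-1)^n φ(a_n, a_0, …, a_{n-1})` and vanishing Hochschild coboundary. -/
def IsCyclicCocycle {n : ℕ} (φ : Cochain A n) : Prop :=
  IsCochain φ ∧ (∀ a, φ a = (-1 : ℂ) ^ n * φ fun i => a (i - 1)) ∧ hochschild φ = 0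

end Cochains

/-! ### The local cochains -/

namespace RegularSpectralTriple

variable {A : Type*} [Ring A] [StarRing A] [Algebra ℂ A] [StarModule ℂ A]
  {H : Type*} [NormedAddCommGroup H] [InnerProductSpace ℂ H] [CompleteSpace H]
  (X : RegularSpectralTriple A H)

/-- The integrand `a₀ ∇^k([D, a₁]) |D|^{-(2k+1)}`. -/
def phi₁Term (k : ℕ) (a₀ a₁ : A) : X.Op :=
  X.rep a₀ * X.nabla^[k] (X.dComm a₁) * X.absInv ^ (2 * k + 1)

/-- The integrand `a₀ [D, a₁] [D, a₂] [D, a₃] |D|^{-3}`. -/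
def phi₃Term (a₀ a₁ a₂ a₃ : A) : X.Op :=
  X.rep a₀ * X.dComm a₁ * X.dComm a₂ * X.dComm a₃ * X.absInv ^ 3

/-- The integrand `a₀ δ^k(a₁) P |D|^{-k}`. -/
def psi₁Term (k : ℕ) (a₀ a₁ : A) : X.Op :=
  X.rep a₀ * X.delta^[k] (X.rep a₁) * X.P * X.absInv ^ k

/-- The integrand `a₀ δ(a₁) δ²(a₂) F |D|^{-3}`. -/
def phiPrime₂Term (a₀ a₁ a₂ : A) : X.Op :=
  X.rep a₀ * X.delta (X.rep a₁) * X.delta^[2] (X.rep a₂) * X.F * X.absInv ^ 3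

/-- The component `φ₁` of the local Chern character. -/
def phi₁ : Cochain A 1 := fun a =>
  X.ncint (X.phi₁Term 0 (a 0) (a 1)) - 1 / 4 * X.ncint (X.phi₁Term 1 (a 0) (a 1)) +
    1 / 8 * X.ncint (X.phi₁Term 2 (a 0) (a 1))

/-- The component `φ₃` of the local Chern character. -/
def phi₃ : Cochain A 3 := fun a =>
  1 / 12 * X.ncint (X.phi₃Term (a 0) (a 1) (a 2) (a 3))

/-- The local Chern character `φ_odd = (φ₁, φ₃)`. -/
def phiOdd : ∀ n, Cochain A n
  | 1 => X.phi₁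
  | 3 => X.phi₃
  | _ => 0

/-- The cochain `ψ₁`. -/
def psi₁ : Cochain A 1 := fun a =>
  2 * X.ncint (X.psi₁Term 1 (a 0) (a 1)) - X.ncint (X.psi₁Term 2 (a 0) (a 1)) +
    2 / 3 * X.ncint (X.psi₁Term 3 (a 0) (a 1))

/-- `ψ₁` as a family with a single nonzero component. -/
def psiOdd : ∀ n, Cochain A n
  | 1 => X.psi₁
  | _ => 0

/-- The component `φ'₀`. -/
def phiPrime₀ : Cochain A 0 := fun a => X.zetaAtZero (X.rep (a 0))

/-- The component `φ'₂`. -/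
def phiPrime₂ : Cochain A 2 := fun a =>
  -(1 / 24) * X.ncint (X.phiPrime₂Term (a 0) (a 1) (a 2))

/-- The cochain `φ'_ev = (φ'₀, φ'₂)`. -/
def phiPrimeEv : ∀ n, Cochain A n
  | 0 => X.phiPrime₀
  | 2 => X.phiPrime₂
  | _ => 0

/-- All residues and zeta values that occur in `φ_odd`, `ψ₁` and `φ'_ev` exist. -/
structure LocalCochainsDefined : Prop where
  phi₁ : ∀ k ≤ 2, ∀ a₀ a₁ : A, ∃ r, X.HasResidue (X.phi₁Term k a₀ a₁) r
  phi₃ : ∀ a₀ a₁ a₂ a₃ : A, ∃ r, X.HasResidue (X.phi₃Term a₀ a₁ a₂ a₃) r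
  psi₁ : ∀ k, 1 ≤ k → k ≤ 3 → ∀ a₀ a₁ : A, ∃ r, X.HasResidue (X.psi₁Term k a₀ a₁) r
  phiPrime₀ : ∀ a : A, ∃ v, X.HasZetaValue (X.rep a) v
  phiPrime₂ : ∀ a₀ a₁ a₂ : A, ∃ r, X.HasResidue (X.phiPrime₂Term a₀ a₁ a₂) r

end RegularSpectralTriple

end LocalIndex

end

/-!
Let `e_i` be an orthonormal basis of eigenvectors of `D`, let `λ_i > 0` be the eigenvalues of `|D|`
and `ε_i = ±1` those of `F`. If `T |D|^{-z}` is trace class then its trace is the Dirichlet series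
`∑ T_ii λ_i^{-z}`, so that all zeta functions are determined by the diagonals of the operators.
Residues and values at `0` can be read off from the behaviour of a continuation to the half-plane
`Re z > 0` as `z → 0+` along the real axis (`DirichletResidue`, `DirichletValue`); these are unique
by the identity theorem. Two facts then carry the proof.

* Operators with a trace class factor do not contribute to residues. If `S` is trace class and an
  expression in `S`, in powers of `|D|` and in operators with bounded iterated commutators with
  `|D|` has total order at most `0`, then its diagonal is summable
  (`summable_diag_mul_delta_iterate_mul`), as `|D|` can be moved to either end, where the diagonal
  does not distinguish left from right. A summable diagonal has residue `0`, and value at `0` equal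
  to its sum. This applies to `S = [F, a]`, and gives `F δ^k(a) ∼ δ^k(a) F` and
  `[D, a] = δ(a) F + |D| [F, a] ∼ δ(a) F`.
* The trace property with its defect. Both `ζ_{YV}(z)` and `ζ_{V δ^k(Y)}(z + k)` are double series
  over `V_ji Y_ij`, with weights `λ_i^{-z}` and `(λ_i - λ_j)^k λ_j^{-z-k}`. The Taylor expansion of
  `λ_i^{-z}` around `λ_j` expresses the first through the second with binomial coefficients of
  `-z`, and the remainder of order `N` converges absolutely once `|D|^{-N}` is trace class, because
  `(λ_i - λ_j)^N Y_ij` are the coefficients of the bounded operator `δ^N(Y)`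
  (`exists_isDirichlet_mul_swap`). At `z = 0` the binomial coefficient over `k` has a simple zero
  with derivative `(-1)^k / k`, so the value of `ζ_{YV} - ζ_{VY}` at `0` is
  `∑ (-1)^k / k` times the residue of `V δ^k(Y) |D|^{-k}` (`dirichletValue_mul_swap`).

Write `∫` for the residue. With `V = a₀`, `Y = a₁` the second fact computes `b φ'₀`, which is the
part of `ψ₁` without `F`. Expanding `∇` through `δ` and replacing `[D, a₁]` by `δ(a₁) F`, one finds
that `φ₁` is the part of `ψ₁` with `F`, except for the coefficient `1/4` instead of `1/3` of
`∫ a₀ δ³(a₁) F |D|⁻³`. The difference is `B φ'₂`, because `T ↦ ∫ T F |D|⁻³` is a trace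
(`ncint_mul_swap`) that vanishes on total derivatives `δ(T)`. The same trace and the Leibniz rule
give `φ₃ = -b φ'₂`. With `V = a₀ F`, `Y = a₁` the second fact shows that
`ψ₁(a₀, a₁) = Z(a₀ a₁) - Z(a₁ a₀) + Tr(a₀ [F, a₁])`, where `Z(a)` is the value at `0` of
`ζ_a + ζ_{aF}` (`psi₁_eq`). This is visibly a cyclic cocycle, as `[F, a₀ a₁]` has zero diagonal.
-/

noncomputable section

namespace LocalIndex

/-! ### Trace class operators -/

section TraceClass

variable {H : Type*} [NormedAddCommGroup H] [InnerProductSpace ℂ H]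

theorem IsTraceClass.mul_left {T : H →L[ℂ] H} (hT : IsTraceClass T) (B : H →L[ℂ] H) :
    IsTraceClass (B * T) := by
  obtain ⟨x, y, hxy, h⟩ := hT
  refine ⟨fun n => B (x n), y, ?_, fun v => ?_⟩
  · refine Summable.of_nonneg_of_le (fun n => by positivity) (fun n => ?_) (hxy.mul_left ‖B‖)
    rw [← mul_assoc]
    gcongr
    exact B.le_opNorm _
  · simpa [Function.comp_def] using (h v).mapL B

theorem IsTraceClass.smul {T : H →L[ℂ] H} (hT : IsTraceClass T) (c : ℂ) :
    IsTraceClass (c • T) := by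
  simpa using hT.mul_left (c • (1 : H →L[ℂ] H))

theorem IsTraceClass.add {S T : H →L[ℂ] H} (hS : IsTraceClass S) (hT : IsTraceClass T) :
    IsTraceClass (S + T) := by
  obtain ⟨x, y, hxy, h⟩ := hS
  obtain ⟨x', y', hxy', h'⟩ := hT
  obtain ⟨e⟩ : Nonempty (ℕ ≃ ℕ ⊕ ℕ) := ⟨Equiv.natSumNatEquivNat.symm⟩
  have key : Summable (fun s : ℕ ⊕ ℕ => ‖Sum.elim x x' s‖ * ‖Sum.elim y y' s‖) :=
    (HasSum.sum (by simpa [Function.comp_def] using hxy.hasSum)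
      (by simpa [Function.comp_def] using hxy'.hasSum)).summable
  refine ⟨fun n => Sum.elim x x' (e n),
    fun n => Sum.elim y y' (e n),
    (Equiv.summable_iff e).2 key, fun v => ?_⟩
  have : HasSum (fun s : ℕ ⊕ ℕ => inner ℂ (Sum.elim y y' s) v • Sum.elim x x' s) (S v + T v) :=
    HasSum.sum (by simpa [Function.comp_def] using h v)
      (by simpa [Function.comp_def] using h' v)
  exact (Equiv.hasSum_iff e).2 this

theorem hasSum_norm_inner_sq {ι : Type*} [CompleteSpace H] (b : HilbertBasis ι ℂ H) (x : H) :
    HasSum (fun i => ‖inner ℂ (b i) x‖ ^ 2) (‖x‖ ^ 2) := by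
  have h := b.hasSum_inner_mul_inner x x
  have h2 := Complex.hasSum_re h
  rw [inner_self_eq_norm_sq_to_K] at h2
  convert h2 using 1
  · funext i
    rw [← inner_conj_symm x (b i), Complex.conj_mul']
    simp [← Complex.ofReal_pow]
  · simp [← Complex.ofReal_pow]

theorem summable_norm_inner_mul_inner {ι : Type*} [CompleteSpace H] (b : HilbertBasis ι ℂ H)
    (x y : H) : Summable fun i => ‖inner ℂ x (b i)‖ * ‖inner ℂ (b i) y‖ := by
  have hx := (hasSum_norm_inner_sq b x).summable
  have hy := (hasSum_norm_inner_sq b y).summable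
  refine Summable.of_nonneg_of_le (fun i => by positivity) (fun i => ?_) (hx.add hy)
  rw [norm_inner_symm]
  nlinarith [sq_nonneg (‖inner ℂ (b i) x‖ - ‖inner ℂ (b i) y‖),
    sq_nonneg (‖inner ℂ (b i) x‖ + ‖inner ℂ (b i) y‖)]

theorem tsum_norm_inner_mul_inner_le {ι : Type*} [CompleteSpace H] (b : HilbertBasis ι ℂ H)
    (x y : H) : ∑' i, ‖inner ℂ x (b i)‖ * ‖inner ℂ (b i) y‖ ≤ ‖x‖ * ‖y‖ := by
  refine Real.tsum_le_of_sum_le (fun i => by positivity) fun s => ?_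
  have hs : ∀ z : H, ∑ i ∈ s, ‖inner ℂ (b i) z‖ ^ 2 ≤ ‖z‖ ^ 2 := fun z =>
    sum_le_hasSum s (fun i _ => by positivity) (hasSum_norm_inner_sq b z)
  refine (Finset.sum_congr rfl fun i _ => by rw [norm_inner_symm]).le.trans ?_
  have := Finset.sum_mul_sq_le_sq_mul_sq s (fun i => ‖inner ℂ (b i) x‖)
    (fun i => ‖inner ℂ (b i) y‖)
  refine abs_le_of_sq_le_sq' (this.trans ?_) (by positivity) |>.2
  rw [mul_pow]
  gcongr
  · exact hs x
  · exact hs y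

/-- The trace of `∑ n, ⟨y n, ·⟩ x n` is `∑ n, ⟨y n, x n⟩`, in any orthonormal basis; the double
series that links the two sums converges absolutely. -/
theorem hasSum_inner_of_rankOne_series [CompleteSpace H] {ι : Type*} (b : HilbertBasis ι ℂ H)
    {T : H →L[ℂ] H} {x y : ℕ → H} (hxy : Summable fun n => ‖x n‖ * ‖y n‖)
    (hT : ∀ v : H, HasSum (fun n => inner ℂ (y n) v • x n) (T v)) :
    HasSum (fun i => inner ℂ (b i) (T (b i))) (∑' n, inner ℂ (y n) (x n)) := by
  set f : ℕ × ι → ℂ := fun p => inner ℂ (y p.1) (b p.2) * inner ℂ (b p.2) (x p.1) with hf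
  have hsum : Summable f := by
    rw [← summable_norm_iff]
    refine (summable_prod_of_nonneg fun p => norm_nonneg _).2 ⟨fun n => ?_, ?_⟩
    · simpa [hf, norm_mul] using summable_norm_inner_mul_inner b (y n) (x n)
    · refine Summable.of_nonneg_of_le (fun n => tsum_nonneg fun i => norm_nonneg _)
        (fun n => ?_) hxy
      simpa [hf, norm_mul, mul_comm] using tsum_norm_inner_mul_inner_le b (y n) (x n)
  have h1 : HasSum (fun n => inner ℂ (y n) (x n)) (∑' p, f p) :=
    hsum.hasSum.prod_fiberwise fun n => b.hasSum_inner_mul_inner (y n) (x n)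
  rw [h1.tsum_eq]
  refine ((Equiv.prodComm ι ℕ).hasSum_iff.2 hsum.hasSum).prod_fiberwise fun i => ?_
  have := (hT (b i)).mapL (innerSL ℂ (b i))
  simpa [hf, Function.comp_def, inner_smul_right] using this

variable [CompleteSpace H]

theorem IsTraceClass.hasSum_opTrace {T : H →L[ℂ] H} (hT : IsTraceClass T) {ι : Type*}
    (b : HilbertBasis ι ℂ H) : HasSum (fun i => inner ℂ (b i) (T (b i))) (opTrace T) := by
  obtain ⟨x, y, hxy, h⟩ := hT
  have hb := (exists_hilbertBasis ℂ H).choose_spec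
  obtain ⟨b', hb'⟩ := hb
  have h' := hasSum_inner_of_rankOne_series b' hxy h
  have : opTrace T = ∑' n, inner ℂ (y n) (x n) := by
    rw [← h'.tsum_eq, opTrace, hb']
  rw [this]
  exact hasSum_inner_of_rankOne_series b hxy h

theorem IsTraceClass.mul_right {T : H →L[ℂ] H} (hT : IsTraceClass T) (B : H →L[ℂ] H) :
    IsTraceClass (T * B) := by
  obtain ⟨x, y, hxy, h⟩ := hT
  refine ⟨x, fun n => ContinuousLinearMap.adjoint B (y n), ?_, fun v => ?_⟩
  · refine Summable.of_nonneg_of_le (fun n => by positivity) (fun n => ?_)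
      (hxy.mul_left ‖ContinuousLinearMap.adjoint B‖)
    rw [mul_left_comm]
    gcongr
    exact (ContinuousLinearMap.adjoint B).le_opNorm _
  · simpa [ContinuousLinearMap.adjoint_inner_left] using h (B v)

/-- Cyclicity of the trace. -/
theorem IsTraceClass.opTrace_mul_comm {T : H →L[ℂ] H} (hT : IsTraceClass T) (B : H →L[ℂ] H) :
    opTrace (B * T) = opTrace (T * B) := by
  obtain ⟨b', hb'⟩ := (exists_hilbertBasis ℂ H).choose_spec
  have h1 := (hT.mul_left B).hasSum_opTrace b'
  have h2 := (hT.mul_right B).hasSum_opTrace b'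
  obtain ⟨x, y, hxy, h⟩ := hT
  have e1 := hasSum_inner_of_rankOne_series b' (T := B * T) (x := fun n => B (x n)) (y := y) (by
    refine Summable.of_nonneg_of_le (fun n => by positivity) (fun n => ?_) (hxy.mul_left ‖B‖)
    rw [← mul_assoc]
    gcongr
    exact B.le_opNorm _) fun v => by simpa [Function.comp_def] using (h v).mapL B
  have e2 := hasSum_inner_of_rankOne_series b' (T := T * B) (x := x)
    (y := fun n => ContinuousLinearMap.adjoint B (y n)) (by
    refine Summable.of_nonneg_of_le (fun n => by positivity) (fun n => ?_)
      (hxy.mul_left ‖ContinuousLinearMap.adjoint B‖)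
    rw [mul_left_comm]
    gcongr
    exact (ContinuousLinearMap.adjoint B).le_opNorm _) fun v => by
      simpa [ContinuousLinearMap.adjoint_inner_left] using h (B v)
  rw [h1.unique e1, h2.unique e2]
  simp [ContinuousLinearMap.adjoint_inner_left]

end TraceClass

/-! ### The spectral decomposition of `D` -/

/-- The continuous functional calculus acts on an eigenvector through the value of the function at
the eigenvalue. -/
theorem cfc_apply_of_apply_eq_smul {H : Type*} [NormedAddCommGroup H] [InnerProductSpace ℂ H]
    [CompleteSpace H] {a : H →L[ℂ] H} (ha : IsSelfAdjoint a) {f : ℂ → ℂ} (hf : Continuous f)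
    {μ : ℝ} {v : H} (hv : a v = (μ : ℂ) • v) : cfc f a v = f μ • v := by
  rcases eq_or_ne v 0 with rfl | hv0
  · simp
  have hn : IsStarNormal a := ha.isStarNormal
  have hμ : (μ : ℂ) ∈ spectrum ℂ a := by
    intro hu
    obtain ⟨u, hu⟩ := hu
    have h0 : (u : H →L[ℂ] H) v = 0 := by
      rw [hu]
      simp [hv, Algebra.algebraMap_eq_smul_one]
    have : ((↑u⁻¹ : H →L[ℂ] H) * (u : H →L[ℂ] H)) v = 0 := by
      rw [mul_apply_eq_comp, h0, map_zero]
    rw [Units.inv_mul] at this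
    exact hv0 this
  rw [cfc_apply f a hn hf.continuousOn]
  set g : C(spectrum ℂ a, ℂ) := ⟨_, hf.continuousOn.domRestrict⟩ with hg
  have hgμ : f μ = g ⟨μ, hμ⟩ := rfl
  rw [hgμ]
  generalize g = g'
  induction g' using ContinuousMap.induction_on_of_compact with
  | const r =>
    have : ContinuousMap.const (spectrum ℂ a) r = algebraMap ℂ C(spectrum ℂ a, ℂ) r := rfl
    rw [this, AlgHomClass.commutes]
    simp [Algebra.algebraMap_eq_smul_one]
  | id => rw [cfcHom_id]; simpa using hv
  | star_id =>
    rw [map_star, cfcHom_id, ha.star_eq]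
    simpa using hv
  | add f g hf hg => simp [hf, hg, add_smul]
  | mul f g hf hg => simp [hf, hg, mul_smul, smul_comm (f _)]
  | frequently f hf =>
    have hc1 : Continuous fun g : C(spectrum ℂ a, ℂ) => cfcHom hn g v :=
      (ContinuousLinearMap.apply ℂ H v).continuous.comp (cfcHom_continuous hn)
    have hc2 : Continuous fun g : C(spectrum ℂ a, ℂ) => g ⟨μ, hμ⟩ • v :=
      (continuous_eval_const _).smul continuous_const
    have := (isClosed_eq hc1 hc2).mem_of_frequently_of_tendsto hf tendsto_id
    exact this

namespace SpectralTriple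

variable {A : Type*} [Ring A] [StarRing A] [Algebra ℂ A] [StarModule ℂ A]
  {H : Type*} [NormedAddCommGroup H] [InnerProductSpace ℂ H] [CompleteSpace H]
  (X : SpectralTriple A H)

theorem continuous_norm_cpow {z : ℂ} (hz : 0 < z.re) :
    Continuous fun t : ℂ => (‖t‖ : ℂ) ^ z :=
  (Complex.continuous_ofReal_cpow_const hz).comp continuous_norm

theorem absPow_add {z w : ℂ} (hz : 0 < z.re) (hw : 0 < w.re) :
    X.absPow (z + w) = X.absPow z * X.absPow w := by
  unfold absPow
  rw [← cfc_mul _ _ X.Dinv (continuous_norm_cpow hz).continuousOn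
    (continuous_norm_cpow hw).continuousOn]
  congr 1
  funext t
  rcases eq_or_ne t 0 with rfl | ht
  · have h1 : z ≠ 0 := by rintro rfl; simp at hz
    have h2 : z + w ≠ 0 := fun h => by
      have := congrArg Complex.re h
      simp at this
      linarith
    simp [h1, h2]
  · exact Complex.cpow_add _ _ (by simpa using ht)

theorem star_absPow_one : star (X.absPow 1) = X.absPow 1 := by
  unfold absPow
  rw [← cfc_star]
  simp

theorem inner_absPow_one (x y : H) : inner ℂ x (X.absPow 1 y) = inner ℂ (X.absPow 1 x) y := by
  conv_rhs => rw [← X.star_absPow_one, ContinuousLinearMap.star_eq_adjoint,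
    ContinuousLinearMap.adjoint_inner_left]

theorem inner_Dinv (x y : H) : inner ℂ x (X.Dinv y) = inner ℂ (X.Dinv x) y := by
  have h := X.isSelfAdjoint_Dinv.star_eq
  conv_rhs => rw [← h, ContinuousLinearMap.star_eq_adjoint,
    ContinuousLinearMap.adjoint_inner_left]

/-- An orthonormal basis of eigenvectors of `D⁻¹`, with the (real) eigenvalues. -/
structure EigenBasis (ι : Type*) where
  /-- the eigenvectors -/
  b : HilbertBasis ι ℂ H
  /-- the eigenvalues of `D⁻¹` -/
  ev : ι → ℝ
  Dinv_b : ∀ i, X.Dinv (b i) = (ev i : ℂ) • b i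

theorem exists_eigenBasis.{u} {H : Type u} [NormedAddCommGroup H] [InnerProductSpace ℂ H]
    [CompleteSpace H] (X : SpectralTriple A H) : ∃ ι : Type u, Nonempty (X.EigenBasis ι) := by
  have hsym : (X.Dinv : H →ₗ[ℂ] H).IsSymmetric :=
    ContinuousLinearMap.isSelfAdjoint_iff_isSymmetric.1 X.isSelfAdjoint_Dinv
  let V : ℝ → Submodule ℂ H := fun μ => Module.End.eigenspace (X.Dinv : H →ₗ[ℂ] H) (μ : ℂ)
  have hVmem : ∀ μ x, x ∈ V μ ↔ X.Dinv x = (μ : ℂ) • x := fun μ x =>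
    Module.End.mem_eigenspace_iff
  have hVc : ∀ μ, IsClosed (V μ : Set H) := by
    intro μ
    have : (V μ : Set H) = {x | X.Dinv x = (μ : ℂ) • x} := Set.ext fun x => hVmem μ x
    rw [this]
    exact isClosed_eq X.Dinv.continuous (continuous_const_smul _)
  have hcomp : ∀ μ, CompleteSpace (V μ) := fun μ => (hVc μ).completeSpace_coe
  choose w b hb using fun μ => exists_hilbertBasis ℂ (V μ)
  have hfam : OrthogonalFamily ℂ (fun μ => V μ) fun μ => (V μ).subtypeₗᵢ :=
    hsym.orthogonalFamily_eigenspaces.comp Complex.ofReal_injective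
  have hon : Orthonormal ℂ fun a : Σ μ, w μ => ((b a.1 a.2 : V a.1) : H) :=
    hfam.orthonormal_sigma_orthonormal fun μ => (b μ).orthonormal
  refine ⟨Σ μ, w μ, ⟨⟨HilbertBasis.mkOfOrthogonalEqBot hon ?_, fun a => a.1, fun a => ?_⟩⟩⟩
  · have htop := ContinuousLinearMap.orthogonalComplement_iSup_eigenspaces_eq_bot
      X.isCompact_Dinv hsym
    rw [eq_bot_iff, ← htop, ← Submodule.iInf_orthogonal]
    refine fun x hx => (Submodule.mem_iInf _).2 fun μ => ?_
    rw [Submodule.mem_orthogonal]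
    intro y hy
    rcases eq_or_ne y 0 with rfl | hy0
    · simp
    have hμ : ((μ.re : ℝ) : ℂ) = μ := Complex.conj_eq_iff_re.1
      (hsym.conj_eigenvalue_eq_self (Module.End.hasEigenvalue_of_hasEigenvector ⟨hy, hy0⟩))
    have hyV : y ∈ V μ.re := by simpa only [V, hμ] using hy
    have h1 := ((b μ.re).hasSum_repr ⟨y, hyV⟩).mapL (V μ.re).subtypeL
    have h2 := h1.mapL (innerSL ℂ x)
    have h3 : ∀ i, inner ℂ x ((b μ.re i : V μ.re) : H) = 0 := fun i =>
      (Submodule.mem_orthogonal' _ _).1 hx _ (Submodule.subset_span ⟨⟨μ.re, i⟩, rfl⟩)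
    have h4 : inner ℂ x y = 0 := by
      refine h2.unique ?_
      convert hasSum_zero with i
      simp [h3]
    exact inner_eq_zero_symm.1 h4
  · rw [HilbertBasis.coe_mkOfOrthogonalEqBot]
    exact (hVmem _ _).1 (b a.1 a.2).2

end SpectralTriple

/-! ### Eigenvectors and smooth vectors -/

namespace SpectralTriple.EigenBasis

variable {A : Type*} [Ring A] [StarRing A] [Algebra ℂ A] [StarModule ℂ A]
  {H : Type*} [NormedAddCommGroup H] [InnerProductSpace ℂ H] [CompleteSpace H]
  {X : SpectralTriple A H} {ι : Type*} (E : X.EigenBasis ι)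

theorem b_ne_zero (i : ι) : E.b i ≠ 0 := E.b.orthonormal.ne_zero i

theorem ev_ne_zero (i : ι) : E.ev i ≠ 0 := by
  intro h
  have := E.Dinv_b i
  rw [h, Complex.ofReal_zero, zero_smul, ← map_zero X.Dinv] at this
  exact E.b_ne_zero i (X.Dinv_injective this)

/-- The eigenvalues of `|D|`. -/
def lam (i : ι) : ℝ := |E.ev i|⁻¹

/-- The eigenvalues `±1` of the sign of `D`. -/
def sgn (i : ι) : ℂ := ((|E.ev i| / E.ev i : ℝ) : ℂ)

theorem lam_pos (i : ι) : 0 < E.lam i := inv_pos.2 (abs_pos.2 (E.ev_ne_zero i))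

theorem lam_ne_zero (i : ι) : (E.lam i : ℂ) ≠ 0 :=
  Complex.ofReal_ne_zero.2 (E.lam_pos i).ne'

/-- The spectrum of `|D|` is bounded below by a positive number. -/
theorem exists_le_lam : ∃ c : ℝ, 0 < c ∧ c ≤ 1 ∧ ∀ i, c ≤ E.lam i := by
  refine ⟨(‖X.Dinv‖ + 1)⁻¹, by positivity, inv_le_one_of_one_le₀ (by simp), fun i => ?_⟩
  refine inv_anti₀ (abs_pos.2 (E.ev_ne_zero i)) ?_
  have h := X.Dinv.le_opNorm (E.b i)
  rw [E.Dinv_b, norm_smul, E.b.orthonormal.1 i] at h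
  simp at h
  linarith

theorem absPow_b {z : ℂ} (hz : 0 < z.re) (i : ι) :
    X.absPow z (E.b i) = (E.lam i : ℂ) ^ (-z) • E.b i := by
  unfold SpectralTriple.absPow
  rw [cfc_apply_of_apply_eq_smul X.isSelfAdjoint_Dinv (continuous_norm_cpow hz) (E.Dinv_b i), lam]
  congr 1
  have : ((|E.ev i|⁻¹ : ℝ) : ℂ) = ((|E.ev i| : ℝ) : ℂ)⁻¹ := by push_cast; rfl
  rw [this, Complex.cpow_neg, Complex.inv_cpow, inv_inv]
  · simp
  · rw [Complex.arg_ofReal_of_nonneg (abs_nonneg _)]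
    exact Real.pi_pos.ne

theorem absPow_one_b (i : ι) : X.absPow 1 (E.b i) = (E.lam i : ℂ)⁻¹ • E.b i := by
  rw [E.absPow_b (by simp), Complex.cpow_neg_one]

theorem b_mem_smooth (i : ι) : E.b i ∈ X.smooth := by
  rw [mem_smooth_iff]
  intro n
  induction n with
  | zero => exact ⟨E.b i, rfl⟩
  | succ n ih =>
    obtain ⟨y, hy⟩ := ih
    refine ⟨(E.ev i : ℂ)⁻¹ • y, ?_⟩
    rw [pow_succ', mul_apply_eq_comp, map_smul, hy, map_smul, E.Dinv_b, smul_smul,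
      inv_mul_cancel₀ (Complex.ofReal_ne_zero.2 (E.ev_ne_zero i)), one_smul]

theorem dense_smooth (E : X.EigenBasis ι) : Dense (X.smooth : Set H) := by
  have h := E.b.dense_span
  rw [← Submodule.dense_iff_topologicalClosure_eq_top] at h
  refine h.mono ?_
  exact Submodule.span_le.2 (by rintro _ ⟨i, rfl⟩; exact E.b_mem_smooth i)

/-- The eigenvectors, as smooth vectors. -/
def vec (i : ι) : X.smooth := ⟨E.b i, E.b_mem_smooth i⟩

end SpectralTriple.EigenBasis

/-! ### The algebra of operators on smooth vectors -/

namespace RegularSpectralTriple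

variable {A : Type*} [Ring A] [StarRing A] [Algebra ℂ A] [StarModule ℂ A]
  {H : Type*} [NormedAddCommGroup H] [InnerProductSpace ℂ H] [CompleteSpace H]
  (X : RegularSpectralTriple A H)

theorem Dinv_dirac (x : X.smooth) : X.Dinv (X.dirac x : H) = x :=
  X.Dinv_D ⟨x, X.smooth_le_domain x.2⟩

theorem dirac_mul_absInv : X.dirac * X.absInv = X.absInv * X.dirac := by
  refine LinearMap.ext fun x => Subtype.ext (X.Dinv_injective ?_)
  have h := X.commute_absPow 1
  change X.Dinv (X.dirac (X.absInv x)) = X.Dinv (X.absPow 1 (X.dirac x))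
  rw [X.Dinv_dirac]
  have := congrArg (fun T : H →L[ℂ] H => T (X.dirac x : H)) h.eq
  simp only [mul_apply_eq_comp] at this
  rw [← this, X.Dinv_dirac]
  rfl

theorem dirac_sq_mul_absInv_sq : X.dirac ^ 2 * X.absInv ^ 2 = 1 := by
  have h : X.absInv ^ 2 * X.dirac ^ 2 = 1 := by
    refine LinearMap.ext fun x => Subtype.ext ?_
    change X.absPow 1 (X.absPow 1 (X.dirac (X.dirac x))) = (x : H)
    have := congrArg (fun T : H →L[ℂ] H => T (X.dirac (X.dirac x) : H)) X.absPow_one_sq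
    simp only [pow_two, mul_apply_eq_comp] at this
    rw [this, X.Dinv_dirac, X.Dinv_dirac]
  have hc : Commute X.dirac X.absInv := X.dirac_mul_absInv
  rw [(hc.pow_pow 2 2).eq, h]

theorem abs_eq : X.abs = X.dirac ^ 2 * X.absInv := by
  rw [abs, F, mul_assoc, ← X.dirac_mul_absInv, ← mul_assoc, pow_two]

theorem abs_mul_absInv : X.abs * X.absInv = 1 := by
  rw [abs_eq, mul_assoc, ← pow_two, X.dirac_sq_mul_absInv_sq]

theorem commute_dirac_absInv : Commute X.dirac X.absInv := X.dirac_mul_absInv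

theorem commute_dirac_abs : Commute X.dirac X.abs := by
  rw [abs_eq]
  exact ((Commute.refl _).pow_right 2).mul_right X.commute_dirac_absInv

theorem commute_absInv_abs : Commute X.absInv X.abs := by
  rw [abs_eq]
  exact (X.commute_dirac_absInv.symm.pow_right 2).mul_right (Commute.refl _)

theorem absInv_mul_abs : X.absInv * X.abs = 1 := by
  rw [X.commute_absInv_abs.eq, X.abs_mul_absInv]

theorem commute_F_abs : Commute X.F X.abs := X.commute_dirac_abs.mul_left X.commute_absInv_abs

theorem F_mul_F : X.F * X.F = 1 := by
  rw [F, X.commute_dirac_absInv.symm.mul_mul_mul_comm, ← pow_two, ← pow_two,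
    X.dirac_sq_mul_absInv_sq]

theorem abs_mul_F : X.abs * X.F = X.dirac := by
  rw [F, X.dirac_mul_absInv, ← mul_assoc, X.abs_mul_absInv, one_mul]

theorem dirac_sq : X.dirac ^ 2 = X.abs ^ 2 := by
  rw [← X.abs_mul_F, X.commute_F_abs.symm.mul_pow, pow_two X.F, X.F_mul_F, mul_one]

theorem absNegPow_add {z w : ℂ} (hz : 0 < z.re) (hw : 0 < w.re) :
    X.absNegPow (z + w) = X.absNegPow z * X.absNegPow w :=
  LinearMap.ext fun x => Subtype.ext
    (congrArg (fun T : H →L[ℂ] H => T (x : H)) (X.absPow_add hz hw))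

theorem absInv_pow_mul_absNegPow (m : ℕ) {z : ℂ} (hz : 0 < z.re) :
    X.absInv ^ m * X.absNegPow z = X.absNegPow (z + m) := by
  induction m with
  | zero => simp
  | succ m ih =>
    have h1 : (0 : ℝ) < (z + m).re := by simp; positivity
    have : z + ((m + 1 : ℕ) : ℂ) = 1 + (z + m) := by push_cast; ring
    rw [pow_succ', mul_assoc, ih, this, X.absNegPow_add (by simp) h1]
    rfl

/-! ### The derivation `δ` -/

theorem delta_add (S T : X.Op) : X.delta (S + T) = X.delta S + X.delta T := by
  simp only [delta, mul_add, add_mul]; abel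

theorem delta_mul (S T : X.Op) : X.delta (S * T) = X.delta S * T + S * X.delta T := by
  simp only [delta, mul_sub, sub_mul, mul_assoc]; abel

theorem delta_smul (c : ℂ) (T : X.Op) : X.delta (c • T) = c • X.delta T := by
  simp only [delta, mul_smul_comm, smul_mul_assoc, smul_sub]

/-- `δ` as a linear map. -/
def deltaHom : X.Op →ₗ[ℂ] X.Op where
  toFun := X.delta
  map_add' := X.delta_add
  map_smul' := X.delta_smul

theorem delta_iterate (k : ℕ) (T : X.Op) : X.delta^[k] T = (X.deltaHom ^ k) T := by
  rw [Module.End.pow_apply]; rfl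

theorem delta_F : X.delta X.F = 0 := sub_eq_zero.2 X.commute_F_abs.eq.symm

theorem delta_absInv : X.delta X.absInv = 0 := sub_eq_zero.2 X.commute_absInv_abs.eq.symm

theorem delta_one : X.delta 1 = 0 := by simp [delta]

theorem delta_abs_mul (T : X.Op) : X.delta (X.abs * T) = X.abs * X.delta T := by
  simp only [delta, mul_sub, mul_assoc]

theorem delta_mul_F (T : X.Op) : X.delta (T * X.F) = X.delta T * X.F := by
  rw [delta_mul, delta_F, mul_zero, add_zero]

theorem delta_iterate_mul_F (k : ℕ) (T : X.Op) :
    X.delta^[k] (T * X.F) = X.delta^[k] T * X.F := by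
  induction k generalizing T with
  | zero => rfl
  | succ k ih => rw [Function.iterate_succ_apply, delta_mul_F, ih, Function.iterate_succ_apply]

theorem delta_iterate_F_mul (k : ℕ) (T : X.Op) :
    X.delta^[k] (X.F * T) = X.F * X.delta^[k] T := by
  induction k generalizing T with
  | zero => rfl
  | succ k ih =>
    rw [Function.iterate_succ_apply, delta_mul, delta_F, zero_mul, zero_add, ih,
      Function.iterate_succ_apply]

theorem delta_iterate_abs_mul (k : ℕ) (T : X.Op) :
    X.delta^[k] (X.abs * T) = X.abs * X.delta^[k] T := by
  induction k generalizing T with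
  | zero => rfl
  | succ k ih => rw [Function.iterate_succ_apply, delta_abs_mul, ih, Function.iterate_succ_apply]

/-! ### Operators with bounded iterated commutators -/

/-- `S` is the bounded extension of the operator `T` on smooth vectors. -/
def Extends (S : H →L[ℂ] H) (T : X.Op) : Prop := ∀ x : X.smooth, S (x : H) = (T x : H)

/-- `T` extends to a bounded operator on the Hilbert space. -/
def IsBoundedOp (T : X.Op) : Prop := ∃ S : H →L[ℂ] H, X.Extends S T

variable {X}

theorem Extends.add {S S' : H →L[ℂ] H} {T T' : X.Op} (h : X.Extends S T) (h' : X.Extends S' T') :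
    X.Extends (S + S') (T + T') := fun x => by simp [h x, h' x]

theorem Extends.mul {S S' : H →L[ℂ] H} {T T' : X.Op} (h : X.Extends S T) (h' : X.Extends S' T') :
    X.Extends (S * S') (T * T') := fun x => by
  rw [mul_apply_eq_comp, h' x, h]; rfl

theorem Extends.smul {S : H →L[ℂ] H} {T : X.Op} (h : X.Extends S T) (c : ℂ) :
    X.Extends (c • S) (c • T) := fun x => by simp [h x]

theorem IsBoundedOp.add {S T : X.Op} (hS : X.IsBoundedOp S) (hT : X.IsBoundedOp T) :
    X.IsBoundedOp (S + T) := ⟨_, hS.choose_spec.add hT.choose_spec⟩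

theorem IsBoundedOp.mul {S T : X.Op} (hS : X.IsBoundedOp S) (hT : X.IsBoundedOp T) :
    X.IsBoundedOp (S * T) := ⟨_, hS.choose_spec.mul hT.choose_spec⟩

variable (X)

theorem isBoundedOp_zero : X.IsBoundedOp 0 := ⟨0, fun x => by simp⟩

theorem isBoundedOp_algebraMap (c : ℂ) : X.IsBoundedOp (algebraMap ℂ X.Op c) :=
  ⟨c • 1, fun x => by simp⟩

theorem isBoundedOp_absInv : X.IsBoundedOp X.absInv := ⟨X.absPow 1, fun _ => rfl⟩

theorem inner_dirac (x y : X.smooth) :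
    inner ℂ (X.dirac x : H) (y : H) = inner ℂ (x : H) (X.dirac y : H) := by
  have := X.inner_Dinv (X.dirac x : H) (X.dirac y : H)
  rwa [X.Dinv_dirac, X.Dinv_dirac] at this

theorem inner_absInv (x y : X.smooth) :
    inner ℂ (x : H) (X.absInv y : H) = inner ℂ (X.absInv x : H) (y : H) :=
  X.inner_absPow_one x y

theorem inner_F (x y : X.smooth) :
    inner ℂ (X.F x : H) (y : H) = inner ℂ (x : H) (X.F y : H) := by
  have : X.F y = X.absInv (X.dirac y) :=
    congrArg (fun T : X.Op => T y) X.dirac_mul_absInv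
  rw [this, X.inner_absInv, ← X.inner_dirac]
  rfl

theorem norm_F_apply (x : X.smooth) : ‖(X.F x : H)‖ = ‖(x : H)‖ := by
  have h : inner ℂ (X.F x : H) (X.F x : H) = inner ℂ (x : H) (x : H) := by
    rw [X.inner_F]
    congr 2
    exact congrArg (fun T : X.Op => T x) X.F_mul_F
  rw [inner_self_eq_norm_sq_to_K, inner_self_eq_norm_sq_to_K] at h
  have h' : ‖(X.F x : H)‖ ^ 2 = ‖(x : H)‖ ^ 2 := by exact_mod_cast h
  exact (sq_eq_sq₀ (norm_nonneg _) (norm_nonneg _)).1 h'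

/-- `F` is isometric on the dense space of smooth vectors, hence bounded. -/
theorem isBoundedOp_F : X.IsBoundedOp X.F := by
  obtain ⟨ι, ⟨E⟩⟩ := X.exists_eigenBasis
  let f : X.smooth →L[ℂ] H := (X.smooth.subtype ∘ₗ X.F).mkContinuous 1 fun x => by
    simp [X.norm_F_apply]
  have hd : DenseRange X.smooth.subtypeL := by
    have := E.dense_smooth
    rwa [DenseRange, Submodule.coe_subtypeL, Submodule.coe_subtype, Subtype.range_coe]
  refine ⟨f.extend X.smooth.subtypeL, fun x => ?_⟩
  have := f.extend_eq hd (isUniformInducing_val _) x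
  exact this

/-- The operators `T` for which all `δ^k(T)` are bounded. -/
def boundedDeltas : Subalgebra ℂ X.Op where
  carrier := {T | ∀ k, X.IsBoundedOp (X.delta^[k] T)}
  add_mem' {S T} hS hT k := by
    rw [delta_iterate, map_add, ← delta_iterate, ← delta_iterate]
    exact (hS k).add (hT k)
  mul_mem' {S T} hS hT k := by
    induction k generalizing S T with
    | zero => exact (hS 0).mul (hT 0)
    | succ k ih =>
      rw [Function.iterate_succ_apply, delta_mul, delta_iterate, map_add, ← delta_iterate,
        ← delta_iterate]
      exact (ih (fun j => hS (j + 1)) hT).add (ih hS fun j => hT (j + 1))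
  algebraMap_mem' c k := by
    cases k with
    | zero => exact X.isBoundedOp_algebraMap c
    | succ k =>
      rw [Function.iterate_succ_apply, Algebra.algebraMap_eq_smul_one, delta_smul, delta_one,
        smul_zero, delta_iterate, map_zero]
      exact X.isBoundedOp_zero

variable {X}

theorem isBoundedOp_of_mem {T : X.Op} (hT : T ∈ X.boundedDeltas) : X.IsBoundedOp T := hT 0

theorem delta_mem_boundedDeltas {T : X.Op} (hT : T ∈ X.boundedDeltas) :
    X.delta T ∈ X.boundedDeltas := fun k => hT (k + 1)

theorem delta_iterate_mem_boundedDeltas {T : X.Op} (hT : T ∈ X.boundedDeltas) (k : ℕ) :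
    X.delta^[k] T ∈ X.boundedDeltas := by
  induction k with
  | zero => exact hT
  | succ k ih => rw [Function.iterate_succ_apply']; exact delta_mem_boundedDeltas ih

theorem mem_boundedDeltas_of_delta_eq_zero {T : X.Op} (hT : X.IsBoundedOp T)
    (h : X.delta T = 0) : T ∈ X.boundedDeltas := by
  rintro (_ | k)
  · exact hT
  · rw [Function.iterate_succ_apply, h, delta_iterate, map_zero]
    exact X.isBoundedOp_zero

variable (X)

theorem F_mem_boundedDeltas : X.F ∈ X.boundedDeltas :=
  mem_boundedDeltas_of_delta_eq_zero X.isBoundedOp_F X.delta_F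

theorem absInv_mem_boundedDeltas : X.absInv ∈ X.boundedDeltas :=
  mem_boundedDeltas_of_delta_eq_zero X.isBoundedOp_absInv X.delta_absInv

theorem extends_delta {T : X.Op} {T' S' : H →L[ℂ] H} (hT : X.Extends T' T)
    (h : HasBoundedCommutator X.absD T' S') : X.Extends S' (X.delta T) := by
  have h1 := SpectralTriple.HasBoundedCommutator.intertwine X.toSpectralTriple h
  intro x
  have hx : x = X.absInv (X.abs x) :=
    congrArg (fun T : X.Op => T x) X.absInv_mul_abs.symm
  have h2 := congrArg (fun S : H →L[ℂ] H => S (X.abs x : H)) h1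
  simp only [mul_apply_eq_comp, add_apply] at h2
  have e : X.absPow 1 (X.abs x : H) = (x : H) := (congrArg Subtype.val hx).symm
  rw [e, hT, hT] at h2
  apply X.absPow_one_injective
  have h3 : X.absInv (X.delta T x) = T x - X.absInv (T (X.abs x)) := by
    have : X.absInv * X.delta T = T - X.absInv * T * X.abs := by
      rw [delta, mul_sub, ← mul_assoc, X.absInv_mul_abs, one_mul, mul_assoc]
    exact congrArg (fun T : X.Op => T x) this
  have h4 : X.absPow 1 (X.delta T x : H) = (T x : H) - X.absPow 1 (T (X.abs x) : H) :=
    congrArg Subtype.val h3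
  rw [h4, h2, map_add, add_sub_cancel_left]

theorem isBoundedOp_delta_iterate (n : ℕ) {T : X.Op} {T' : H →L[ℂ] H} (hT : X.Extends T' T)
    (h : X.InDomDelta n T') : X.IsBoundedOp (X.delta^[n] T) := by
  induction n generalizing T T' with
  | zero => exact ⟨T', hT⟩
  | succ n ih =>
    obtain ⟨S', h1, h2⟩ := h
    exact ih (X.extends_delta hT h1) h2

theorem rep_mem_boundedDeltas (a : A) : X.rep a ∈ X.boundedDeltas := fun k =>
  X.isBoundedOp_delta_iterate k (T' := X.π a) (fun _ => rfl)
    (X.isRegular _ (Algebra.subset_adjoin (Or.inl ⟨a, rfl⟩)) k)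

theorem dComm_mem_boundedDeltas (a : A) : X.dComm a ∈ X.boundedDeltas := fun k => by
  obtain ⟨S, hS⟩ := X.bounded_comm a
  refine X.isBoundedOp_delta_iterate k (T' := S) (fun x => ?_)
    (X.isRegular _ (Algebra.subset_adjoin (Or.inr ⟨a, hS⟩)) k)
  obtain ⟨h1, h2⟩ := hS ⟨x, X.smooth_le_domain x.2⟩
  exact h2.symm

theorem psiZero_le_boundedDeltas : X.psiZero ≤ X.boundedDeltas := by
  refine Algebra.adjoin_le ?_
  rintro T (⟨k, a, rfl⟩ | ⟨k, a, rfl⟩)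
  · exact delta_iterate_mem_boundedDeltas (X.rep_mem_boundedDeltas a) k
  · exact delta_iterate_mem_boundedDeltas (X.dComm_mem_boundedDeltas a) k

theorem delta_iterate_rep_mem_psiZero (k : ℕ) (a : A) : X.delta^[k] (X.rep a) ∈ X.psiZero :=
  Algebra.subset_adjoin (Or.inl ⟨k, a, rfl⟩)

theorem delta_iterate_dComm_mem_psiZero (k : ℕ) (a : A) : X.delta^[k] (X.dComm a) ∈ X.psiZero :=
  Algebra.subset_adjoin (Or.inr ⟨k, a, rfl⟩)

theorem rep_mul (a a' : A) : X.rep (a * a') = X.rep a * X.rep a' :=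
  LinearMap.ext fun x => Subtype.ext (by simp [rep])

theorem rep_one : X.rep 1 = 1 :=
  LinearMap.ext fun x => Subtype.ext (by simp [rep])

/-- The representation on smooth vectors, as a linear map. -/
def repHom : A →ₗ[ℂ] X.Op where
  toFun := X.rep
  map_add' a a' := LinearMap.ext fun x => Subtype.ext (by simp [rep])
  map_smul' c a := LinearMap.ext fun x => Subtype.ext (by simp [rep])

end RegularSpectralTriple

/-! ### Matrix coefficients -/

namespace SpectralTriple.EigenBasis

open RegularSpectralTriple

variable {A : Type*} [Ring A] [StarRing A] [Algebra ℂ A] [StarModule ℂ A]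
  {H : Type*} [NormedAddCommGroup H] [InnerProductSpace ℂ H] [CompleteSpace H]
  {X : RegularSpectralTriple A H} {ι : Type*} (E : X.EigenBasis ι)

theorem absNegPow_vec {z : ℂ} (hz : 0 < z.re) (i : ι) :
    X.absNegPow z (E.vec i) = (E.lam i : ℂ) ^ (-z) • E.vec i :=
  Subtype.ext (E.absPow_b hz i)

theorem absInv_vec (i : ι) : X.absInv (E.vec i) = (E.lam i : ℂ)⁻¹ • E.vec i :=
  Subtype.ext (E.absPow_one_b i)

theorem abs_vec (i : ι) : X.abs (E.vec i) = (E.lam i : ℂ) • E.vec i := by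
  have h := congrArg (fun T : X.Op => T (E.vec i)) X.abs_mul_absInv
  simp only [Module.End.mul_apply, E.absInv_vec, map_smul, Module.End.one_apply] at h
  rw [← h, smul_smul, mul_inv_cancel₀ (E.lam_ne_zero i), one_smul, h]

theorem dirac_vec (i : ι) : X.dirac (E.vec i) = (E.ev i : ℂ)⁻¹ • E.vec i := by
  have h0 : (E.ev i : ℂ) ≠ 0 := Complex.ofReal_ne_zero.2 (E.ev_ne_zero i)
  refine Subtype.ext (X.Dinv_injective ?_)
  rw [X.Dinv_dirac]
  change E.b i = X.Dinv ((E.ev i : ℂ)⁻¹ • E.b i)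
  rw [map_smul, E.Dinv_b, smul_smul, inv_mul_cancel₀ h0, one_smul]

theorem F_vec (i : ι) : X.F (E.vec i) = E.sgn i • E.vec i := by
  rw [F, Module.End.mul_apply, E.absInv_vec, map_smul, E.dirac_vec, smul_smul]
  congr 1
  rw [sgn, lam]
  push_cast
  rw [inv_inv, div_eq_mul_inv]

/-- The matrix coefficient `⟨e_i, T e_j⟩` of an operator on smooth vectors. -/
def mat (T : X.Op) (i j : ι) : ℂ := inner ℂ (E.b i) (T (E.vec j) : H)

/-- The diagonal matrix coefficients. -/
def diag (T : X.Op) (i : ι) : ℂ := E.mat T i i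

@[simp] theorem mat_add (S T : X.Op) (i j : ι) : E.mat (S + T) i j = E.mat S i j + E.mat T i j := by
  simp [mat]

@[simp] theorem mat_sub (S T : X.Op) (i j : ι) : E.mat (S - T) i j = E.mat S i j - E.mat T i j := by
  simp [mat]

@[simp] theorem mat_smul (c : ℂ) (T : X.Op) (i j : ι) : E.mat (c • T) i j = c * E.mat T i j := by
  simp [mat]

@[simp] theorem mat_mul_absInv (T : X.Op) (i j : ι) :
    E.mat (T * X.absInv) i j = E.mat T i j * (E.lam j : ℂ)⁻¹ := by
  simp [mat, E.absInv_vec, mul_comm]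

@[simp] theorem mat_mul_absInv_pow (T : X.Op) (m : ℕ) (i j : ι) :
    E.mat (T * X.absInv ^ m) i j = E.mat T i j * ((E.lam j : ℂ)⁻¹) ^ m := by
  induction m with
  | zero => simp
  | succ m ih => rw [pow_succ, ← mul_assoc, mat_mul_absInv, ih, pow_succ, mul_assoc]

@[simp] theorem mat_mul_abs (T : X.Op) (i j : ι) :
    E.mat (T * X.abs) i j = E.mat T i j * E.lam j := by
  simp [mat, E.abs_vec, mul_comm]

@[simp] theorem mat_mul_F (T : X.Op) (i j : ι) :
    E.mat (T * X.F) i j = E.mat T i j * E.sgn j := by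
  simp [mat, E.F_vec, mul_comm]

theorem mat_mul_absNegPow (T : X.Op) {z : ℂ} (hz : 0 < z.re) (i j : ι) :
    E.mat (T * X.absNegPow z) i j = E.mat T i j * (E.lam j : ℂ) ^ (-z) := by
  simp [mat, E.absNegPow_vec hz, mul_comm]

theorem mat_absInv_mul (T : X.Op) (i j : ι) :
    E.mat (X.absInv * T) i j = (E.lam i : ℂ)⁻¹ * E.mat T i j := by
  have := X.inner_absInv (E.vec i) (T (E.vec j))
  rw [E.absInv_vec] at this
  refine this.trans ?_
  simp [mat, vec, mul_comm]

@[simp] theorem mat_abs_mul (T : X.Op) (i j : ι) :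
    E.mat (X.abs * T) i j = E.lam i * E.mat T i j := by
  have := E.mat_absInv_mul (X.abs * T) i j
  rw [← mul_assoc, X.absInv_mul_abs, one_mul] at this
  rw [this, mul_inv_cancel_left₀ (E.lam_ne_zero i)]

@[simp] theorem mat_F_mul (T : X.Op) (i j : ι) :
    E.mat (X.F * T) i j = E.sgn i * E.mat T i j := by
  have := X.inner_F (E.vec i) (T (E.vec j))
  rw [E.F_vec] at this
  refine this.symm.trans ?_
  simp [mat, vec, sgn, mul_comm]

theorem mat_delta (T : X.Op) (i j : ι) :
    E.mat (X.delta T) i j = (E.lam i - E.lam j) * E.mat T i j := by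
  rw [delta, mat_sub, mat_abs_mul, mat_mul_abs]; ring

theorem mat_delta_iterate (k : ℕ) (T : X.Op) (i j : ι) :
    E.mat (X.delta^[k] T) i j = (E.lam i - E.lam j) ^ k * E.mat T i j := by
  induction k generalizing T with
  | zero => simp
  | succ k ih => rw [Function.iterate_succ_apply, ih, mat_delta, pow_succ, mul_assoc]

theorem diag_delta (T : X.Op) (i : ι) : E.diag (X.delta T) i = 0 := by
  rw [diag, mat_delta, sub_self, zero_mul]

theorem mat_eq_of_extends {T : X.Op} {S : H →L[ℂ] H} (h : X.Extends S T) (i j : ι) :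
    E.mat T i j = inner ℂ (E.b i) (S (E.b j)) := by
  rw [mat, ← h]; rfl

/-- Matrix multiplication. -/
theorem hasSum_mat_mul {S : X.Op} (hS : X.IsBoundedOp S) (T : X.Op) (i j : ι) :
    HasSum (fun k => E.mat S i k * E.mat T k j) (E.mat (S * T) i j) := by
  obtain ⟨S', hS'⟩ := hS
  have h := E.b.hasSum_inner_mul_inner (ContinuousLinearMap.adjoint S' (E.b i))
    (T (E.vec j) : H)
  simp only [ContinuousLinearMap.adjoint_inner_left] at h
  rw [hS'] at h
  rw [show (fun k => E.mat S i k * E.mat T k j) = _ from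
    funext fun k => by rw [E.mat_eq_of_extends hS']]
  exact h

/-- The matrix coefficients of bounded operators `S` and `T` satisfy
`∑ k, |S_ik| |T_kj| ≤ ‖S‖ ‖T‖`. -/
theorem exists_tsum_norm_mat_mul_le {S T : X.Op} (hS : X.IsBoundedOp S) (hT : X.IsBoundedOp T) :
    ∃ C : ℝ, ∀ i j, Summable (fun k => ‖E.mat S i k‖ * ‖E.mat T k j‖) ∧
      ∑' k, ‖E.mat S i k‖ * ‖E.mat T k j‖ ≤ C := by
  obtain ⟨S', hS'⟩ := hS
  obtain ⟨T', hT'⟩ := hT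
  refine ⟨‖ContinuousLinearMap.adjoint S'‖ * ‖T'‖, fun i j => ?_⟩
  have e : (fun k => ‖E.mat S i k‖ * ‖E.mat T k j‖) = fun k =>
      ‖inner ℂ (ContinuousLinearMap.adjoint S' (E.b i)) (E.b k)‖ *
        ‖inner ℂ (E.b k) (T' (E.b j))‖ := by
    funext k
    rw [E.mat_eq_of_extends hS', E.mat_eq_of_extends hT', ContinuousLinearMap.adjoint_inner_left]
  rw [e]
  refine ⟨summable_norm_inner_mul_inner _ _ _, (tsum_norm_inner_mul_inner_le _ _ _).trans ?_⟩
  gcongr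
  · simpa [E.b.orthonormal.1 i] using
      (ContinuousLinearMap.adjoint S').le_opNorm (E.b i)
  · simpa [E.b.orthonormal.1 j] using T'.le_opNorm (E.b j)

/-! ### Traces and the diagonal -/

theorem hasSum_diag_of_hasTrace {T : X.Op} {t : ℂ} (h : X.HasTrace T t) :
    HasSum (E.diag T) t := by
  obtain ⟨S, hS, hS', rfl⟩ := h
  convert hS'.hasSum_opTrace E.b using 2 with i
  exact E.mat_eq_of_extends hS i i

theorem summable_diag_of_isTraceClassOp {T : X.Op} (h : X.IsTraceClassOp T) :
    Summable (E.diag T) := by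
  obtain ⟨S, hS, hS'⟩ := h
  exact (E.hasSum_diag_of_hasTrace ⟨S, hS, hS', rfl⟩).summable

end SpectralTriple.EigenBasis

namespace RegularSpectralTriple

variable {A : Type*} [Ring A] [StarRing A] [Algebra ℂ A] [StarModule ℂ A]
  {H : Type*} [NormedAddCommGroup H] [InnerProductSpace ℂ H] [CompleteSpace H]
  {X : RegularSpectralTriple A H}

theorem IsTraceClassOp.mul_left {T : X.Op} (hT : X.IsTraceClassOp T) {B : X.Op}
    (hB : X.IsBoundedOp B) : X.IsTraceClassOp (B * T) := by
  obtain ⟨S, hS, hS'⟩ := hT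
  obtain ⟨B', hB'⟩ := hB
  exact ⟨B' * S, Extends.mul hB' hS, hS'.mul_left B'⟩

theorem IsTraceClassOp.mul_right {T : X.Op} (hT : X.IsTraceClassOp T) {B : X.Op}
    (hB : X.IsBoundedOp B) : X.IsTraceClassOp (T * B) := by
  obtain ⟨S, hS, hS'⟩ := hT
  obtain ⟨B', hB'⟩ := hB
  exact ⟨S * B', Extends.mul hS hB', hS'.mul_right B'⟩

theorem IsTraceClassOp.tsum_diag_mul_comm {T : X.Op} (hT : X.IsTraceClassOp T) {B : X.Op}
    (hB : X.IsBoundedOp B) {ι : Type*} (E : X.EigenBasis ι) :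
    ∑' i, E.diag (B * T) i = ∑' i, E.diag (T * B) i := by
  obtain ⟨S, hS, hS'⟩ := hT
  obtain ⟨B', hB'⟩ := hB
  rw [(E.hasSum_diag_of_hasTrace ⟨B' * S, Extends.mul hB' hS, hS'.mul_left B', rfl⟩).tsum_eq,
    (E.hasSum_diag_of_hasTrace ⟨S * B', Extends.mul hS hB', hS'.mul_right B', rfl⟩).tsum_eq,
    hS'.opTrace_mul_comm B']

theorem HasTrace.add {S T : X.Op} {s t : ℂ} (hS : X.HasTrace S s) (hT : X.HasTrace T t) :
    X.HasTrace (S + T) (s + t) := by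
  obtain ⟨ι, ⟨E⟩⟩ := X.exists_eigenBasis
  have hs := E.hasSum_diag_of_hasTrace hS
  have ht := E.hasSum_diag_of_hasTrace hT
  obtain ⟨S', hS, hS', -⟩ := hS
  obtain ⟨T', hT, hT', -⟩ := hT
  have h : X.HasTrace (S + T) (opTrace (S' + T')) := ⟨_, Extends.add hS hT, hS'.add hT', rfl⟩
  convert h
  refine HasSum.unique ?_ (E.hasSum_diag_of_hasTrace h)
  rw [show E.diag (S + T) = _ from funext fun i => E.mat_add S T i i]
  exact hs.add ht

theorem HasTrace.smul {T : X.Op} {t : ℂ} (hT : X.HasTrace T t) (c : ℂ) :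
    X.HasTrace (c • T) (c * t) := by
  obtain ⟨ι, ⟨E⟩⟩ := X.exists_eigenBasis
  have ht := E.hasSum_diag_of_hasTrace hT
  obtain ⟨T', hT, hT', -⟩ := hT
  have h : X.HasTrace (c • T) (opTrace (c • T')) := ⟨_, Extends.smul hT c, hT'.smul c, rfl⟩
  convert h
  refine HasSum.unique ?_ (E.hasSum_diag_of_hasTrace h)
  rw [show E.diag (c • T) = _ from funext fun i => E.mat_smul c T i i]
  exact ht.mul_left c

/-! ### Trace class factors under the residue -/

theorem absInv_pow_mem_boundedDeltas (m : ℕ) : X.absInv ^ m ∈ X.boundedDeltas :=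
  pow_mem X.absInv_mem_boundedDeltas m

/-- `|D|` can be moved through an operator with bounded `δ`-derivatives: from left to right. -/
theorem exists_abs_pow_mul_eq {Y : X.Op} (hY : Y ∈ X.boundedDeltas) (q : ℕ) :
    ∃ Y' ∈ X.boundedDeltas, X.abs ^ q * Y = Y' * X.abs ^ q := by
  induction q with
  | zero => exact ⟨Y, hY, by simp⟩
  | succ q ih =>
    obtain ⟨Y', hY', e⟩ := ih
    refine ⟨Y' + X.delta Y' * X.absInv, add_mem hY'
      (mul_mem (delta_mem_boundedDeltas hY') X.absInv_mem_boundedDeltas), ?_⟩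
    rw [pow_succ', mul_assoc, e, ← mul_assoc, ← mul_assoc, add_mul, mul_assoc _ X.absInv,
      X.absInv_mul_abs, delta]
    simp

/-- `|D|` can be moved through an operator with bounded `δ`-derivatives: from right to left. -/
theorem exists_mul_abs_pow_eq {Y : X.Op} (hY : Y ∈ X.boundedDeltas) (q : ℕ) :
    ∃ Y' ∈ X.boundedDeltas, Y * X.abs ^ q = X.abs ^ q * Y' := by
  induction q with
  | zero => exact ⟨Y, hY, by simp⟩
  | succ q ih =>
    obtain ⟨Y', hY', e⟩ := ih
    refine ⟨Y' - X.absInv * X.delta Y', sub_mem hY'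
      (mul_mem X.absInv_mem_boundedDeltas (delta_mem_boundedDeltas hY')), ?_⟩
    rw [pow_succ, ← mul_assoc, e, mul_assoc, mul_assoc, mul_sub X.abs, ← mul_assoc X.abs X.absInv,
      X.abs_mul_absInv, one_mul, delta]
    simp

/-- If `S` is trace class then so is, on the diagonal, every expression of order at most `0` in
`|D|` that contains `S` as a factor. Only the diagonal is claimed: powers of `|D|` that end up on
the far left and on the far right cancel there, although the operator need not be bounded. -/
theorem summable_diag_mul_delta_iterate_mul {S : X.Op} (hS : X.IsTraceClassOp S) {ι : Type*}
    (E : X.EigenBasis ι) {V W : X.Op} (hV : V ∈ X.boundedDeltas) (hW : W ∈ X.boundedDeltas)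
    {p k q m : ℕ} (h : p + k + q ≤ m) :
    Summable (E.diag (V * X.abs ^ p * X.delta^[k] S * X.abs ^ q * W * X.absInv ^ m)) := by
  induction k generalizing p q with
  | zero =>
    obtain ⟨V', hV', eV⟩ := exists_mul_abs_pow_eq hV p
    obtain ⟨W', hW', eW⟩ := exists_abs_pow_mul_eq hW q
    have hB := (hS.mul_left (isBoundedOp_of_mem hV')).mul_right (isBoundedOp_of_mem
      (mul_mem hW' (absInv_pow_mem_boundedDeltas (X := X) (m - q - p))))
    refine (E.summable_diag_of_isTraceClassOp hB).congr fun i => ?_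
    have e : V * X.abs ^ p * X.delta^[0] S * X.abs ^ q * W * X.absInv ^ m =
        X.abs ^ p * (V' * S * W') * (X.abs ^ q * X.absInv ^ m) := by
      rw [eV, Function.iterate_zero, id]
      simp only [mul_assoc]
      rw [← mul_assoc (X.abs ^ q) W, eW, mul_assoc]
    have e2 : X.abs ^ q * X.absInv ^ m = X.absInv ^ (m - q) := by
      obtain ⟨n, rfl⟩ := Nat.exists_eq_add_of_le (show q ≤ m by omega)
      rw [pow_add, ← mul_assoc, ← X.commute_absInv_abs.symm.mul_pow, X.abs_mul_absInv, one_pow,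
        one_mul, Nat.add_sub_cancel_left]
    have e3 : ∀ (n : ℕ) (T : X.Op), E.mat (X.abs ^ n * T) i i = (E.lam i : ℂ) ^ n * E.mat T i i := by
      intro n T
      induction n with
      | zero => simp
      | succ n ih => rw [pow_succ', mul_assoc, E.mat_abs_mul, ih, pow_succ', mul_assoc]
    simp only [SpectralTriple.EigenBasis.diag]
    rw [e, e2, mul_assoc (X.abs ^ p), e3, ← mul_assoc (V' * S), E.mat_mul_absInv_pow,
      E.mat_mul_absInv_pow, mul_left_comm]
    congr 1
    obtain ⟨n, hn⟩ := Nat.exists_eq_add_of_le (show p ≤ m - q by omega)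
    rw [hn, Nat.add_sub_cancel_left, pow_add, ← mul_assoc, ← mul_pow,
      mul_inv_cancel₀ (E.lam_ne_zero i), one_pow, one_mul]
  | succ k ih =>
    refine ((ih (p := p + 1) (q := q) (by omega)).sub (ih (p := p) (q := q + 1) (by omega))).congr
      fun i => ?_
    rw [SpectralTriple.EigenBasis.diag, SpectralTriple.EigenBasis.diag,
      SpectralTriple.EigenBasis.diag, ← E.mat_sub, Function.iterate_succ_apply']
    congr 1
    simp only [delta, pow_succ, pow_succ' X.abs q, mul_sub, sub_mul, mul_assoc]

end RegularSpectralTriple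

/-! ### Dirichlet series and their residues at `0` -/

section Dirichlet

variable {ι : Type*}

/-- `f` is meromorphic in the right half-plane `Re z > 0`, and is the sum of the Dirichlet series
`∑ i, d i * (lam i) ^ (-z)` in some smaller right half-plane. -/
def IsDirichlet (lam : ι → ℝ) (d : ι → ℂ) (f : ℂ → ℂ) : Prop :=
  MeromorphicOn f {z | 0 < z.re} ∧
    ∃ R : ℝ, ∀ z : ℂ, R < z.re → HasSum (fun i => d i * (lam i : ℂ) ^ (-z)) (f z)

/-- The residue at `0` of a Dirichlet series, as the limit of `t * f t` for `t → 0+`. No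
continuation beyond the half-plane `Re z > 0` is required. -/
def DirichletResidue (lam : ι → ℝ) (d : ι → ℂ) (r : ℂ) : Prop :=
  ∃ f, IsDirichlet lam d f ∧ Tendsto (fun t : ℝ => (t : ℂ) * f t) (𝓝[>] 0) (𝓝 r)

/-- The value at `0` of a Dirichlet series, as the limit of `f t` for `t → 0+`. -/
def DirichletValue (lam : ι → ℝ) (d : ι → ℂ) (v : ℂ) : Prop :=
  ∃ f, IsDirichlet lam d f ∧ Tendsto (fun t : ℝ => f t) (𝓝[>] 0) (𝓝 v)

variable {lam : ι → ℝ} {d d' : ι → ℂ} {f g : ℂ → ℂ}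

theorem isPreconnected_re_pos : IsPreconnected {z : ℂ | 0 < z.re} :=
  (convex_halfSpace_re_gt 0).isPreconnected

theorem isOpen_re_pos : IsOpen {z : ℂ | 0 < z.re} :=
  isOpen_lt continuous_const Complex.continuous_re

/-- Two continuations of one Dirichlet series agree at points arbitrarily close to `0`, by the
identity theorem for meromorphic functions. -/
theorem IsDirichlet.frequently_eq (hf : IsDirichlet lam d f) (hg : IsDirichlet lam d g) :
    ∃ᶠ t : ℝ in 𝓝[>] 0, f t = g t := by
  obtain ⟨hfm, R, hR⟩ := hf
  obtain ⟨hgm, R', hR'⟩ := hg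
  have hm : MeromorphicOn (f - g) {z | 0 < z.re} := hfm.sub hgm
  set x₀ : ℂ := ((max (max R R') 0 + 1 : ℝ) : ℂ) with hx₀
  have hx₀re : x₀.re = max (max R R') 0 + 1 := Complex.ofReal_re _
  have hx₀U : x₀ ∈ {z : ℂ | 0 < z.re} := by
    have := le_max_right (max R R') 0
    simp only [Set.mem_ofPred_eq, hx₀re]
    linarith
  have htop : meromorphicOrderAt (f - g) x₀ = ⊤ := by
    rw [meromorphicOrderAt_eq_top_iff]
    refine Filter.Eventually.filter_mono nhdsWithin_le_nhds ?_
    have ho : IsOpen {z : ℂ | max (max R R') 0 < z.re} :=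
      isOpen_lt continuous_const Complex.continuous_re
    filter_upwards [ho.mem_nhds (by simp only [Set.mem_ofPred_eq, hx₀re]; linarith)] with z hz
    simp only [max_lt_iff] at hz
    exact sub_eq_zero.2 ((hR z hz.1.1).unique (hR' z hz.1.2))
  have hall : ∀ z ∈ {z : ℂ | 0 < z.re}, meromorphicOrderAt (f - g) z = ⊤ := by
    intro z hz
    by_contra hne
    exact hm.meromorphicOrderAt_ne_top_of_isPreconnected isPreconnected_re_pos hz hx₀U hne htop
  intro hev
  obtain ⟨ε, hε, hsub⟩ := mem_nhdsGT_iff_exists_Ioo_subset.1 hev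
  have hε : (0 : ℝ) < ε := hε
  have h1 := meromorphicOrderAt_eq_top_iff.1 (hall ((ε / 2 : ℝ) : ℂ)
    (by simp only [Set.mem_ofPred_eq, Complex.ofReal_re]; positivity))
  have h2 : Tendsto (fun s : ℝ => (s : ℂ)) (𝓝[≠] (ε / 2)) (𝓝[≠] ((ε / 2 : ℝ) : ℂ)) :=
    tendsto_nhdsWithin_of_tendsto_nhds_of_eventually_within _
      (Complex.continuous_ofReal.continuousAt.mono_left nhdsWithin_le_nhds)
      (eventually_nhdsWithin_of_forall fun s hs => by
        simpa only [Set.mem_compl_iff, Set.mem_singleton_iff, Complex.ofReal_inj] using hs)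
  have h3 : ∀ᶠ s in 𝓝[≠] (ε / 2), s ∈ Set.Ioo 0 ε :=
    nhdsWithin_le_nhds (Ioo_mem_nhds (by positivity) (by linarith))
  obtain ⟨s, hs1, hs2⟩ := ((h2.eventually h1).and h3).exists
  exact hsub hs2 (sub_eq_zero.1 hs1)

theorem DirichletResidue.unique {r r' : ℂ} (h : DirichletResidue lam d r)
    (h' : DirichletResidue lam d r') : r = r' := by
  obtain ⟨f, hf, hr⟩ := h
  obtain ⟨g, hg, hr'⟩ := h'
  refine tendsto_nhds_unique_of_frequently_eq hr hr' ?_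
  exact (hf.frequently_eq hg).mono fun t ht => by rw [ht]

theorem DirichletValue.unique {r r' : ℂ} (h : DirichletValue lam d r)
    (h' : DirichletValue lam d r') : r = r' := by
  obtain ⟨f, hf, hr⟩ := h
  obtain ⟨g, hg, hr'⟩ := h'
  exact tendsto_nhds_unique_of_frequently_eq hr hr' (hf.frequently_eq hg)

theorem IsDirichlet.add (hf : IsDirichlet lam d f) (hg : IsDirichlet lam d' g) :
    IsDirichlet lam (d + d') (f + g) := by
  obtain ⟨hfm, R, hR⟩ := hf
  obtain ⟨hgm, R', hR'⟩ := hg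
  refine ⟨hfm.add hgm, max R R', fun z hz => ?_⟩
  rw [max_lt_iff] at hz
  convert (hR z hz.1).add (hR' z hz.2) using 2
  · simp [add_mul]
  · rfl

theorem DirichletResidue.add {r r' : ℂ} (h : DirichletResidue lam d r)
    (h' : DirichletResidue lam d' r') : DirichletResidue lam (d + d') (r + r') := by
  obtain ⟨f, hf, hr⟩ := h
  obtain ⟨g, hg, hr'⟩ := h'
  refine ⟨f + g, hf.add hg, ?_⟩
  simpa [mul_add] using hr.add hr'

theorem DirichletValue.add {r r' : ℂ} (h : DirichletValue lam d r)
    (h' : DirichletValue lam d' r') : DirichletValue lam (d + d') (r + r') := by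
  obtain ⟨f, hf, hr⟩ := h
  obtain ⟨g, hg, hr'⟩ := h'
  exact ⟨f + g, hf.add hg, hr.add hr'⟩

theorem norm_ofReal_cpow_neg {x : ℝ} (hx : 0 < x) (z : ℂ) : ‖(x : ℂ) ^ (-z)‖ = x ^ (-z.re) := by
  rw [Complex.norm_cpow_eq_rpow_re_of_pos hx, Complex.neg_re]

theorem differentiable_const_cpow_neg {x : ℝ} (hx : 0 < x) :
    Differentiable ℂ fun z : ℂ => (x : ℂ) ^ (-z) := fun _ =>
  (differentiableAt_id.neg).const_cpow (Or.inl (Complex.ofReal_ne_zero.2 hx.ne'))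

/-- A series of holomorphic functions that is dominated, on bounded parts of the half-plane
`Re z > 0`, by convergent series of constants is holomorphic there. -/
theorem meromorphicOn_tsum {κ : Type*} {u : κ → ℂ → ℂ}
    (hu : ∀ k, Differentiable ℂ (u k)) {w : κ → ℝ} (hw : Summable w)
    (C : ℝ → ℝ) (hb : ∀ B k z, 0 < z.re → ‖z‖ < B → ‖u k z‖ ≤ C B * w k) :
    MeromorphicOn (fun z => ∑' k, u k z) {z | 0 < z.re} := by
  intro z hz
  have hopen : IsOpen ({z : ℂ | 0 < z.re} ∩ Metric.ball 0 (‖z‖ + 1)) :=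
    isOpen_re_pos.inter Metric.isOpen_ball
  have hd := Complex.differentiableOn_tsum_of_summable_norm (F := u)
    (hw.mul_left (C (‖z‖ + 1))) (fun k => (hu k).differentiableOn) hopen
    fun k y hy => hb _ k y hy.1 (by simpa using hy.2)
  exact (hd.analyticAt (hopen.mem_nhds ⟨hz, by simp⟩)).meromorphicAt

theorem rpow_neg_le {c x r B : ℝ} (hc : 0 < c) (hc1 : c ≤ 1) (hx : c ≤ x) (hr : 0 ≤ r)
    (hB : r ≤ B) : x ^ (-r) ≤ c ^ (-B) :=
  (Real.rpow_le_rpow_of_nonpos hc hx (by linarith)).trans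
    (Real.rpow_le_rpow_of_exponent_ge hc hc1 (by linarith))

/-- A Dirichlet series with summable coefficients converges for `Re z > 0`, and is continuous up
to `0` along the positive real axis. -/
theorem exists_isDirichlet_of_summable {c : ℝ} (hc : 0 < c) (hc1 : c ≤ 1)
    (hlam : ∀ i, c ≤ lam i) (hd : Summable d) :
    ∃ f, IsDirichlet lam d f ∧ Tendsto (fun t : ℝ => f t) (𝓝[>] 0) (𝓝 (∑' i, d i)) := by
  have hpos : ∀ i, 0 < lam i := fun i => hc.trans_le (hlam i)
  have hb : ∀ (B : ℝ) i (z : ℂ), 0 < z.re → ‖z‖ < B →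
      ‖d i * (lam i : ℂ) ^ (-z)‖ ≤ c ^ (-B) * ‖d i‖ := by
    intro B i z hz hB
    rw [norm_mul, norm_ofReal_cpow_neg (hpos i), mul_comm]
    gcongr
    exact rpow_neg_le hc hc1 (hlam i) hz.le ((Complex.re_le_norm z).trans hB.le)
  refine ⟨fun z => ∑' i, d i * (lam i : ℂ) ^ (-z), ⟨meromorphicOn_tsum
    (fun i => (differentiable_const_cpow_neg (hpos i)).const_mul _) hd.norm _ hb, 0,
    fun z hz => ?_⟩, ?_⟩
  · exact (Summable.of_norm_bounded (hd.norm.mul_left (c ^ (-(‖z‖ + 1))))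
      fun i => hb _ i z hz (by linarith)).hasSum
  · refine tendsto_tsum_of_dominated_convergence (bound := fun i => c ^ (-2 : ℝ) * ‖d i‖)
      (hd.norm.mul_left _) (fun i => ?_) ?_
    · have h1 : Tendsto (fun t : ℝ => d i * (lam i : ℂ) ^ (-(t : ℂ))) (𝓝 0)
          (𝓝 (d i * (lam i : ℂ) ^ (-((0 : ℝ) : ℂ)))) :=
        (((differentiable_const_cpow_neg (hpos i)).continuous.comp
          Complex.continuous_ofReal).const_mul _).tendsto 0 |>.trans (by simp)
      simpa using h1.mono_left nhdsWithin_le_nhds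
    · filter_upwards [Ioo_mem_nhdsGT (zero_lt_one' ℝ)] with t ht i
      refine hb 2 i t (by simpa using ht.1) ?_
      rw [Complex.norm_real, Real.norm_of_nonneg ht.1.le]
      linarith [ht.2]

theorem tendsto_ofReal_nhdsGT : Tendsto (fun t : ℝ => (t : ℂ)) (𝓝[>] 0) (𝓝 0) := by
  have := Complex.continuous_ofReal.tendsto 0
  simpa using this.mono_left nhdsWithin_le_nhds

theorem DirichletValue.residue_zero {v : ℂ} (h : DirichletValue lam d v) :
    DirichletResidue lam d 0 := by
  obtain ⟨f, hf, hv⟩ := h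
  exact ⟨f, hf, by simpa using tendsto_ofReal_nhdsGT.mul hv⟩

end Dirichlet

/-! ### Taylor expansion of complex powers -/

/-- The binomial coefficient of `-z` over `k`. -/
def negChoose : ℕ → ℂ → ℂ
  | 0, _ => 1
  | k + 1, z => -z / (k + 1) * negChoose k (z + 1)

theorem differentiable_negChoose (k : ℕ) : Differentiable ℂ (negChoose k) := by
  induction k with
  | zero => exact differentiable_const _
  | succ k ih =>
    exact (differentiable_id.neg.div_const _).mul (ih.comp (differentiable_id.add_const 1))

theorem negChoose_one (k : ℕ) : negChoose k 1 = (-1) ^ k := by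
  have h : ∀ (k n : ℕ), negChoose k (n + 1) = (-1) ^ k * ((n + k).choose k : ℂ) := by
    intro k
    induction k with
    | zero => intro n; simp [negChoose]
    | succ k ih =>
      intro n
      have h1 := ih (n + 1)
      have h2 : ((n + 1 + k).choose k : ℂ) * (n + 1) = (n + (k + 1)).choose (k + 1) * (k + 1) := by
        have := Nat.add_one_mul_choose_eq (n + k) k
        have h3 := Nat.choose_succ_right_eq (n + (k + 1)) k
        have h4 : n + (k + 1) - k = n + 1 := by omega
        rw [h4] at h3
        rw [show n + 1 + k = n + (k + 1) by ring]
        exact_mod_cast h3.symm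
      have hk : ((k : ℂ) + 1) ≠ 0 := Nat.cast_add_one_ne_zero k
      rw [negChoose]
      push_cast at h1
      rw [h1, div_mul_eq_mul_div, div_eq_iff hk, pow_succ]
      linear_combination (-1) * (-1) ^ k * h2
  simpa using h k 0

/-- The remainder of order `N` in the Taylor expansion of `x ^ (-z)` around `y`. -/
def taylorRem (N : ℕ) (z : ℂ) (x y : ℝ) : ℂ :=
  (x : ℂ) ^ (-z) - ∑ k ∈ Finset.range N, negChoose k z * ((x : ℂ) - y) ^ k * (y : ℂ) ^ (-z - k)

theorem taylorRem_self (N : ℕ) (z : ℂ) (y : ℝ) : taylorRem (N + 1) z y y = 0 := by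
  rw [taylorRem, Finset.sum_range_succ']
  simp [negChoose]

theorem hasDerivAt_taylorRem (N : ℕ) (z : ℂ) {x : ℝ} (hx : 0 < x) (y : ℝ) :
    HasDerivAt (fun x : ℝ => taylorRem (N + 1) z x y) (-z * taylorRem N (z + 1) x y) x := by
  have h1 : HasDerivAt (fun w : ℂ => w ^ (-z)) (-z * (x : ℂ) ^ (-z - 1)) (x : ℂ) := by
    simpa using (hasDerivAt_id (x : ℂ)).cpow_const (c := -z) (Or.inl (by simpa using hx))
  have h2 : HasDerivAt (fun w : ℂ => ∑ k ∈ Finset.range (N + 1),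
      negChoose k z * (w - y) ^ k * (y : ℂ) ^ (-z - k))
      (∑ k ∈ Finset.range (N + 1),
        negChoose k z * (k * ((x : ℂ) - y) ^ (k - 1)) * (y : ℂ) ^ (-z - k)) (x : ℂ) := by
    refine HasDerivAt.fun_sum fun k _ => ?_
    refine HasDerivAt.mul_const (HasDerivAt.const_mul _ ?_) _
    simpa using ((hasDerivAt_id (x : ℂ)).sub_const (y : ℂ)).fun_pow k
  have h3 := (h1.sub h2).comp_ofReal
  refine h3.congr_deriv ?_
  rw [taylorRem, Finset.sum_range_succ', mul_sub, Finset.mul_sum]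
  congr 1
  · congr 2; ring
  · rw [Nat.cast_zero, zero_mul, mul_zero, zero_mul, add_zero]
    refine Finset.sum_congr rfl fun k _ => ?_
    have hk : ((k : ℂ) + 1) ≠ 0 := Nat.cast_add_one_ne_zero k
    rw [negChoose, Nat.add_sub_cancel, show -(z + 1) - (k : ℂ) = -z - ((k + 1 : ℕ) : ℂ) by
      push_cast; ring]
    push_cast
    field_simp

theorem norm_taylorRem_le (N : ℕ) {z : ℂ} (hz : 0 ≤ z.re) {m x y : ℝ} (hm : 0 < m) (hx : m ≤ x)
    (hy : m ≤ y) : ‖taylorRem N z x y‖ ≤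
      (∏ j ∈ Finset.range N, ‖z + j‖) * |x - y| ^ N * m ^ (-(z.re + N)) := by
  induction N generalizing z x with
  | zero =>
    simp only [taylorRem, Finset.range_zero, Finset.sum_empty, sub_zero, Finset.prod_empty,
      pow_zero, one_mul, Nat.cast_zero, add_zero]
    rw [norm_ofReal_cpow_neg (hm.trans_le hx)]
    exact Real.rpow_le_rpow_of_nonpos hm hx (by linarith)
  | succ N ih =>
    have hle : ∀ ξ ∈ Set.uIcc y x, m ≤ ξ := fun ξ hξ => (le_min hy hx).trans hξ.1
    have hderiv : ∀ ξ ∈ Set.uIcc y x, HasDerivWithinAt (fun x : ℝ => taylorRem (N + 1) z x y)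
        (-z * taylorRem N (z + 1) ξ y) (Set.uIcc y x) ξ := fun ξ hξ =>
      (hasDerivAt_taylorRem N z (hm.trans_le (hle ξ hξ)) y).hasDerivWithinAt
    have hbound : ∀ ξ ∈ Set.uIcc y x, ‖-z * taylorRem N (z + 1) ξ y‖ ≤
        ‖z‖ * ((∏ j ∈ Finset.range N, ‖z + 1 + j‖) * |x - y| ^ N *
          m ^ (-((z + 1).re + N))) := by
      intro ξ hξ
      rw [norm_mul, norm_neg]
      gcongr
      refine (ih (by simp; linarith) (hle ξ hξ)).trans ?_
      have h0 := pow_le_pow_left₀ (abs_nonneg _) (Set.abs_sub_left_of_mem_uIcc hξ) N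
      gcongr
    have h := (convex_uIcc y x).norm_image_sub_le_of_norm_hasDerivWithin_le hderiv hbound
      Set.left_mem_uIcc Set.right_mem_uIcc
    rw [taylorRem_self, sub_zero, Real.norm_eq_abs] at h
    refine h.trans (le_of_eq ?_)
    rw [Finset.prod_range_succ', pow_succ]
    have e1 : (z + 1).re + (N : ℝ) = z.re + ((N + 1 : ℕ) : ℝ) := by
      push_cast; simp; ring
    have e2 : ∀ j : ℕ, z + 1 + (j : ℂ) = z + ((j + 1 : ℕ) : ℂ) := fun j => by push_cast; ring
    simp only [e1, e2, Nat.cast_zero, add_zero]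
    ring

namespace SpectralTriple.EigenBasis

open RegularSpectralTriple

variable {A : Type*} [Ring A] [StarRing A] [Algebra ℂ A] [StarModule ℂ A]
  {H : Type*} [NormedAddCommGroup H] [InnerProductSpace ℂ H] [CompleteSpace H]
  {X : RegularSpectralTriple A H} {ι : Type*} (E : X.EigenBasis ι)

/-! ### The trace property of Dirichlet series -/

theorem summable_mat_mul_weight {V W : X.Op} (hV : X.IsBoundedOp V) (hW : X.IsBoundedOp W)
    {w : ι → ℝ} (hw0 : ∀ i, 0 ≤ w i) (hw : Summable w) :
    Summable fun p : ι × ι => ‖E.mat V p.1 p.2‖ * ‖E.mat W p.2 p.1‖ * w p.1 := by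
  obtain ⟨C, hC⟩ := E.exists_tsum_norm_mat_mul_le hV hW
  have h0 : ∀ p : ι × ι, 0 ≤ ‖E.mat V p.1 p.2‖ * ‖E.mat W p.2 p.1‖ * w p.1 := fun p =>
    mul_nonneg (mul_nonneg (norm_nonneg _) (norm_nonneg _)) (hw0 _)
  have h1 : ∀ i, Summable fun j => ‖E.mat V i j‖ * ‖E.mat W j i‖ * w i := fun i =>
    (hC i i).1.mul_right _
  refine (summable_prod_of_nonneg h0).2 ⟨h1, ?_⟩
  refine Summable.of_nonneg_of_le (fun i => tsum_nonneg fun j => h0 (i, j)) (fun i => ?_)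
    (hw.mul_left C)
  change ∑' j, ‖E.mat V i j‖ * ‖E.mat W j i‖ * w i ≤ C * w i
  rw [tsum_mul_right]
  exact mul_le_mul_of_nonneg_right (hC i i).2 (hw0 i)

theorem summable_mat_mul_weight' {V W : X.Op} (hV : X.IsBoundedOp V) (hW : X.IsBoundedOp W)
    {w : ι → ℝ} (hw0 : ∀ i, 0 ≤ w i) (hw : Summable w) :
    Summable fun p : ι × ι => ‖E.mat V p.2 p.1‖ * ‖E.mat W p.1 p.2‖ * (w p.1 + w p.2) := by
  have h1 := E.summable_mat_mul_weight hW hV hw0 hw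
  have h2 := (Equiv.prodComm ι ι).summable_iff.2 (E.summable_mat_mul_weight hV hW hw0 hw)
  refine (h1.add h2).congr fun p => ?_
  simp only [Function.comp_apply, Equiv.prodComm_apply, Prod.fst_swap, Prod.snd_swap]
  ring

theorem lam_cpow_sub (z : ℂ) (n : ℕ) (i : ι) :
    (E.lam i : ℂ) ^ (z - n) = ((E.lam i : ℂ)⁻¹) ^ n * (E.lam i : ℂ) ^ z := by
  rw [Complex.cpow_sub _ _ (E.lam_ne_zero i), Complex.cpow_natCast, inv_pow, div_eq_inv_mul]

theorem rpow_neg_add_le {c x r : ℝ} {N : ℕ} (hc : 0 < c) (hc1 : c ≤ 1) (hx : c ≤ x) {B : ℝ}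
    (hr : 0 ≤ r) (hB : r ≤ B) : x ^ (-(r + N)) ≤ c ^ (-B) * x⁻¹ ^ N := by
  have hx0 := hc.trans_le hx
  rw [neg_add, Real.rpow_add hx0, Real.rpow_neg hx0.le (N : ℝ), Real.rpow_natCast, inv_pow]
  gcongr
  exact rpow_neg_le hc hc1 hx hr hB

/-- The trace property up to lower order terms. The Dirichlet series of `Y V |D|^{-m}` is a
combination, with polynomial coefficients, of those of `V δ^k(Y) |D|^{-m-k}` for `k < N`, up to a
function that is holomorphic for `Re z > 0` and `O(t + m)` as `t → 0+`. In an eigenbasis of `D`,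
both sides are double series over the coefficients `V_ji Y_ij`, and the remainder is controlled by
the Taylor expansion of `λ_i^{-z}` around `λ_j` and by `(λ_i - λ_j)^N Y_ij = δ^N(Y)_ij`. -/
theorem exists_isDirichlet_mul_swap {V Y : X.Op} (hV : X.IsBoundedOp V)
    (hY : Y ∈ X.boundedDeltas) {N : ℕ} (hN0 : 1 ≤ N)
    (hN : Summable fun i => (E.lam i)⁻¹ ^ N) (m : ℕ) {f : ℕ → ℂ → ℂ}
    (hf : ∀ k < N, IsDirichlet E.lam (E.diag (V * X.delta^[k] Y * X.absInv ^ (m + k))) (f k)) :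
    ∃ g : ℂ → ℂ, (∃ C : ℝ, ∀ t : ℝ, 0 < t → t ≤ 1 → ‖g t‖ ≤ C * (t + m)) ∧
      IsDirichlet E.lam (E.diag (Y * V * X.absInv ^ m))
        (fun z => ∑ k ∈ Finset.range N, negChoose k (z + m) * f k z + g z) := by
  obtain ⟨c, hc, hc1, hlam⟩ := E.exists_le_lam
  have hpos := E.lam_pos
  set w : ι → ℝ := fun i => (E.lam i)⁻¹ ^ N with hw
  have hw0 : ∀ i, 0 ≤ w i := fun i => by have := hpos i; positivity
  have hδ : ∀ k, X.IsBoundedOp (X.delta^[k] Y) := hY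
  -- the dominating double series
  set u : ι × ι → ℝ := fun p =>
    ‖E.mat V p.2 p.1‖ * ‖E.mat (X.delta^[N] Y) p.1 p.2‖ * (w p.1 + w p.2) with hu_def
  have hu : Summable u := E.summable_mat_mul_weight' hV (hδ N) hw0 hN
  have hu0 : ∀ p, 0 ≤ u p := fun p => by
    have := hw0 p.1; have := hw0 p.2; positivity
  set κ : ι × ι → ℂ → ℂ := fun p z => E.mat V p.2 p.1 * E.mat Y p.1 p.2 *
    taylorRem N (z + m) (E.lam p.1) (E.lam p.2) with hκ
  have hκb : ∀ p z, 0 < z.re → ∀ B : ℝ, z.re + m ≤ B →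
      ‖κ p z‖ ≤ (∏ j ∈ Finset.range N, ‖z + m + j‖) * c ^ (-B) * u p := by
    intro p z hz B hB
    set x := E.lam p.1
    set y := E.lam p.2
    have hx : 0 < x := hpos _
    have hy : 0 < y := hpos _
    have hz' : 0 ≤ (z + m).re := by simp; positivity
    have h1 := norm_taylorRem_le N hz' (lt_min hx hy) (min_le_left x y) (min_le_right x y)
    have h2 : min x y ^ (-((z + m).re + N)) ≤ c ^ (-B) * (w p.1 + w p.2) := by
      refine (rpow_neg_add_le hc hc1 (le_min (hlam _) (hlam _)) hz' (by simpa using hB)).trans ?_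
      gcongr
      rcases min_choice x y with h | h <;> rw [h]
      · exact le_add_of_nonneg_right (hw0 _)
      · exact le_add_of_nonneg_left (hw0 _)
    have h3 : ‖E.mat (X.delta^[N] Y) p.1 p.2‖ = |x - y| ^ N * ‖E.mat Y p.1 p.2‖ := by
      rw [E.mat_delta_iterate, norm_mul, norm_pow, ← Complex.ofReal_sub, Complex.norm_real,
        Real.norm_eq_abs]
    have hP : (0 : ℝ) ≤ ∏ j ∈ Finset.range N, ‖z + m + j‖ :=
      Finset.prod_nonneg fun _ _ => norm_nonneg _
    calc ‖κ p z‖ ≤ ‖E.mat V p.2 p.1‖ * ‖E.mat Y p.1 p.2‖ *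
          ((∏ j ∈ Finset.range N, ‖z + m + j‖) * |x - y| ^ N *
            (c ^ (-B) * (w p.1 + w p.2))) := by
          rw [hκ, norm_mul, norm_mul]
          gcongr
          exact h1.trans (by gcongr)
      _ = _ := by rw [hu_def]; dsimp only; rw [h3]; ring
  have hprod : ∀ z : ℂ, ∀ B : ℝ, ‖z‖ ≤ B → (∏ j ∈ Finset.range N, ‖z + m + j‖) ≤
      (B + m + N) ^ N := by
    intro z B hB
    refine (Finset.prod_le_prod (g := fun _ => B + m + N) (fun _ _ => norm_nonneg _)
      fun j hj => ?_).trans (by rw [Finset.prod_const, Finset.card_range])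
    refine (norm_add_le _ _).trans (add_le_add ((norm_add_le _ _).trans ?_) ?_)
    · simpa using hB
    · simpa using (Finset.mem_range.1 hj).le
  have hκd : ∀ p, Differentiable ℂ (κ p) := by
    intro p
    refine Differentiable.const_mul ?_ _
    have hx : (E.lam p.1 : ℂ) ≠ 0 := E.lam_ne_zero _
    have hy : (E.lam p.2 : ℂ) ≠ 0 := E.lam_ne_zero _
    have hadd : Differentiable ℂ fun z : ℂ => z + m := differentiable_id.add_const _
    refine Differentiable.sub (fun z => (hadd z).neg.const_cpow (Or.inl hx)) ?_
    refine Differentiable.fun_sum fun k _ => Differentiable.mul (Differentiable.mul_const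
      ((differentiable_negChoose k).comp hadd) _)
      fun z => ((hadd z).neg.sub_const _).const_cpow (Or.inl hy)
  have hκs : ∀ z : ℂ, 0 < z.re → Summable fun p => κ p z := fun z hz =>
    Summable.of_norm_bounded (hu.mul_left _) fun p => hκb p z hz _ le_rfl
  refine ⟨fun z => ∑' p, κ p z, ?_, ?_, ?_⟩
  · -- the first factor of `∏ j < N, (z + m + j)` is `z + m`
    obtain ⟨N', rfl⟩ := Nat.exists_eq_add_of_le' hN0
    refine ⟨(∏ j ∈ Finset.range N', (1 + m + (j + 1) : ℝ)) * c ^ (-(1 + m : ℝ)) * ∑' p, u p,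
      fun t ht0 ht1 => ?_⟩
    have hre : (0 : ℝ) < (t : ℂ).re := by simpa using ht0
    have h1 : ∀ p, ‖κ p t‖ ≤ (∏ j ∈ Finset.range (N' + 1), ‖(t : ℂ) + m + j‖) *
        c ^ (-(1 + m : ℝ)) * u p := fun p => hκb p t hre _ (by simpa using ht1)
    have h2 : (∏ j ∈ Finset.range (N' + 1), ‖(t : ℂ) + m + j‖) ≤
        (∏ j ∈ Finset.range N', (1 + m + (j + 1) : ℝ)) * (t + m) := by
      have hn : ∀ j : ℕ, ‖(t : ℂ) + m + j‖ = t + m + j := by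
        intro j
        rw [← Complex.ofReal_natCast, ← Complex.ofReal_natCast, ← Complex.ofReal_add,
          ← Complex.ofReal_add, Complex.norm_real, Real.norm_of_nonneg (by positivity)]
      rw [Finset.prod_range_succ']
      simp only [hn]
      rw [Nat.cast_zero, add_zero]
      gcongr with j hj
      · push_cast; linarith
    calc ‖∑' p, κ p t‖ ≤ ∑' p, (∏ j ∈ Finset.range (N' + 1), ‖(t : ℂ) + m + j‖) *
          c ^ (-(1 + m : ℝ)) * u p := tsum_of_norm_bounded (hu.mul_left _).hasSum h1
      _ = (∏ j ∈ Finset.range (N' + 1), ‖(t : ℂ) + m + j‖) * c ^ (-(1 + m : ℝ)) * ∑' p, u p := by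
          rw [tsum_mul_left]
      _ ≤ (∏ j ∈ Finset.range N', (1 + m + (j + 1) : ℝ)) * (t + m) * c ^ (-(1 + m : ℝ)) *
          ∑' p, u p :=
          mul_le_mul_of_nonneg_right (mul_le_mul_of_nonneg_right h2 (by positivity))
            (tsum_nonneg hu0)
      _ = _ := by ring
  · have hg : MeromorphicOn (fun z => ∑' p, κ p z) {z | 0 < z.re} := by
      refine meromorphicOn_tsum hκd hu (fun B => (B + m + N) ^ N * c ^ (-(B + m))) ?_
      intro B p z hz hB
      refine (hκb p z hz (B + m) ?_).trans ?_
      · have := (Complex.re_le_norm z).trans hB.le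
        linarith
      · have := hprod z B hB.le
        have := hu0 p
        gcongr
    have hs : MeromorphicOn (fun z => ∑ k ∈ Finset.range N, negChoose k (z + m) * f k z)
        {z | 0 < z.re} := by
      intro z hz
      refine MeromorphicAt.fun_sum fun k hk => ?_
      refine MeromorphicAt.mul ?_ ((hf k (Finset.mem_range.1 hk)).1 z hz)
      exact (((differentiable_negChoose k).comp (differentiable_id.add_const _)).analyticAt
        z).meromorphicAt
    exact hs.add hg
  · have hR : ∃ R : ℝ, ∀ k < N, ∀ z : ℂ, R < z.re → HasSum (fun i =>
        E.diag (V * X.delta^[k] Y * X.absInv ^ (m + k)) i * (E.lam i : ℂ) ^ (-z)) (f k z) := by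
      choose R hR using fun k (hk : k < N) => (hf k hk).2
      refine ⟨∑ k ∈ Finset.range N, if h : k < N then |R k h| else 0, fun k hk z hz => ?_⟩
      refine hR k hk z (lt_of_le_of_lt ?_ hz)
      refine le_trans ?_ (Finset.single_le_sum (f := fun k => if h : k < N then |R k h| else 0)
        (fun j _ => by split_ifs <;> positivity) (Finset.mem_range.2 hk))
      simp only [hk, dif_pos]
      exact le_abs_self _
    obtain ⟨R, hR⟩ := hR
    refine ⟨max R N, fun z hz => ?_⟩
    rw [max_lt_iff] at hz
    have hz0 : 0 < z.re := (Nat.cast_nonneg N).trans_lt hz.2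
    have hpw : ∀ i, ∀ n : ℕ, ‖(E.lam i : ℂ) ^ (-z - n)‖ ≤ c ^ (-(z.re + n)) * w i := by
      intro i n
      have : -z - (n : ℂ) = -(z + n) := by ring
      rw [this, norm_ofReal_cpow_neg (hpos i)]
      have h1 : -(z + (n : ℂ)).re = -((z.re + n - N) + N) := by simp
      rw [h1]
      have hn : (0 : ℝ) ≤ n := Nat.cast_nonneg n
      have hN' : (0 : ℝ) ≤ N := Nat.cast_nonneg N
      exact rpow_neg_add_le hc hc1 (hlam i) (by linarith [hz.2]) (by linarith)
    -- the double series for `V δ^k(Y) |D|^{-m-k}`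
    have hQ : ∀ k < N, HasSum (fun p : ι × ι => E.mat V p.2 p.1 * E.mat (X.delta^[k] Y) p.1 p.2 *
        (E.lam p.2 : ℂ) ^ (-z - (m + k : ℕ))) (f k z) := by
      intro k hk
      have hs : Summable (fun p : ι × ι => E.mat V p.2 p.1 * E.mat (X.delta^[k] Y) p.1 p.2 *
          (E.lam p.2 : ℂ) ^ (-z - (m + k : ℕ))) := by
        refine Summable.of_norm_bounded ((E.summable_mat_mul_weight' hV (hδ k) hw0 hN).mul_left
          (c ^ (-(z.re + (m + k : ℕ))))) fun p => ?_
        rw [norm_mul, norm_mul, mul_left_comm]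
        gcongr
        refine (hpw p.2 (m + k)).trans ?_
        gcongr
        exact le_add_of_nonneg_left (hw0 _)
      convert hs.hasSum using 1
      refine (hR k hk z hz.1).unique ?_
      refine ((Equiv.prodComm ι ι).hasSum_iff.2 hs.hasSum).prod_fiberwise fun j => ?_
      have h1 := (E.hasSum_mat_mul hV (X.delta^[k] Y) j j).mul_right
        ((E.lam j : ℂ) ^ (-z - (m + k : ℕ)))
      rw [E.lam_cpow_sub (-z) (m + k), ← mul_assoc, ← E.mat_mul_absInv_pow] at h1
      rw [← E.lam_cpow_sub] at h1
      exact h1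
    have hsum := (hasSum_sum fun k hk => (hQ k (Finset.mem_range.1 hk)).mul_left
      (negChoose k (z + m))).add (hκs z hz0).hasSum
    have hpt : ∀ p : ι × ι, (∑ k ∈ Finset.range N, negChoose k (z + m) *
        (E.mat V p.2 p.1 * E.mat (X.delta^[k] Y) p.1 p.2 *
          (E.lam p.2 : ℂ) ^ (-z - (m + k : ℕ)))) + κ p z =
        E.mat Y p.1 p.2 * E.mat V p.2 p.1 * (E.lam p.1 : ℂ) ^ (-z - m) := by
      intro p
      rw [hκ]
      dsimp only
      rw [taylorRem, mul_sub, Finset.mul_sum, show -(z + (m : ℂ)) = -z - m by ring]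
      have : ∀ k ∈ Finset.range N, negChoose k (z + m) *
          (E.mat V p.2 p.1 * E.mat (X.delta^[k] Y) p.1 p.2 *
          (E.lam p.2 : ℂ) ^ (-z - (m + k : ℕ))) = E.mat V p.2 p.1 * E.mat Y p.1 p.2 *
          (negChoose k (z + m) * ((E.lam p.1 : ℂ) - E.lam p.2) ^ k *
            (E.lam p.2 : ℂ) ^ (-z - m - k)) := by
        intro k _
        rw [E.mat_delta_iterate, show -z - ((m + k : ℕ) : ℂ) = -z - m - k by push_cast; ring]
        ring
      rw [Finset.sum_congr rfl this]
      ring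
    simp only [hpt] at hsum
    refine hsum.prod_fiberwise fun i => ?_
    have h1 := (E.hasSum_mat_mul (hδ 0) V i i).mul_right ((E.lam i : ℂ) ^ (-z - m))
    rw [E.lam_cpow_sub (-z) m, ← mul_assoc, ← E.mat_mul_absInv_pow] at h1
    rw [← E.lam_cpow_sub] at h1
    exact h1

theorem tendsto_of_norm_le_mul_add {g : ℂ → ℂ} {C : ℝ} {m : ℕ}
    (hg : ∀ t : ℝ, 0 < t → t ≤ 1 → ‖g t‖ ≤ C * (t + m)) :
    Tendsto (fun t : ℝ => (t : ℂ) * g t) (𝓝[>] 0) (𝓝 0) := by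
  have h0 : Tendsto (fun t : ℝ => t * (C * (t + m))) (𝓝[>] 0) (𝓝 0) := by
    have h : Continuous fun t : ℝ => t * (C * (t + m)) := by fun_prop
    simpa using (h.tendsto 0).mono_left nhdsWithin_le_nhds
  refine squeeze_zero_norm' ?_ h0
  filter_upwards [Ioo_mem_nhdsGT (zero_lt_one' ℝ)] with t ht
  rw [norm_mul, Complex.norm_real, Real.norm_of_nonneg ht.1.le]
  exact mul_le_mul_of_nonneg_left (hg t ht.1 ht.2.le) ht.1.le

/-- The trace property of residues, up to lower order terms. -/
theorem dirichletResidue_mul_swap {V Y : X.Op} (hV : X.IsBoundedOp V)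
    (hY : Y ∈ X.boundedDeltas) {N : ℕ} (hN0 : 1 ≤ N) (hN : Summable fun i => (E.lam i)⁻¹ ^ N)
    (m : ℕ) {r : ℕ → ℂ} (hr : ∀ k < N, DirichletResidue E.lam
      (E.diag (V * X.delta^[k] Y * X.absInv ^ (m + k))) (r k)) :
    DirichletResidue E.lam (E.diag (Y * V * X.absInv ^ m))
      (∑ k ∈ Finset.range N, negChoose k m * r k) := by
  choose! f hf hfr using hr
  obtain ⟨g, ⟨C, hg⟩, hd⟩ := E.exists_isDirichlet_mul_swap hV hY hN0 hN m hf
  refine ⟨_, hd, ?_⟩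
  have h1 : Tendsto (fun t : ℝ => ∑ k ∈ Finset.range N, negChoose k ((t : ℂ) + m) *
      ((t : ℂ) * f k t)) (𝓝[>] 0) (𝓝 (∑ k ∈ Finset.range N, negChoose k m * r k)) := by
    refine tendsto_finsetSum _ fun k hk => Tendsto.mul ?_ (hfr k (Finset.mem_range.1 hk))
    have hc : Continuous fun z : ℂ => negChoose k (z + m) :=
      (differentiable_negChoose k).continuous.comp (continuous_id.add continuous_const)
    simpa [Function.comp_def] using (hc.tendsto 0).comp tendsto_ofReal_nhdsGT
  have h2 := h1.add (tendsto_of_norm_le_mul_add hg)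
  rw [add_zero] at h2
  refine h2.congr fun t => ?_
  rw [mul_add, Finset.mul_sum]
  congr 1
  exact Finset.sum_congr rfl fun k _ => by ring

/-- The failure of the trace property for values at `0` is a combination of residues; the
coefficient `(-1)^k / k` is the derivative at `z = 0` of the binomial coefficient of `-z` over
`k`. -/
theorem dirichletValue_mul_swap {V Y : X.Op} (hV : X.IsBoundedOp V)
    (hY : Y ∈ X.boundedDeltas) {N : ℕ} (hN : Summable fun i => (E.lam i)⁻¹ ^ (N + 1))
    {v : ℂ} (hv : DirichletValue E.lam (E.diag (V * Y)) v) {r : ℕ → ℂ}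
    (hr : ∀ k < N, DirichletResidue E.lam
      (E.diag (V * X.delta^[k + 1] Y * X.absInv ^ (k + 1))) (r k)) :
    DirichletValue E.lam (E.diag (Y * V))
      (v + ∑ k ∈ Finset.range N, (-1 : ℂ) ^ (k + 1) / (k + 1) * r k) := by
  choose! f hf hfr using hr
  obtain ⟨f₀, hf₀, hv⟩ := hv
  have hf' : ∀ k < N + 1, IsDirichlet E.lam (E.diag (V * X.delta^[k] Y * X.absInv ^ (0 + k)))
      ((fun k => Nat.casesOn k f₀ f : ℕ → ℂ → ℂ) k) := by
    rintro (_ | k) hk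
    · simpa using hf₀
    · simpa using hf k (by omega)
  obtain ⟨g, ⟨C, hg⟩, hd⟩ :=
    E.exists_isDirichlet_mul_swap hV hY (Nat.succ_le_succ (Nat.zero_le N)) hN 0 hf'
  rw [pow_zero, mul_one] at hd
  refine ⟨_, hd, ?_⟩
  have hg0 : Tendsto (fun t : ℝ => g t) (𝓝[>] 0) (𝓝 0) := by
    have h0 : Tendsto (fun t : ℝ => C * (t + (0 : ℕ))) (𝓝[>] 0) (𝓝 0) := by
      have h : Continuous fun t : ℝ => C * (t + (0 : ℕ)) := by fun_prop
      simpa using (h.tendsto 0).mono_left nhdsWithin_le_nhds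
    refine squeeze_zero_norm' ?_ h0
    filter_upwards [Ioo_mem_nhdsGT (zero_lt_one' ℝ)] with t ht
    exact hg t ht.1 ht.2.le
  have h1 : Tendsto (fun t : ℝ => ∑ k ∈ Finset.range N,
      -1 / ((k : ℂ) + 1) * negChoose k ((t : ℂ) + 1) * ((t : ℂ) * f k t)) (𝓝[>] 0)
      (𝓝 (∑ k ∈ Finset.range N, (-1 : ℂ) ^ (k + 1) / (k + 1) * r k)) := by
    refine tendsto_finsetSum _ fun k hk => Tendsto.mul ?_ (hfr k (Finset.mem_range.1 hk))
    have hc : Continuous fun z : ℂ => -1 / ((k : ℂ) + 1) * negChoose k (z + 1) :=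
      continuous_const.mul
        ((differentiable_negChoose k).continuous.comp (continuous_id.add continuous_const))
    have h3 := (hc.tendsto 0).comp tendsto_ofReal_nhdsGT
    rw [zero_add, negChoose_one, div_mul_eq_mul_div, ← pow_succ'] at h3
    exact h3
  have h2 := (hv.add h1).add hg0
  rw [add_zero] at h2
  refine h2.congr fun t => ?_
  rw [Finset.sum_range_succ']
  simp only [negChoose, Nat.cast_zero, add_zero, one_mul]
  rw [add_comm (f₀ t)]
  congr 2
  exact Finset.sum_congr rfl fun k _ => by ring

/-! ### Residues of zeta functions -/

theorem isDirichlet_of_isZeta {T : X.Op} {f : ℂ → ℂ} (h : X.IsZeta T f) :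
    IsDirichlet E.lam (E.diag T) f := by
  obtain ⟨hm, R, hR⟩ := h
  refine ⟨fun z _ => hm z trivial, max R 0, fun z hz => ?_⟩
  rw [max_lt_iff] at hz
  have h1 := E.hasSum_diag_of_hasTrace (hR z hz.1)
  rwa [show E.diag (T * X.absNegPow z) = _ from
    funext fun i => E.mat_mul_absNegPow T hz.2 i i] at h1

theorem tendsto_ofReal_nhdsGT_nhdsNE : Tendsto (fun t : ℝ => (t : ℂ)) (𝓝[>] 0) (𝓝[≠] 0) :=
  tendsto_nhdsWithin_of_tendsto_nhds_of_eventually_within _ tendsto_ofReal_nhdsGT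
    (eventually_nhdsWithin_of_forall fun t ht => by
      simpa using ne_of_gt ht)

theorem dirichletResidue_of_hasResidue {T : X.Op} {r : ℂ} (h : X.HasResidue T r) :
    DirichletResidue E.lam (E.diag T) r := by
  obtain ⟨f, hf, hr⟩ := h
  exact ⟨f, E.isDirichlet_of_isZeta hf, hr.comp tendsto_ofReal_nhdsGT_nhdsNE⟩

theorem dirichletValue_of_hasZetaValue {T : X.Op} {v : ℂ} (h : X.HasZetaValue T v) :
    DirichletValue E.lam (E.diag T) v := by
  obtain ⟨f, hf, hv⟩ := h
  exact ⟨f, E.isDirichlet_of_isZeta hf, hv.comp tendsto_ofReal_nhdsGT_nhdsNE⟩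

theorem dirichletValue_of_summable {d : ι → ℂ} (hd : Summable d) :
    DirichletValue E.lam d (∑' i, d i) := by
  obtain ⟨c, hc, hc1, hlam⟩ := E.exists_le_lam
  exact exists_isDirichlet_of_summable hc hc1 hlam hd

theorem dirichletResidue_of_summable {d : ι → ℂ} (hd : Summable d) :
    DirichletResidue E.lam d 0 := (E.dirichletValue_of_summable hd).residue_zero

end SpectralTriple.EigenBasis

namespace RegularSpectralTriple

variable {A : Type*} [Ring A] [StarRing A] [Algebra ℂ A] [StarModule ℂ A]
  {H : Type*} [NormedAddCommGroup H] [InnerProductSpace ℂ H] [CompleteSpace H]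
  {X : RegularSpectralTriple A H}

theorem HasResidue.unique {T : X.Op} {r r' : ℂ} (h : X.HasResidue T r) (h' : X.HasResidue T r') :
    r = r' := by
  obtain ⟨ι, ⟨E⟩⟩ := X.exists_eigenBasis
  exact (E.dirichletResidue_of_hasResidue h).unique (E.dirichletResidue_of_hasResidue h')

theorem HasZetaValue.unique {T : X.Op} {r r' : ℂ} (h : X.HasZetaValue T r)
    (h' : X.HasZetaValue T r') : r = r' := by
  obtain ⟨ι, ⟨E⟩⟩ := X.exists_eigenBasis
  exact (E.dirichletValue_of_hasZetaValue h).unique (E.dirichletValue_of_hasZetaValue h')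

theorem HasResidue.ncint_eq {T : X.Op} {r : ℂ} (h : X.HasResidue T r) : X.ncint T = r := by
  have h' : ∃ r, X.HasResidue T r := ⟨r, h⟩
  rw [ncint, dif_pos h']
  exact h'.choose_spec.unique h

theorem HasZetaValue.zetaAtZero_eq {T : X.Op} {v : ℂ} (h : X.HasZetaValue T v) :
    X.zetaAtZero T = v := by
  have h' : ∃ v, X.HasZetaValue T v := ⟨v, h⟩
  rw [zetaAtZero, dif_pos h']
  exact h'.choose_spec.unique h

theorem IsZeta.add {S T : X.Op} {f g : ℂ → ℂ} (hf : X.IsZeta S f) (hg : X.IsZeta T g) :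
    X.IsZeta (S + T) (f + g) := by
  obtain ⟨hfm, R, hR⟩ := hf
  obtain ⟨hgm, R', hR'⟩ := hg
  refine ⟨hfm.add hgm, max R R', fun z hz => ?_⟩
  rw [max_lt_iff] at hz
  rw [add_mul]
  exact (hR z hz.1).add (hR' z hz.2)

theorem IsZeta.smul {T : X.Op} {f : ℂ → ℂ} (hf : X.IsZeta T f) (c : ℂ) :
    X.IsZeta (c • T) (fun z => c * f z) := by
  obtain ⟨hfm, R, hR⟩ := hf
  refine ⟨fun z hz => (MeromorphicAt.const c z).mul (hfm z hz), R, fun z hz => ?_⟩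
  rw [smul_mul_assoc]
  exact (hR z hz).smul c

theorem IsZeta.mul_absInv_pow {T : X.Op} {f : ℂ → ℂ} (hf : X.IsZeta T f) (m : ℕ) :
    X.IsZeta (T * X.absInv ^ m) (fun z => f (z + m)) := by
  obtain ⟨hfm, R, hR⟩ := hf
  refine ⟨fun z _ => ?_, max R 0, fun z hz => ?_⟩
  · exact MeromorphicAt.comp_analyticAt (g := fun z : ℂ => z + m) (hfm (z + m) trivial)
      (analyticAt_id.add analyticAt_const)
  · rw [max_lt_iff] at hz
    rw [mul_assoc, X.absInv_pow_mul_absNegPow m hz.2]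
    refine hR _ ?_
    have : (0 : ℝ) ≤ m := Nat.cast_nonneg m
    simp
    linarith [hz.1]

variable (X)

/-- The operators whose zeta function continues meromorphically with at most a simple pole at
`0`. -/
def residual : Submodule ℂ X.Op where
  carrier := {T | ∃ r, X.HasResidue T r}
  add_mem' := by
    rintro S T ⟨r, f, hf, hr⟩ ⟨r', g, hg, hr'⟩
    exact ⟨r + r', f + g, hf.add hg, by simpa [mul_add] using hr.add hr'⟩
  zero_mem' := by
    refine ⟨0, 0, ⟨fun z _ => MeromorphicAt.const 0 z, 0, fun z _ => ?_⟩, by simp⟩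
    exact ⟨0, fun x => by simp, ⟨0, 0, by simp, fun v => by simp⟩,
      by simp [opTrace]⟩
  smul_mem' := by
    rintro c T ⟨r, f, hf, hr⟩
    exact ⟨c * r, _, hf.smul c, by simpa [mul_left_comm] using hr.const_mul c⟩

variable {X}

theorem hasResidue_ncint {T : X.Op} (hT : T ∈ X.residual) : X.HasResidue T (X.ncint T) := by
  obtain ⟨r, hr⟩ := hT
  rwa [hr.ncint_eq]

variable (X)

/-- The noncommutative integral is linear on the operators that have a residue, hence agrees there
with an everywhere defined linear functional. -/
theorem exists_linearMap_eq_ncint :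
    ∃ L : X.Op →ₗ[ℂ] ℂ, ∀ T ∈ X.residual, L T = X.ncint T := by
  let l : X.residual →ₗ[ℂ] ℂ :=
    { toFun := fun T => X.ncint T
      map_add' := fun S T => by
        obtain ⟨f, hf, hr⟩ := hasResidue_ncint S.2
        obtain ⟨g, hg, hr'⟩ := hasResidue_ncint T.2
        exact HasResidue.ncint_eq ⟨f + g, hf.add hg, by simpa [mul_add] using hr.add hr'⟩
      map_smul' := fun c T => by
        obtain ⟨f, hf, hr⟩ := hasResidue_ncint T.2
        exact HasResidue.ncint_eq
          ⟨_, hf.smul c, by simpa [mul_left_comm] using hr.const_mul c⟩ }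
  obtain ⟨L, hL⟩ := l.exists_extend
  exact ⟨L, fun T hT => congrArg (fun m : X.residual →ₗ[ℂ] ℂ => m ⟨T, hT⟩) hL⟩

variable {X} {Sd : Set ℂ}

theorem HasSimpleDimensionSpectrum.meromorphicOrderAt_ge {f : ℂ → ℂ}
    (hf : AnalyticOnNhd ℂ f Sdᶜ) (h : ∀ s ∈ Sd, ((-1 : ℤ) : WithTop ℤ) ≤ meromorphicOrderAt f s)
    (s : ℂ) : ((-1 : ℤ) : WithTop ℤ) ≤ meromorphicOrderAt f s := by
  by_cases hs : s ∈ Sd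
  · exact h s hs
  · exact le_trans (by norm_cast) (hf s hs).meromorphicOrderAt_nonneg

theorem HasSimpleDimensionSpectrum.mul_absInv_pow_mem_residual
    (hSd : X.HasSimpleDimensionSpectrum Sd) {T T' : X.Op} (hT : T ∈ X.psiZero)
    (hT' : T' = T ∨ T' = T * X.F) (m : ℕ) : T' * X.absInv ^ m ∈ X.residual := by
  obtain ⟨f, hf, han, hord⟩ := hSd.continuation T hT T' hT'
  have hge := HasSimpleDimensionSpectrum.meromorphicOrderAt_ge han hord (m : ℂ)
  have hmf : MeromorphicAt f m := hf.1 m trivial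
  have hid : MeromorphicAt (fun z : ℂ => z - m) m :=
    (MeromorphicAt.id _).sub (MeromorphicAt.const _ _)
  have hone : meromorphicOrderAt (fun z : ℂ => z - m) m = 1 := meromorphicOrderAt_id_sub_const
  have h0 : 0 ≤ meromorphicOrderAt ((fun z : ℂ => z - m) * f) m := by
    rw [meromorphicOrderAt_mul hid hmf, hone]
    calc (0 : WithTop ℤ) = 1 + ((-1 : ℤ) : WithTop ℤ) := by norm_cast
      _ ≤ _ := by gcongr
  obtain ⟨r, hr⟩ := tendsto_nhds_of_meromorphicOrderAt_nonneg (hid.mul hmf) h0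
  refine ⟨r, _, hf.mul_absInv_pow m, ?_⟩
  have h1 : Tendsto (fun z : ℂ => z + m) (𝓝[≠] 0) (𝓝[≠] (m : ℂ)) := by
    refine tendsto_nhdsWithin_of_tendsto_nhds_of_eventually_within _ ?_
      (eventually_nhdsWithin_of_forall fun z hz => by simpa using hz)
    have hc : Continuous fun z : ℂ => z + m := continuous_id.add continuous_const
    simpa using (hc.tendsto 0).mono_left nhdsWithin_le_nhds
  simpa [Function.comp_def] using hr.comp h1

/-- The residues of order at least `4` vanish, as the poles have real part at most `3`. -/
theorem HasSimpleDimensionSpectrum.ncint_mul_absInv_pow_eq_zero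
    (hSd : X.HasSimpleDimensionSpectrum Sd) (h3 : ∀ s ∈ Sd, s.re ≤ 3) {T T' : X.Op}
    (hT : T ∈ X.psiZero) (hT' : T' = T ∨ T' = T * X.F) {m : ℕ} (hm : 4 ≤ m) :
    X.ncint (T' * X.absInv ^ m) = 0 := by
  obtain ⟨f, hf, han, -⟩ := hSd.continuation T hT T' hT'
  have hmS : (m : ℂ) ∉ Sd := fun h => by
    have h1 := h3 _ h
    have h2 : (4 : ℝ) ≤ m := by exact_mod_cast hm
    simp at h1
    linarith
  refine HasResidue.ncint_eq ⟨_, hf.mul_absInv_pow m, ?_⟩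
  have hc : ContinuousAt (fun z : ℂ => z * f (z + m)) 0 := by
    refine continuousAt_id.mul (ContinuousAt.comp (f := fun z : ℂ => z + m) ?_ ?_)
    · simpa using (han _ hmS).continuousAt
    · exact continuousAt_id.add continuousAt_const
  simpa using hc.tendsto.mono_left nhdsWithin_le_nhds

theorem HasSimpleDimensionSpectrum.exists_hasZetaValue
    (hSd : X.HasSimpleDimensionSpectrum Sd) (h0 : (0 : ℂ) ∉ Sd) {T T' : X.Op}
    (hT : T ∈ X.psiZero) (hT' : T' = T ∨ T' = T * X.F) : ∃ v, X.HasZetaValue T' v := by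
  obtain ⟨f, hf, han, -⟩ := hSd.continuation T hT T' hT'
  exact ⟨f 0, f, hf, (han 0 h0).continuousAt.tendsto.mono_left nhdsWithin_le_nhds⟩

theorem hasZetaValue_zetaAtZero {T : X.Op} (hT : ∃ v, X.HasZetaValue T v) :
    X.HasZetaValue T (X.zetaAtZero T) := by
  obtain ⟨v, hv⟩ := hT
  rwa [hv.zetaAtZero_eq]

/-- A large power of `|D|⁻¹` is trace class. -/
theorem HasSimpleDimensionSpectrum.exists_summable_lam_inv_pow
    (hSd : X.HasSimpleDimensionSpectrum Sd) {ι : Type*} (E : X.EigenBasis ι) :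
    ∃ M : ℕ, Summable fun i => (E.lam i)⁻¹ ^ (M + 4) := by
  obtain ⟨f, hf, -, -⟩ := hSd.continuation 1 (one_mem _) 1 (Or.inl rfl)
  obtain ⟨-, R, hR⟩ := E.isDirichlet_of_isZeta hf
  obtain ⟨M, hM⟩ := exists_nat_gt R
  refine ⟨M, ?_⟩
  have h1 := (hR ((M + 4 : ℕ) : ℂ) (by
    simp only [Complex.natCast_re]
    push_cast
    linarith)).summable.norm
  refine h1.congr fun i => ?_
  have h2 : E.diag (1 : X.Op) i = 1 := by
    have : E.diag (1 : X.Op) i = inner ℂ (E.b i) (E.b i) := rfl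
    rw [this, inner_self_eq_norm_sq_to_K, E.b.orthonormal.1 i]
    simp
  rw [h2, one_mul, norm_ofReal_cpow_neg (E.lam_pos i), Complex.natCast_re,
    Real.rpow_neg (E.lam_pos i).le, Real.rpow_natCast, inv_pow]

/-- The noncommutative integral vanishes on operators with summable diagonal. -/
theorem ncint_eq_zero_of_summable {T : X.Op} (hT : T ∈ X.residual) {ι : Type*}
    (E : X.EigenBasis ι) (h : Summable (E.diag T)) : X.ncint T = 0 :=
  (E.dirichletResidue_of_hasResidue (hasResidue_ncint hT)).unique
    (E.dirichletResidue_of_summable h)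

end RegularSpectralTriple

namespace RegularSpectralTriple

variable {A : Type*} [Ring A] [StarRing A] [Algebra ℂ A] [StarModule ℂ A]
  {H : Type*} [NormedAddCommGroup H] [InnerProductSpace ℂ H] [CompleteSpace H]
  (X : RegularSpectralTriple A H)

/-! ### Algebraic identities -/

/-- The commutator `[F, a]`. -/
def fComm (a : A) : X.Op := X.F * X.rep a - X.rep a * X.F

theorem fComm_mul (a a' : A) :
    X.fComm (a * a') = X.fComm a * X.rep a' + X.rep a * X.fComm a' := by
  simp only [fComm, rep_mul, mul_sub, sub_mul, mul_assoc]; abel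

theorem delta_iterate_sub (k : ℕ) (S T : X.Op) :
    X.delta^[k] (S - T) = X.delta^[k] S - X.delta^[k] T := by
  simp only [delta_iterate, map_sub]

theorem F_mul_delta_iterate (k : ℕ) (a : A) : X.F * X.delta^[k] (X.rep a) =
    X.delta^[k] (X.rep a) * X.F + X.delta^[k] (X.fComm a) := by
  rw [fComm, delta_iterate_sub, delta_iterate_F_mul, delta_iterate_mul_F]; abel

/-- Up to a term with a trace class factor, `[D, a]` is `δ(a) F`. -/
theorem dComm_eq (a : A) : X.dComm a = X.delta (X.rep a) * X.F + X.abs * X.fComm a := by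
  rw [dComm, ← X.abs_mul_F]
  simp only [fComm, delta, mul_sub, sub_mul, mul_assoc]; abel

theorem delta_iterate_dComm (k : ℕ) (a : A) : X.delta^[k] (X.dComm a) =
    X.delta^[k + 1] (X.rep a) * X.F + X.abs * X.delta^[k] (X.fComm a) := by
  rw [dComm_eq, delta_iterate, map_add, ← delta_iterate, ← delta_iterate, delta_iterate_mul_F,
    delta_iterate_abs_mul, Function.iterate_succ_apply]

theorem nabla_eq (T : X.Op) : X.nabla T = 2 • (X.delta T * X.abs) + X.delta (X.delta T) := by
  rw [nabla, dirac_sq]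
  simp only [delta, pow_two, mul_sub, sub_mul, mul_assoc, two_smul]; abel

theorem delta_mul_abs (T : X.Op) : X.delta (T * X.abs) = X.delta T * X.abs := by
  simp only [delta, sub_mul, mul_assoc]

theorem abs_mul_absInv_pow_succ (m : ℕ) : X.abs * X.absInv ^ (m + 1) = X.absInv ^ m := by
  rw [pow_succ', ← mul_assoc, X.abs_mul_absInv, one_mul]

theorem phi₁Term_zero (a₀ a₁ : A) :
    X.phi₁Term 0 a₀ a₁ = X.rep a₀ * X.delta^[0] (X.dComm a₁) * X.absInv ^ 1 := rfl

theorem phi₁Term_one (a₀ a₁ : A) : X.phi₁Term 1 a₀ a₁ =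
    (2 : ℂ) • (X.rep a₀ * X.delta^[1] (X.dComm a₁) * X.absInv ^ 2) +
      X.rep a₀ * X.delta^[2] (X.dComm a₁) * X.absInv ^ 3 := by
  simp only [phi₁Term, Function.iterate_succ_apply, Function.iterate_zero_apply]
  rw [nabla_eq, two_smul, two_smul]
  simp only [mul_add, add_mul, mul_assoc]
  rw [X.abs_mul_absInv_pow_succ]

theorem phi₁Term_two (a₀ a₁ : A) : X.phi₁Term 2 a₀ a₁ =
    (4 : ℂ) • (X.rep a₀ * X.delta^[2] (X.dComm a₁) * X.absInv ^ 3) +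
      (4 : ℂ) • (X.rep a₀ * X.delta^[3] (X.dComm a₁) * X.absInv ^ 4) +
      X.rep a₀ * X.delta^[4] (X.dComm a₁) * X.absInv ^ 5 := by
  simp only [phi₁Term, Function.iterate_succ_apply, Function.iterate_zero_apply]
  rw [nabla_eq, nabla_eq]
  simp only [two_smul, delta_add, delta_mul_abs, mul_add, add_mul, mul_assoc]
  rw [X.abs_mul_absInv_pow_succ, X.abs_mul_absInv_pow_succ]
  have : ∀ T : X.Op, (4 : ℂ) • T = T + T + T + T := fun T => by module
  rw [this, this]
  abel

theorem psi₁Term_eq (k : ℕ) (a₀ a₁ : A) : X.psi₁Term k a₀ a₁ =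
    (1 / 2 : ℂ) • (X.rep a₀ * X.delta^[k] (X.rep a₁) * X.absInv ^ k +
      X.rep a₀ * X.delta^[k] (X.rep a₁) * X.F * X.absInv ^ k) := by
  rw [psi₁Term, P, mul_smul_comm, smul_mul_assoc, mul_add, mul_one, add_mul]

variable {X} {Sd : Set ℂ}

/-! ### Trace property of the noncommutative integral -/

section

variable (hSd : X.HasSimpleDimensionSpectrum Sd) (h3 : ∀ s ∈ Sd, s.re ≤ 3)
  (hF : ∀ a : A, X.IsTraceClassOp (X.fComm a))

theorem diag_add {ι : Type*} (E : X.EigenBasis ι) (S T : X.Op) :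
    E.diag (S + T) = E.diag S + E.diag T := funext fun i => E.mat_add S T i i

include hSd h3 in
theorem hasResidue_zero_of_four_le {T T' : X.Op} (hT : T ∈ X.psiZero)
    (hT' : T' = T ∨ T' = T * X.F) {m : ℕ} (hm : 4 ≤ m) : X.HasResidue (T' * X.absInv ^ m) 0 := by
  have h := hasResidue_ncint (hSd.mul_absInv_pow_mem_residual hT hT' m)
  rwa [hSd.ncint_mul_absInv_pow_eq_zero h3 hT hT' hm] at h

include hSd in
theorem hasResidue_of_mem_psiZero {T T' : X.Op} (hT : T ∈ X.psiZero)
    (hT' : T' = T ∨ T' = T * X.F) (m : ℕ) :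
    X.HasResidue (T' * X.absInv ^ m) (X.ncint (T' * X.absInv ^ m)) :=
  hasResidue_ncint (hSd.mul_absInv_pow_mem_residual hT hT' m)

include hSd h3 hF in
/-- The functional `T ↦ ncint (T F |D|⁻³)` is tracial when one factor is `δ^j(a)` with `j ≤ 3`. -/
theorem ncint_mul_swap {V : X.Op} (hV : V ∈ X.psiZero) (a : A) {j : ℕ} (hj : j ≤ 3) :
    X.ncint (X.delta^[j] (X.rep a) * V * X.F * X.absInv ^ 3) =
      X.ncint (V * X.delta^[j] (X.rep a) * X.F * X.absInv ^ 3) := by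
  obtain ⟨ι, ⟨E⟩⟩ := X.exists_eigenBasis
  obtain ⟨M, hM⟩ := hSd.exists_summable_lam_inv_pow E
  set Y := X.delta^[j] (X.rep a) with hY
  have hYΨ : Y ∈ X.psiZero := X.delta_iterate_rep_mem_psiZero j a
  have hYδ : ∀ k, X.delta^[k] Y ∈ X.psiZero := fun k => by
    rw [hY, ← Function.iterate_add_apply]
    exact X.delta_iterate_rep_mem_psiZero _ a
  have hVb := X.psiZero_le_boundedDeltas hV
  have hYb := X.psiZero_le_boundedDeltas hYΨ
  have e1 : ∀ (k m : ℕ), E.diag (X.F * V * X.delta^[k] Y * X.absInv ^ m) =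
      E.diag (V * X.delta^[k] Y * X.F * X.absInv ^ m) := by
    intro k m
    funext i
    simp only [SpectralTriple.EigenBasis.diag]
    rw [E.mat_mul_absInv_pow, E.mat_mul_absInv_pow, mul_assoc X.F, E.mat_F_mul, E.mat_mul_F,
      mul_comm (E.sgn i)]
  have h1 := E.dirichletResidue_mul_swap (isBoundedOp_of_mem (mul_mem X.F_mem_boundedDeltas hVb))
    hYb (by omega) hM 3 (r := fun k => if k = 0 then X.ncint (V * Y * X.F * X.absInv ^ 3) else 0)
    (by
      intro k _
      rw [e1]
      refine E.dirichletResidue_of_hasResidue ?_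
      split_ifs with hk
      · subst hk
        exact hasResidue_of_mem_psiZero hSd (mul_mem hV hYΨ) (Or.inr rfl) 3
      · exact hasResidue_zero_of_four_le hSd h3 (mul_mem hV (hYδ k)) (Or.inr rfl) (by omega))
  have h2 : ∑ k ∈ Finset.range (M + 4), negChoose k (3 : ℕ) *
      (if k = 0 then X.ncint (V * Y * X.F * X.absInv ^ 3) else 0) =
      X.ncint (V * Y * X.F * X.absInv ^ 3) := by
    simp [negChoose]
  rw [h2] at h1
  have h4 : DirichletResidue E.lam
      (E.diag (X.delta^[j] (X.fComm a) * V * X.absInv ^ 3)) 0 := by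
    refine E.dirichletResidue_of_summable ?_
    have := summable_diag_mul_delta_iterate_mul (hF a) E (one_mem _) hVb
      (p := 0) (k := j) (q := 0) (m := 3) (by omega)
    simpa using this
  have h5 := h1.add h4
  have e2 : E.diag (Y * V * X.F * X.absInv ^ 3) = E.diag (Y * (X.F * V) * X.absInv ^ 3) +
      E.diag (X.delta^[j] (X.fComm a) * V * X.absInv ^ 3) := by
    rw [← diag_add, ← add_mul, ← mul_assoc, ← add_mul, ← X.F_mul_delta_iterate]
    funext i
    simp only [SpectralTriple.EigenBasis.diag]
    rw [E.mat_mul_absInv_pow, E.mat_mul_absInv_pow, mul_assoc X.F, E.mat_F_mul, E.mat_mul_F,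
      mul_comm (E.sgn i)]
  rw [← e2, add_zero] at h5
  exact (E.dirichletResidue_of_hasResidue
    (hasResidue_of_mem_psiZero hSd (mul_mem hYΨ hV) (Or.inr rfl) 3)).unique h5

include hSd in
/-- The noncommutative integral of a total derivative vanishes. -/
theorem ncint_delta_mul_F_eq_zero {T : X.Op} (hT : X.delta T ∈ X.psiZero) :
    X.ncint (X.delta T * X.F * X.absInv ^ 3) = 0 := by
  obtain ⟨ι, ⟨E⟩⟩ := X.exists_eigenBasis
  refine ncint_eq_zero_of_summable (hSd.mul_absInv_pow_mem_residual hT (Or.inr rfl) 3) E ?_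
  convert summable_zero with i
  have h : E.mat (X.delta T) i i = 0 := E.diag_delta T i
  rw [SpectralTriple.EigenBasis.diag, E.mat_mul_absInv_pow, E.mat_mul_F, h, zero_mul, zero_mul]

theorem sum_eq_sum_range_three {M : ℕ} {f : ℕ → ℂ} (hf : ∀ k, 3 ≤ k → f k = 0) :
    ∑ k ∈ Finset.range (M + 3), f k = f 0 + f 1 + f 2 := by
  rw [← Finset.sum_subset (Finset.range_mono (show 3 ≤ M + 3 by omega))
    fun k _ hk => hf k (by simpa using hk)]
  simp [Finset.sum_range_succ]

variable (h0 : (0 : ℂ) ∉ Sd)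

include hSd h3 h0 in
/-- The coboundary of the zeta value at `0`, expressed through residues. -/
theorem zetaAtZero_mul_sub (a₀ a₁ : A) :
    X.zetaAtZero (X.rep (a₀ * a₁)) - X.zetaAtZero (X.rep (a₁ * a₀)) =
      X.ncint (X.rep a₀ * X.delta^[1] (X.rep a₁) * X.absInv ^ 1) -
      1 / 2 * X.ncint (X.rep a₀ * X.delta^[2] (X.rep a₁) * X.absInv ^ 2) +
      1 / 3 * X.ncint (X.rep a₀ * X.delta^[3] (X.rep a₁) * X.absInv ^ 3) := by
  obtain ⟨ι, ⟨E⟩⟩ := X.exists_eigenBasis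
  obtain ⟨M, hM⟩ := hSd.exists_summable_lam_inv_pow E
  have hrep := X.delta_iterate_rep_mem_psiZero
  have hval : ∀ a : A, DirichletValue E.lam (E.diag (X.rep a)) (X.zetaAtZero (X.rep a)) :=
    fun a => E.dirichletValue_of_hasZetaValue (hasZetaValue_zetaAtZero
      (hSd.exists_hasZetaValue h0 (hrep 0 a) (Or.inl rfl)))
  have hv := hval (a₀ * a₁)
  rw [rep_mul] at hv
  have hmem : ∀ k, X.rep a₀ * X.delta^[k] (X.rep a₁) ∈ X.psiZero := fun k =>
    mul_mem (hrep 0 a₀) (hrep k a₁)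
  have h1 := E.dirichletValue_mul_swap (isBoundedOp_of_mem (X.rep_mem_boundedDeltas a₀))
    (X.rep_mem_boundedDeltas a₁) (N := M + 3) hM hv fun k _ =>
    E.dirichletResidue_of_hasResidue
      (hasResidue_of_mem_psiZero hSd (hmem (k + 1)) (Or.inl rfl) (k + 1))
  rw [sum_eq_sum_range_three fun k hk => by
    rw [hSd.ncint_mul_absInv_pow_eq_zero h3 (hmem (k + 1)) (Or.inl rfl) (by omega), mul_zero],
    ← rep_mul] at h1
  rw [rep_mul, (hval (a₁ * a₀)).unique h1, ← rep_mul]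
  norm_num
  ring

include hSd h3 h0 hF in
/-- The cochain with integrands `a₀ δ^k(a₁) F |D|^{-k}` is the sum of a coboundary and of the
cocycle `Tr (a₀ [F, a₁])`. -/
theorem ncint_F_eq {ι : Type*} (E : X.EigenBasis ι) (a₀ a₁ : A) :
    X.ncint (X.rep a₀ * X.delta^[1] (X.rep a₁) * X.F * X.absInv ^ 1) -
      1 / 2 * X.ncint (X.rep a₀ * X.delta^[2] (X.rep a₁) * X.F * X.absInv ^ 2) +
      1 / 3 * X.ncint (X.rep a₀ * X.delta^[3] (X.rep a₁) * X.F * X.absInv ^ 3) =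
    X.zetaAtZero (X.rep (a₀ * a₁) * X.F) - X.zetaAtZero (X.rep (a₁ * a₀) * X.F) +
      ∑' i, E.diag (X.rep a₀ * X.fComm a₁) i := by
  obtain ⟨M, hM⟩ := hSd.exists_summable_lam_inv_pow E
  have hrep := X.delta_iterate_rep_mem_psiZero
  have ha₀ := X.rep_mem_boundedDeltas a₀
  have hval : ∀ a : A, DirichletValue E.lam (E.diag (X.rep a * X.F))
      (X.zetaAtZero (X.rep a * X.F)) :=
    fun a => E.dirichletValue_of_hasZetaValue (hasZetaValue_zetaAtZero
      (hSd.exists_hasZetaValue h0 (hrep 0 a) (Or.inr rfl)))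
  have hmem : ∀ k, X.rep a₀ * X.delta^[k] (X.rep a₁) ∈ X.psiZero := fun k =>
    mul_mem (hrep 0 a₀) (hrep k a₁)
  have hcomm : ∀ k m : ℕ, E.diag (X.rep a₀ * X.F * X.delta^[k] (X.rep a₁) * X.absInv ^ m) =
      E.diag (X.rep a₀ * X.delta^[k] (X.rep a₁) * X.F * X.absInv ^ m) +
        E.diag (X.rep a₀ * X.delta^[k] (X.fComm a₁) * X.absInv ^ m) := by
    intro k m
    rw [← diag_add, mul_assoc (X.rep a₀), F_mul_delta_iterate, mul_add, add_mul, ← mul_assoc]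
  have hsum : ∀ k m : ℕ, k ≤ m →
      Summable (E.diag (X.rep a₀ * X.delta^[k] (X.fComm a₁) * X.absInv ^ m)) := by
    intro k m hkm
    have := summable_diag_mul_delta_iterate_mul (hF a₁) E ha₀ (one_mem _)
      (p := 0) (k := k) (q := 0) (m := m) (by omega)
    simpa using this
  have hv : DirichletValue E.lam (E.diag (X.rep a₀ * X.F * X.rep a₁))
      (X.zetaAtZero (X.rep (a₀ * a₁) * X.F) + ∑' i, E.diag (X.rep a₀ * X.fComm a₁) i) := by
    have h1 := hcomm 0 0
    have h2 := hsum 0 0 le_rfl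
    simp only [Function.iterate_zero_apply, pow_zero, mul_one] at h1 h2
    rw [h1, ← rep_mul]
    exact (hval _).add (E.dirichletValue_of_summable h2)
  have h1 := E.dirichletValue_mul_swap
    (isBoundedOp_of_mem (mul_mem ha₀ X.F_mem_boundedDeltas))
    (X.rep_mem_boundedDeltas a₁) (N := M + 3) hM hv
    (r := fun k => X.ncint (X.rep a₀ * X.delta^[k + 1] (X.rep a₁) * X.F * X.absInv ^ (k + 1)))
    fun k _ => by
      rw [hcomm]
      have h2 := (E.dirichletResidue_of_hasResidue (hasResidue_of_mem_psiZero hSd (hmem (k + 1))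
        (Or.inr rfl) (k + 1))).add (E.dirichletResidue_of_summable (hsum (k + 1) (k + 1) le_rfl))
      rwa [add_zero] at h2
  rw [sum_eq_sum_range_three fun k hk => by
    rw [hSd.ncint_mul_absInv_pow_eq_zero h3 (hmem (k + 1)) (Or.inr rfl) (by omega), mul_zero],
    ← mul_assoc, ← rep_mul] at h1
  rw [(hval (a₁ * a₀)).unique h1]
  norm_num
  ring

end

end RegularSpectralTriple

namespace RegularSpectralTriple

variable {A : Type*} [Ring A] [StarRing A] [Algebra ℂ A] [StarModule ℂ A]
  {H : Type*} [NormedAddCommGroup H] [InnerProductSpace ℂ H] [CompleteSpace H]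
  {X : RegularSpectralTriple A H} {Sd : Set ℂ}

theorem ncint_congr_of_summable_sub {T T' : X.Op} (hT : T ∈ X.residual) (hT' : T' ∈ X.residual)
    {ι : Type*} (E : X.EigenBasis ι) (h : Summable (E.diag (T - T'))) :
    X.ncint T = X.ncint T' := by
  obtain ⟨L, hL⟩ := X.exists_linearMap_eq_ncint
  have h1 := ncint_eq_zero_of_summable (sub_mem hT hT') E h
  rwa [← hL _ (sub_mem hT hT'), map_sub, hL _ hT, hL _ hT', sub_eq_zero] at h1

section

variable (hSd : X.HasSimpleDimensionSpectrum Sd) (h3 : ∀ s ∈ Sd, s.re ≤ 3)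
  (hF : ∀ a : A, X.IsTraceClassOp (X.fComm a))

include hSd hF in
/-- Under the noncommutative integral, `[D, a]` may be replaced by `δ(a) F`. -/
theorem ncint_delta_iterate_dComm (k : ℕ) (a₀ a₁ : A) :
    X.ncint (X.rep a₀ * X.delta^[k] (X.dComm a₁) * X.absInv ^ (k + 1)) =
      X.ncint (X.rep a₀ * X.delta^[k + 1] (X.rep a₁) * X.F * X.absInv ^ (k + 1)) := by
  obtain ⟨ι, ⟨E⟩⟩ := X.exists_eigenBasis
  have h0 := X.delta_iterate_rep_mem_psiZero 0 a₀
  refine ncint_congr_of_summable_sub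
    (hSd.mul_absInv_pow_mem_residual
      (mul_mem h0 (X.delta_iterate_dComm_mem_psiZero k a₁)) (Or.inl rfl) _)
    (hSd.mul_absInv_pow_mem_residual
      (mul_mem h0 (X.delta_iterate_rep_mem_psiZero (k + 1) a₁)) (Or.inr rfl) _) E ?_
  have h := summable_diag_mul_delta_iterate_mul (hF a₁) E (X.rep_mem_boundedDeltas a₀)
    (one_mem _) (p := 1) (k := k) (q := 0) (m := k + 1) (by omega)
  refine h.congr fun i => ?_
  congr 1
  rw [delta_iterate_dComm, mul_add, add_mul, ← mul_assoc, add_sub_cancel_left]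
  simp [mul_assoc]

include hSd hF in
theorem ncint_phi₃Term (a₀ a₁ a₂ a₃ : A) : X.ncint (X.phi₃Term a₀ a₁ a₂ a₃) =
    X.ncint (X.rep a₀ * X.delta (X.rep a₁) * X.delta (X.rep a₂) * X.delta (X.rep a₃) * X.F *
      X.absInv ^ 3) := by
  obtain ⟨ι, ⟨E⟩⟩ := X.exists_eigenBasis
  have h0 := X.delta_iterate_rep_mem_psiZero 0
  have h1 := X.delta_iterate_rep_mem_psiZero 1
  have hd := X.delta_iterate_dComm_mem_psiZero 0
  refine ncint_congr_of_summable_sub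
    (hSd.mul_absInv_pow_mem_residual
      (mul_mem (mul_mem (mul_mem (h0 a₀) (hd a₁)) (hd a₂)) (hd a₃)) (Or.inl rfl) 3)
    (hSd.mul_absInv_pow_mem_residual
      (mul_mem (mul_mem (mul_mem (h0 a₀) (h1 a₁)) (h1 a₂)) (h1 a₃)) (Or.inr rfl) 3) E ?_
  have bF := X.F_mem_boundedDeltas
  have b0 := X.rep_mem_boundedDeltas
  have b1 : ∀ a, X.delta (X.rep a) ∈ X.boundedDeltas := fun a => delta_mem_boundedDeltas (b0 a)
  have bd := X.dComm_mem_boundedDeltas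
  -- the terms in which one of the commutators is replaced by its trace class part
  have s1 := summable_diag_mul_delta_iterate_mul (hF a₁) E (b0 a₀)
    (mul_mem (bd a₂) (bd a₃)) (p := 1) (k := 0) (q := 0) (m := 3) (by omega)
  have s2 := summable_diag_mul_delta_iterate_mul (hF a₂) E
    (mul_mem (mul_mem (b0 a₀) (b1 a₁)) bF) (bd a₃) (p := 1) (k := 0) (q := 0) (m := 3) (by omega)
  have s3 := summable_diag_mul_delta_iterate_mul (hF a₃) E
    (mul_mem (mul_mem (mul_mem (mul_mem (b0 a₀) (b1 a₁)) bF) (b1 a₂)) bF) (one_mem _)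
    (p := 1) (k := 0) (q := 0) (m := 3) (by omega)
  -- the term that arises when `F` is moved through `δ(a₂)`
  have s4 := summable_diag_mul_delta_iterate_mul (hF a₂) E (mul_mem (b0 a₀) (b1 a₁))
    (mul_mem (mul_mem bF (b1 a₃)) bF) (p := 0) (k := 1) (q := 0) (m := 3) (by omega)
  refine (((s1.add s2).add s3).add s4).congr fun i => ?_
  simp only [SpectralTriple.EigenBasis.diag, ← SpectralTriple.EigenBasis.mat_add]
  congr 1
  have hF2 : X.F * X.delta (X.rep a₂) = X.delta (X.rep a₂) * X.F + X.delta (X.fComm a₂) :=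
    X.F_mul_delta_iterate 1 a₂
  have e : X.rep a₀ * X.dComm a₁ * X.dComm a₂ * X.dComm a₃ =
      X.rep a₀ * X.delta (X.rep a₁) * X.delta (X.rep a₂) * X.delta (X.rep a₃) * X.F +
      (X.rep a₀ * (X.abs * X.fComm a₁) * X.dComm a₂ * X.dComm a₃ +
        X.rep a₀ * X.delta (X.rep a₁) * X.F * (X.abs * X.fComm a₂) * X.dComm a₃ +
        X.rep a₀ * X.delta (X.rep a₁) * X.F * X.delta (X.rep a₂) * X.F *
          (X.abs * X.fComm a₃) +
        X.rep a₀ * X.delta (X.rep a₁) * X.delta (X.fComm a₂) * X.F * X.delta (X.rep a₃) *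
          X.F) := by
    have e1 : X.rep a₀ * X.delta (X.rep a₁) * X.F * X.delta (X.rep a₂) * X.F *
        X.delta (X.rep a₃) * X.F =
        X.rep a₀ * X.delta (X.rep a₁) * X.delta (X.rep a₂) * X.delta (X.rep a₃) * X.F +
        X.rep a₀ * X.delta (X.rep a₁) * X.delta (X.fComm a₂) * X.F * X.delta (X.rep a₃) *
          X.F := by
      rw [mul_assoc (X.rep a₀ * X.delta (X.rep a₁)) X.F, hF2, mul_add, add_mul, add_mul, add_mul,
        ← mul_assoc, mul_assoc _ X.F X.F, X.F_mul_F, mul_one]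
    calc X.rep a₀ * X.dComm a₁ * X.dComm a₂ * X.dComm a₃
        = X.rep a₀ * X.delta (X.rep a₁) * X.F * X.delta (X.rep a₂) * X.F *
            X.delta (X.rep a₃) * X.F +
          (X.rep a₀ * (X.abs * X.fComm a₁) * X.dComm a₂ * X.dComm a₃ +
            X.rep a₀ * X.delta (X.rep a₁) * X.F * (X.abs * X.fComm a₂) * X.dComm a₃ +
            X.rep a₀ * X.delta (X.rep a₁) * X.F * X.delta (X.rep a₂) * X.F *
              (X.abs * X.fComm a₃)) := by
          simp only [dComm_eq, mul_add, add_mul, mul_assoc]; abel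
      _ = _ := by rw [e1]; abel
  rw [phi₃Term, e, add_mul, add_sub_cancel_left]
  simp only [add_mul, mul_assoc, pow_zero, pow_one, mul_one, Function.iterate_succ_apply,
    Function.iterate_zero_apply]

end

/-! ### Multilinearity -/

theorem isCochain_of_linear {n : ℕ} (L : X.Op →ₗ[ℂ] ℂ) (l : Fin (n + 1) → A →ₗ[ℂ] X.Op)
    (c : X.Op) : IsCochain (fun a => L ((List.ofFn fun i => l i (a i)).prod * c)) :=
  ⟨(L ∘ₗ LinearMap.mulRight ℂ c).compMultilinearMap
    ((MultilinearMap.mkPiAlgebraFin ℂ (n + 1) X.Op).compLinearMap l), fun a => by simp⟩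

end RegularSpectralTriple

section Cochains

variable {A : Type*} [Ring A]

theorem IsCochain.add [Algebra ℂ A] {n : ℕ} {φ ψ : Cochain A n} (h : IsCochain φ) (h' : IsCochain ψ) :
    IsCochain (φ + ψ) := by
  obtain ⟨f, hf⟩ := h
  obtain ⟨g, hg⟩ := h'
  exact ⟨f + g, fun a => by simp [hf, hg]⟩

theorem IsCochain.smul [Algebra ℂ A] {n : ℕ} {φ : Cochain A n} (h : IsCochain φ) (c : ℂ) :
    IsCochain (c • φ) := by
  obtain ⟨f, hf⟩ := h
  exact ⟨c • f, fun a => by simp [hf]⟩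

theorem isCochain_zero [Algebra ℂ A] {n : ℕ} : IsCochain (0 : Cochain A n) := ⟨0, fun _ => rfl⟩

theorem hochschild_apply_zero (φ : Cochain A 0) (a : Fin 2 → A) :
    hochschild φ a = φ ![a 0 * a 1] - φ ![a 1 * a 0] := by
  have e1 : Fin.contractNth (0 : Fin 1).castSucc (· * ·) a = ![a 0 * a 1] := by
    funext i; fin_cases i; rfl
  have e2 : (Fin.cons (a (Fin.last 1) * a 0) fun i : Fin 0 => a i.succ.castSucc : Fin 1 → A) =
      ![a 1 * a 0] := by
    funext i; fin_cases i; rfl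
  rw [hochschild, Fin.sum_univ_one, e1, e2]
  simp [sub_eq_add_neg]

theorem hochschild_apply_one (φ : Cochain A 1) (a : Fin 3 → A) :
    hochschild φ a = φ ![a 0 * a 1, a 2] - φ ![a 0, a 1 * a 2] + φ ![a 2 * a 0, a 1] := by
  have e1 : Fin.contractNth (0 : Fin 2).castSucc (· * ·) a = ![a 0 * a 1, a 2] := by
    funext i; fin_cases i <;> rfl
  have e2 : Fin.contractNth (1 : Fin 2).castSucc (· * ·) a = ![a 0, a 1 * a 2] := by
    funext i; fin_cases i <;> rfl
  have e3 : (Fin.cons (a (Fin.last 2) * a 0) fun i : Fin 1 => a i.succ.castSucc : Fin 2 → A) =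
      ![a 2 * a 0, a 1] := by
    funext i; fin_cases i <;> rfl
  rw [hochschild, Fin.sum_univ_two, e1, e2, e3]
  simp [sub_eq_add_neg]

theorem hochschild_apply_two (φ : Cochain A 2) (a : Fin 4 → A) :
    hochschild φ a = φ ![a 0 * a 1, a 2, a 3] - φ ![a 0, a 1 * a 2, a 3] +
      φ ![a 0, a 1, a 2 * a 3] - φ ![a 3 * a 0, a 1, a 2] := by
  have e1 : Fin.contractNth (0 : Fin 3).castSucc (· * ·) a = ![a 0 * a 1, a 2, a 3] := by
    funext i; fin_cases i <;> rfl
  have e2 : Fin.contractNth (1 : Fin 3).castSucc (· * ·) a = ![a 0, a 1 * a 2, a 3] := by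
    funext i; fin_cases i <;> rfl
  have e3 : Fin.contractNth (2 : Fin 3).castSucc (· * ·) a = ![a 0, a 1, a 2 * a 3] := by
    funext i; fin_cases i <;> rfl
  have e4 : (Fin.cons (a (Fin.last 3) * a 0) fun i : Fin 2 => a i.succ.castSucc : Fin 3 → A) =
      ![a 3 * a 0, a 1, a 2] := by
    funext i; fin_cases i <;> rfl
  rw [hochschild, Fin.sum_univ_three, e1, e2, e3, e4]
  norm_num
  ring

theorem connesB_apply_one (φ : Cochain A 2) (a : Fin 2 → A) :
    connesB φ a = φ ![1, a 0, a 1] - φ ![a 0, a 1, 1] - (φ ![1, a 1, a 0] - φ ![a 1, a 0, 1]) := by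
  have e1 : ∀ b : Fin 2 → A, (Fin.cons 1 b : Fin 3 → A) = ![1, b 0, b 1] := fun b => by
    funext i; fin_cases i <;> rfl
  have e2 : ∀ b : Fin 2 → A, (Fin.snoc b 1 : Fin 3 → A) = ![b 0, b 1, 1] := fun b => by
    funext i; fin_cases i <;> rfl
  rw [connesB, cyclicSum, Fin.sum_univ_two]
  simp only [connesB₀, e1, e2]
  simp [sub_eq_add_neg]

theorem hochschild_zero {n : ℕ} : hochschild (0 : Cochain A n) = 0 := by
  funext a; simp [hochschild]

theorem connesB_zero {m : ℕ} : connesB (0 : Cochain A (m + 1)) = 0 := by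
  funext a; simp [connesB, cyclicSum, connesB₀]

end Cochains

namespace RegularSpectralTriple

variable {A : Type*} [Ring A] [StarRing A] [Algebra ℂ A] [StarModule ℂ A]
  {H : Type*} [NormedAddCommGroup H] [InnerProductSpace ℂ H] [CompleteSpace H]
  {X : RegularSpectralTriple A H} {Sd : Set ℂ}

/-! ### The local cochains -/

section

variable (hSd : X.HasSimpleDimensionSpectrum Sd)

include hSd

theorem phi₁Term_mem_residual {k : ℕ} (hk : k ≤ 2) (a₀ a₁ : A) :
    X.phi₁Term k a₀ a₁ ∈ X.residual := by
  have h : ∀ j m, X.rep a₀ * X.delta^[j] (X.dComm a₁) * X.absInv ^ m ∈ X.residual := fun j m =>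
    hSd.mul_absInv_pow_mem_residual (mul_mem (X.delta_iterate_rep_mem_psiZero 0 a₀)
      (X.delta_iterate_dComm_mem_psiZero j a₁)) (Or.inl rfl) m
  interval_cases k
  · exact h 0 1
  · rw [phi₁Term_one]
    exact add_mem (Submodule.smul_mem _ _ (h 1 2)) (h 2 3)
  · rw [phi₁Term_two]
    exact add_mem (add_mem (Submodule.smul_mem _ _ (h 2 3)) (Submodule.smul_mem _ _ (h 3 4)))
      (h 4 5)

theorem phi₃Term_mem_residual (a₀ a₁ a₂ a₃ : A) : X.phi₃Term a₀ a₁ a₂ a₃ ∈ X.residual := by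
  have hd := X.delta_iterate_dComm_mem_psiZero 0
  exact hSd.mul_absInv_pow_mem_residual (mul_mem (mul_mem (mul_mem
    (X.delta_iterate_rep_mem_psiZero 0 a₀) (hd a₁)) (hd a₂)) (hd a₃)) (Or.inl rfl) 3

theorem psi₁Term_mem_residual (k : ℕ) (a₀ a₁ : A) : X.psi₁Term k a₀ a₁ ∈ X.residual := by
  have h := mul_mem (X.delta_iterate_rep_mem_psiZero 0 a₀) (X.delta_iterate_rep_mem_psiZero k a₁)
  rw [psi₁Term_eq]
  exact Submodule.smul_mem _ _ (add_mem
    (hSd.mul_absInv_pow_mem_residual h (Or.inl rfl) k)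
    (hSd.mul_absInv_pow_mem_residual h (Or.inr rfl) k))

theorem phiPrime₂Term_mem_residual (a₀ a₁ a₂ : A) : X.phiPrime₂Term a₀ a₁ a₂ ∈ X.residual :=
  hSd.mul_absInv_pow_mem_residual (mul_mem (mul_mem (X.delta_iterate_rep_mem_psiZero 0 a₀)
    (X.delta_iterate_rep_mem_psiZero 1 a₁)) (X.delta_iterate_rep_mem_psiZero 2 a₂)) (Or.inr rfl) 3

theorem exists_hasZetaValue_rep (h0 : (0 : ℂ) ∉ Sd) (a : A) :
    ∃ v, X.HasZetaValue (X.rep a) v :=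
  hSd.exists_hasZetaValue h0 (X.delta_iterate_rep_mem_psiZero 0 a) (Or.inl rfl)

theorem localCochainsDefined (h0 : (0 : ℂ) ∉ Sd) : X.LocalCochainsDefined where
  phi₁ _ hk a₀ a₁ := phi₁Term_mem_residual hSd hk a₀ a₁
  phi₃ := phi₃Term_mem_residual hSd
  psi₁ k _ _ := psi₁Term_mem_residual hSd k
  phiPrime₀ := exists_hasZetaValue_rep hSd h0
  phiPrime₂ := phiPrime₂Term_mem_residual hSd

theorem isCochain_phiOdd (n : ℕ) : IsCochain (X.phiOdd n) := by
  obtain ⟨L, hL⟩ := X.exists_linearMap_eq_ncint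
  -- the operators `∇` and `[D, ·]` as linear maps
  let nablaHom : X.Op →ₗ[ℂ] X.Op :=
    LinearMap.mulLeft ℂ (X.dirac ^ 2) - LinearMap.mulRight ℂ (X.dirac ^ 2)
  let dCommHom : A →ₗ[ℂ] X.Op :=
    (LinearMap.mulLeft ℂ X.dirac - LinearMap.mulRight ℂ X.dirac) ∘ₗ X.repHom
  have hnabla : ∀ k T, X.nabla^[k] T = (nablaHom ^ k) T := fun k T => by
    rw [Module.End.pow_apply]; rfl
  have h1 : ∀ k ≤ 2, IsCochain fun a : Fin 2 → A => X.ncint (X.phi₁Term k (a 0) (a 1)) := by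
    intro k hk
    have h := isCochain_of_linear L ![X.repHom, (nablaHom ^ k) ∘ₗ dCommHom] (X.absInv ^ (2 * k + 1))
    convert h using 2 with a
    rw [← hL _ (phi₁Term_mem_residual hSd hk _ _), phi₁Term, hnabla]
    simp [List.ofFn_succ, dCommHom, repHom, dComm]
  match n with
  | 0 => exact isCochain_zero
  | 1 =>
    convert ((h1 0 (by omega)).add ((h1 1 (by omega)).smul (-(1 / 4)))).add
      ((h1 2 le_rfl).smul (1 / 8)) using 1
    funext a
    simp only [phiOdd, phi₁, Pi.add_apply, Pi.smul_apply, smul_eq_mul]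
    ring
  | 2 => exact isCochain_zero
  | 3 =>
    have h := (isCochain_of_linear L ![X.repHom, dCommHom, dCommHom, dCommHom]
      (X.absInv ^ 3)).smul (1 / 12)
    convert h using 1
    funext a
    simp only [phiOdd, phi₃, Pi.smul_apply, smul_eq_mul]
    rw [← hL _ (phi₃Term_mem_residual hSd _ _ _ _), phi₃Term]
    simp [List.ofFn_succ, dCommHom, repHom, dComm, mul_assoc]
  | n + 4 => exact isCochain_zero

theorem isCochain_psi₁ : IsCochain X.psi₁ := by
  obtain ⟨L, hL⟩ := X.exists_linearMap_eq_ncint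
  have h1 : ∀ k, IsCochain fun a : Fin 2 → A => X.ncint (X.psi₁Term k (a 0) (a 1)) := by
    intro k
    have h := isCochain_of_linear L ![X.repHom, (X.deltaHom ^ k) ∘ₗ X.repHom] (X.P * X.absInv ^ k)
    convert h using 2 with a
    rw [← hL _ (psi₁Term_mem_residual hSd k _ _), psi₁Term, delta_iterate]
    simp [List.ofFn_succ, repHom, mul_assoc]
  convert (((h1 1).smul 2).add ((h1 2).smul (-1))).add ((h1 3).smul (2 / 3)) using 1
  funext a
  simp only [psi₁, Pi.add_apply, Pi.smul_apply, smul_eq_mul]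
  ring

theorem isCochain_phiPrimeEv (h0 : (0 : ℂ) ∉ Sd) (n : ℕ) : IsCochain (X.phiPrimeEv n) := by
  obtain ⟨L, hL⟩ := X.exists_linearMap_eq_ncint
  match n with
  | 0 =>
    have hv := exists_hasZetaValue_rep hSd h0
    let l : A →ₗ[ℂ] ℂ :=
      { toFun := fun a => X.zetaAtZero (X.rep a)
        map_add' := fun a a' => by
          obtain ⟨f, hf, hr⟩ := hasZetaValue_zetaAtZero (hv a)
          obtain ⟨g, hg, hr'⟩ := hasZetaValue_zetaAtZero (hv a')
          have : X.rep (a + a') = X.rep a + X.rep a' := X.repHom.map_add a a'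
          rw [this]
          exact HasZetaValue.zetaAtZero_eq ⟨f + g, hf.add hg, hr.add hr'⟩
        map_smul' := fun c a => by
          obtain ⟨f, hf, hr⟩ := hasZetaValue_zetaAtZero (hv a)
          have : X.rep (c • a) = c • X.rep a := X.repHom.map_smul c a
          rw [this]
          exact HasZetaValue.zetaAtZero_eq ⟨_, hf.smul c, hr.const_mul c⟩ }
    exact ⟨l.compMultilinearMap (MultilinearMap.mkPiAlgebraFin ℂ 1 A), fun a => by
      simp [l, phiPrimeEv, phiPrime₀]⟩
  | 1 => exact isCochain_zero
  | 2 =>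
    have h := (isCochain_of_linear L ![X.repHom, X.deltaHom ∘ₗ X.repHom,
      (X.deltaHom ^ 2) ∘ₗ X.repHom] (X.F * X.absInv ^ 3)).smul (-(1 / 24))
    convert h using 1
    funext a
    simp only [phiPrimeEv, phiPrime₂, Pi.smul_apply, smul_eq_mul]
    rw [← hL _ (phiPrime₂Term_mem_residual hSd _ _ _), phiPrime₂Term, delta_iterate]
    simp [List.ofFn_succ, repHom, deltaHom, mul_assoc]
  | n + 3 => exact isCochain_zero

theorem psi₁_apply (a : Fin 2 → A) : X.psi₁ a =
    (X.ncint (X.rep (a 0) * X.delta^[1] (X.rep (a 1)) * X.absInv ^ 1) -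
      1 / 2 * X.ncint (X.rep (a 0) * X.delta^[2] (X.rep (a 1)) * X.absInv ^ 2) +
      1 / 3 * X.ncint (X.rep (a 0) * X.delta^[3] (X.rep (a 1)) * X.absInv ^ 3)) +
    (X.ncint (X.rep (a 0) * X.delta^[1] (X.rep (a 1)) * X.F * X.absInv ^ 1) -
      1 / 2 * X.ncint (X.rep (a 0) * X.delta^[2] (X.rep (a 1)) * X.F * X.absInv ^ 2) +
      1 / 3 * X.ncint (X.rep (a 0) * X.delta^[3] (X.rep (a 1)) * X.F * X.absInv ^ 3)) := by
  obtain ⟨L, hL⟩ := X.exists_linearMap_eq_ncint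
  have h : ∀ k, X.ncint (X.psi₁Term k (a 0) (a 1)) =
      1 / 2 * (X.ncint (X.rep (a 0) * X.delta^[k] (X.rep (a 1)) * X.absInv ^ k) +
        X.ncint (X.rep (a 0) * X.delta^[k] (X.rep (a 1)) * X.F * X.absInv ^ k)) := by
    intro k
    have hm := mul_mem (X.delta_iterate_rep_mem_psiZero 0 (a 0))
      (X.delta_iterate_rep_mem_psiZero k (a 1))
    rw [← hL _ (psi₁Term_mem_residual hSd k _ _), psi₁Term_eq, map_smul, map_add, smul_eq_mul]
    congr 2
    · exact hL _ (hSd.mul_absInv_pow_mem_residual hm (Or.inl rfl) k)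
    · exact hL _ (hSd.mul_absInv_pow_mem_residual hm (Or.inr rfl) k)
  rw [psi₁, h, h, h]
  ring

variable (h3 : ∀ s ∈ Sd, s.re ≤ 3) (hF : ∀ a : A, X.IsTraceClassOp (X.fComm a))

include h3 hF

theorem phi₁_apply (a : Fin 2 → A) : X.phi₁ a =
    X.ncint (X.rep (a 0) * X.delta^[1] (X.rep (a 1)) * X.F * X.absInv ^ 1) -
      1 / 2 * X.ncint (X.rep (a 0) * X.delta^[2] (X.rep (a 1)) * X.F * X.absInv ^ 2) +
      1 / 4 * X.ncint (X.rep (a 0) * X.delta^[3] (X.rep (a 1)) * X.F * X.absInv ^ 3) := by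
  obtain ⟨L, hL⟩ := X.exists_linearMap_eq_ncint
  have hm : ∀ k, X.rep (a 0) * X.delta^[k] (X.dComm (a 1)) ∈ X.psiZero := fun k =>
    mul_mem (X.delta_iterate_rep_mem_psiZero 0 (a 0))
      (X.delta_iterate_dComm_mem_psiZero k (a 1))
  have hL' : ∀ k m, L (X.rep (a 0) * X.delta^[k] (X.dComm (a 1)) * X.absInv ^ m) =
      X.ncint (X.rep (a 0) * X.delta^[k] (X.dComm (a 1)) * X.absInv ^ m) := fun k m =>
    hL _ (hSd.mul_absInv_pow_mem_residual (hm k) (Or.inl rfl) m)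
  have e := ncint_delta_iterate_dComm hSd hF
  rw [phi₁, ← hL _ (phi₁Term_mem_residual hSd (by omega : 1 ≤ 2) _ _),
    ← hL _ (phi₁Term_mem_residual hSd le_rfl _ _), phi₁Term_one, phi₁Term_two, phi₁Term_zero]
  simp only [map_add, map_smul, smul_eq_mul, hL']
  rw [hSd.ncint_mul_absInv_pow_eq_zero h3 (hm 3) (Or.inl rfl) le_rfl,
    hSd.ncint_mul_absInv_pow_eq_zero h3 (hm 4) (Or.inl rfl) (by omega), e 0, e 1, e 2]
  ring

theorem connesB_phiPrime₂ (a : Fin 2 → A) : connesB X.phiPrime₂ a =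
    1 / 12 * X.ncint (X.rep (a 0) * X.delta^[3] (X.rep (a 1)) * X.F * X.absInv ^ 3) := by
  obtain ⟨L, hL⟩ := X.exists_linearMap_eq_ncint
  have hr := X.delta_iterate_rep_mem_psiZero
  have hL' : ∀ T ∈ X.psiZero, L (T * X.F * X.absInv ^ 3) = X.ncint (T * X.F * X.absInv ^ 3) :=
    fun T hT => hL _ (hSd.mul_absInv_pow_mem_residual hT (Or.inr rfl) 3)
  have hone : ∀ b c : A, X.ncint (X.phiPrime₂Term b c 1) = 0 := by
    intro b c
    rw [← hL _ (phiPrime₂Term_mem_residual hSd _ _ _), phiPrime₂Term, rep_one]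
    simp [delta]
  have hleft : ∀ b c : A, X.phiPrime₂Term 1 b c =
      X.delta^[1] (X.rep b) * X.delta^[2] (X.rep c) * X.F * X.absInv ^ 3 := by
    intro b c
    rw [phiPrime₂Term, rep_one, one_mul]
    rfl
  -- integration by parts
  have hparts : ∀ i j : ℕ, L (X.delta^[i + 1] (X.rep (a 0)) * X.delta^[j] (X.rep (a 1)) * X.F *
      X.absInv ^ 3) = - L (X.delta^[i] (X.rep (a 0)) * X.delta^[j + 1] (X.rep (a 1)) * X.F *
      X.absInv ^ 3) := by
    intro i j
    have hd : X.delta (X.delta^[i] (X.rep (a 0)) * X.delta^[j] (X.rep (a 1))) =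
        X.delta^[i + 1] (X.rep (a 0)) * X.delta^[j] (X.rep (a 1)) +
          X.delta^[i] (X.rep (a 0)) * X.delta^[j + 1] (X.rep (a 1)) := by
      rw [delta_mul, Function.iterate_succ_apply', Function.iterate_succ_apply']
    have hmem : X.delta (X.delta^[i] (X.rep (a 0)) * X.delta^[j] (X.rep (a 1))) ∈ X.psiZero := by
      rw [hd]
      exact add_mem (mul_mem (hr _ _) (hr _ _)) (mul_mem (hr _ _) (hr _ _))
    have h := ncint_delta_mul_F_eq_zero hSd hmem
    rw [← hL' _ hmem, hd, add_mul, add_mul, map_add] at h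
    exact eq_neg_of_add_eq_zero_left h
  have h1 : X.ncint (X.phiPrime₂Term 1 (a 0) (a 1)) =
      - X.ncint (X.rep (a 0) * X.delta^[3] (X.rep (a 1)) * X.F * X.absInv ^ 3) := by
    rw [hleft, ← hL' _ (mul_mem (hr 1 _) (hr 2 _)), hparts 0 2]
    exact congrArg Neg.neg (hL' _ (mul_mem (hr 0 _) (hr 3 _)))
  have h2 : X.ncint (X.phiPrime₂Term 1 (a 1) (a 0)) =
      X.ncint (X.rep (a 0) * X.delta^[3] (X.rep (a 1)) * X.F * X.absInv ^ 3) := by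
    rw [hleft, ncint_mul_swap hSd h3 hF (hr 2 _) _ (by omega),
      ← hL' _ (mul_mem (hr 2 _) (hr 1 _)), hparts 1 1, hparts 0 2, neg_neg]
    exact hL' _ (mul_mem (hr 0 _) (hr 3 _))
  rw [connesB_apply_one]
  simp only [phiPrime₂, Matrix.cons_val_zero, Matrix.cons_val_one, Matrix.cons_val]
  rw [hone, hone, h1, h2]
  ring

theorem phi₃_eq_neg_hochschild : X.phi₃ = - hochschild X.phiPrime₂ := by
  obtain ⟨L, hL⟩ := X.exists_linearMap_eq_ncint
  have hr := X.delta_iterate_rep_mem_psiZero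
  have hL' : ∀ T ∈ X.psiZero, X.ncint (T * X.F * X.absInv ^ 3) = L (T * X.F * X.absInv ^ 3) :=
    fun T hT => (hL _ (hSd.mul_absInv_pow_mem_residual hT (Or.inr rfl) 3)).symm
  funext a
  have hmem3 : X.rep (a 0) * X.delta (X.rep (a 1)) * X.delta (X.rep (a 2)) *
      X.delta (X.rep (a 3)) ∈ X.psiZero :=
    mul_mem (mul_mem (mul_mem (hr 0 _) (hr 1 _)) (hr 1 _)) (hr 1 _)
  have hmem2 : X.rep (a 0) * X.delta (X.rep (a 1)) * X.delta^[2] (X.rep (a 2)) ∈ X.psiZero :=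
    mul_mem (mul_mem (hr 0 _) (hr 1 _)) (hr 2 _)
  have hswap := ncint_mul_swap hSd h3 hF hmem2 (a 3) (j := 0) (by omega)
  rw [hL' _ (mul_mem (hr 0 _) hmem2), hL' _ (mul_mem hmem2 (hr 0 _))] at hswap
  rw [Pi.neg_apply, hochschild_apply_two]
  simp only [phi₃, phiPrime₂, Matrix.cons_val_zero, Matrix.cons_val_one, Matrix.cons_val]
  rw [ncint_phi₃Term hSd hF, hL' _ hmem3]
  simp only [← hL _ (phiPrime₂Term_mem_residual hSd _ _ _)]
  simp only [phiPrime₂Term, rep_mul, Function.iterate_succ_apply, Function.iterate_zero_apply,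
    delta_mul, delta_add, mul_add, add_mul, map_add, mul_assoc] at hswap ⊢
  rw [hswap]
  ring

variable (h0 : (0 : ℂ) ∉ Sd)

include h0

theorem phi₁_eq : X.phi₁ = X.psi₁ - (hochschild X.phiPrime₀ + connesB X.phiPrime₂) := by
  funext a
  rw [Pi.sub_apply, Pi.add_apply, phi₁_apply hSd h3 hF, psi₁_apply hSd,
    connesB_phiPrime₂ hSd h3 hF, hochschild_apply_zero]
  have h := zetaAtZero_mul_sub hSd h3 h0 (a 0) (a 1)
  simp only [phiPrime₀, Matrix.cons_val_zero]
  rw [h]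
  ring

/-- `ψ₁` is cohomologous to the cyclic cocycle `Tr (a₀ [F, a₁])`. -/
theorem psi₁_eq {ι : Type*} (E : X.EigenBasis ι) (a : Fin 2 → A) : X.psi₁ a =
    (X.zetaAtZero (X.rep (a 0 * a 1)) + X.zetaAtZero (X.rep (a 0 * a 1) * X.F)) -
      (X.zetaAtZero (X.rep (a 1 * a 0)) + X.zetaAtZero (X.rep (a 1 * a 0) * X.F)) +
      ∑' i, E.diag (X.rep (a 0) * X.fComm (a 1)) i := by
  rw [psi₁_apply hSd, ncint_F_eq hSd h3 hF h0 E, ← zetaAtZero_mul_sub hSd h3 h0]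
  ring

theorem isCyclicCocycle_psi₁ : IsCyclicCocycle X.psi₁ := by
  obtain ⟨ι, ⟨E⟩⟩ := X.exists_eigenBasis
  have hψ := psi₁_eq hSd h3 hF h0 E
  have hb : ∀ a, X.IsBoundedOp (X.rep a) := fun a =>
    isBoundedOp_of_mem (X.rep_mem_boundedDeltas a)
  have hs1 : ∀ a b, Summable (E.diag (X.rep a * X.fComm b)) := fun a b =>
    E.summable_diag_of_isTraceClassOp ((hF b).mul_left (hb a))
  have hs2 : ∀ a b, Summable (E.diag (X.fComm a * X.rep b)) := fun a b =>
    E.summable_diag_of_isTraceClassOp ((hF a).mul_right (hb b))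
  refine ⟨isCochain_psi₁ hSd, fun a => ?_, ?_⟩
  · have h1 : ∑' i, E.diag (X.rep (a 0) * X.fComm (a 1)) i +
        ∑' i, E.diag (X.rep (a 1) * X.fComm (a 0)) i = 0 := by
      rw [(hF (a 0)).tsum_diag_mul_comm (hb (a 1)) E, add_comm,
        ← (hs2 _ _).tsum_add (hs1 _ _)]
      -- the diagonal of the commutator `[F, a₀ a₁]` vanishes
      refine (tsum_congr fun i => ?_).trans tsum_zero
      have h2 := congrFun (diag_add E (X.fComm (a 0) * X.rep (a 1))
        (X.rep (a 0) * X.fComm (a 1))) i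
      rw [← fComm_mul] at h2
      refine h2.symm.trans ?_
      rw [SpectralTriple.EigenBasis.diag, fComm, E.mat_sub, E.mat_F_mul, E.mat_mul_F]
      ring
    have e0 : (0 : Fin 2) - 1 = 1 := rfl
    rw [hψ, hψ]
    simp only [e0, sub_self]
    linear_combination h1
  · funext a
    have h1 : ∑' i, E.diag (X.rep (a 0) * X.fComm (a 1 * a 2)) i =
        ∑' i, E.diag (X.rep (a 2 * a 0) * X.fComm (a 1)) i +
          ∑' i, E.diag (X.rep (a 0 * a 1) * X.fComm (a 2)) i := by
      have hT := (hF (a 1)).mul_left (hb (a 0))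
      rw [rep_mul, mul_assoc, hT.tsum_diag_mul_comm (hb (a 2)) E,
        ← (E.summable_diag_of_isTraceClassOp (hT.mul_right (hb (a 2)))).tsum_add (hs1 _ _)]
      refine tsum_congr fun i => ?_
      rw [fComm_mul, mul_add, rep_mul, mul_assoc, mul_assoc]
      exact congrFun (diag_add E _ _) i
    rw [hochschild_apply_one, hψ, hψ, hψ]
    simp only [Matrix.cons_val_zero, Matrix.cons_val_one, Matrix.cons_val_fin_one, mul_assoc,
      Pi.zero_apply]
    rw [h1]
    ring

end

end RegularSpectralTriple

end LocalIndex

end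

theorem mainTheorem2
    {A : Type*} [Ring A] [StarRing A] [Algebra ℂ A] [StarModule ℂ A]
    {H : Type*} [NormedAddCommGroup H] [InnerProductSpace ℂ H] [CompleteSpace H]
    (X : LocalIndex.RegularSpectralTriple A H) (Sd : Set ℂ)
    (hSd : X.HasSimpleDimensionSpectrum Sd) (h0 : (0 : ℂ) ∉ Sd) (h3 : ∀ s ∈ Sd, s.re ≤ 3)
    (hF : ∀ a : A, X.IsTraceClassOp (X.F * X.rep a - X.rep a * X.F)) :
    X.LocalCochainsDefined ∧
      (∀ n, LocalIndex.IsCochain (X.phiOdd n)) ∧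
      (∀ n, LocalIndex.IsCochain (X.phiPrimeEv n)) ∧
      LocalIndex.IsCyclicCocycle X.psi₁ ∧
      X.phiOdd = X.psiOdd - LocalIndex.totalBoundary X.phiPrimeEv := by
  refine ⟨LocalIndex.RegularSpectralTriple.localCochainsDefined hSd h0,
    LocalIndex.RegularSpectralTriple.isCochain_phiOdd hSd,
    LocalIndex.RegularSpectralTriple.isCochain_phiPrimeEv hSd h0,
    LocalIndex.RegularSpectralTriple.isCyclicCocycle_psi₁ hSd h3 hF h0, ?_⟩
  funext n
  match n with
  | 0 =>
    change (0 : LocalIndex.Cochain A 0) =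
      0 - LocalIndex.connesB (0 : LocalIndex.Cochain A 1)
    rw [LocalIndex.connesB_zero, sub_zero]
  | 1 => exact LocalIndex.RegularSpectralTriple.phi₁_eq hSd h3 hF h0
  | 2 =>
    change (0 : LocalIndex.Cochain A 2) = 0 - (LocalIndex.hochschild (0 : LocalIndex.Cochain A 1) +
      LocalIndex.connesB (0 : LocalIndex.Cochain A 3))
    rw [LocalIndex.connesB_zero, LocalIndex.hochschild_zero, add_zero, sub_zero]
  | 3 =>
    change X.phi₃ = 0 - (LocalIndex.hochschild X.phiPrime₂ +
      LocalIndex.connesB (0 : LocalIndex.Cochain A 4))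
    rw [LocalIndex.connesB_zero, add_zero, zero_sub]
    exact LocalIndex.RegularSpectralTriple.phi₃_eq_neg_hochschild hSd h3 hF
  | n + 4 =>
    change (0 : LocalIndex.Cochain A (n + 4)) =
      0 - (LocalIndex.hochschild (0 : LocalIndex.Cochain A (n + 3)) +
        LocalIndex.connesB (0 : LocalIndex.Cochain A (n + 5)))
    rw [LocalIndex.connesB_zero, LocalIndex.hochschild_zero, add_zero, sub_zero]
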